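/- Let $(M,g)$ be a smooth Riemannian manifold, let $K\subset M$ be compact, let $\beta\le t_0\le\psi$ be real numbers, and let $(g_k(x,t),H_k(x,t))_k$ be a collection of smooth solutions to the generalized Ricci flow (GRF), each defined on an open neighborhood $W_k\subset M\times\mathbb R$ of $K\times[\beta,\psi]$. That is, on $W_k$ the $g_k(t)$ are Riemannian metrics, the $H_k(t)$ are $3$-forms, both are smooth in $(x,t)$, and $$\partial_t g_{ij}=-2R_{ij}+\tfrac12 g^{kp}g^{lq}H_{ikl}H_{jpq},\qquad \partial_t H=\square_{g(t)}H,\qquad \square_g=-(dd^*_g+d^*_gd),$$ where $R_{ij}$ is the Ricci tensor of $g(t)$. For a metric $\bar g$ write ${}^{\bar g}\nabla$ for its Levi-Civita connection and $|\cdot|_{\bar g}$ for its norm on tensors. Suppose that there are constants $C$, $(C_p)_{p\ge1}$, $(C'_p)_{p\ge0}$, independent of $k$, such that (i) $C^{-1}g(x)(V,V)\le g_k(x,t_0)(V,V)\le C\,g(x)(V,V)$ for all $k$, $x\in K$, $V\in T_xM$; (ii) $|{}^{g}\nabla^{p}g_k(x,t_0)|_{g(x)}+|{}^{g}\nabla^{p-1}H_k(x,t_0)|_{g(x)}\le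 C_p$ for all $k$, $p\ge1$, $x\in K$; (iii) $|{}^{g_k}\nabla^{p}\mathrm{Rm}(g_k(x,t))|_{g_k(x,t)}+|{}^{g_k}\nabla^{p}H_k(x,t)|_{g_k(x,t)}\le C'_p$ for all $k$, $p\ge0$, $(x,t)\in K\times[\beta,\psi]$. Then there is a constant $C'$ independent of $k$ such that, with the same $C$ as in (i) and $B(t,t_0)=Ce^{C'|t-t_0|}$, $$B(t,t_0)^{-1}g(x)(V,V)\le g_k(x,t)(V,V)\le B(t,t_0)\,g(x)(V,V)$$ for all $k$, $(x,t)\in K\times[\beta,\psi]$ and $V\in T_xM$; and for all integers $p,q\ge0$ there is a constant $\widetilde C_{p,q}$ independent of $k$ such that $$\left|\frac{\partial^{q}}{\partial t^{q}}{}^{g}\nabla^{p}g_k(x,t)\right|_{g(x)}+\left|\frac{\partial^{q}}{\partial t^{q}}{}^{g}\nabla^{p}H_k(x,t)\right|_{g(x)}\le\widetilde C_{p,q}$$ for all $k$ and all $(x,t)\in K\times[\beta,\psi]$. -/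

import Mathlib

open Set Manifold ContDiff

noncomputable section

namespace GRF

/-! ### Tensor calculus in a coordinate chart of dimension `n` -/

/-- Components `T_{i₁ … i_r}(y)` of a covariant tensor field of rank `r` in local coordinates
`y ∈ ℝⁿ`. -/
abbrev CoordTensor (n r : ℕ) : Type :=
  EuclideanSpace ℝ (Fin n) → (Fin r → Fin n) → ℝ

/-- The partial derivative `∂f/∂yᵃ`. -/
def pd {n : ℕ} (a : Fin n) (f : EuclideanSpace ℝ (Fin n) → ℝ)
    (y : EuclideanSpace ℝ (Fin n)) : ℝ :=
  fderiv ℝ f y (EuclideanSpace.single a 1)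

/-- The components `gⁱʲ` of the inverse of the metric `g_{ij}`. -/
def invMetric {n : ℕ} (G : CoordTensor n 2) (y : EuclideanSpace ℝ (Fin n)) (i j : Fin n) : ℝ :=
  (Matrix.of fun a b => G y ![a, b])⁻¹ i j

/-- The Christoffel symbols
`Γᶜ_{ab} = ½ gᶜᵈ (∂_a g_{bd} + ∂_b g_{ad} - ∂_d g_{ab})`. -/
def christoffel {n : ℕ} (G : CoordTensor n 2) (y : EuclideanSpace ℝ (Fin n))
    (c a b : Fin n) : ℝ :=
  (1 / 2) * ∑ d, invMetric G y c d *
    (pd a (fun z => G z ![b, d]) y + pd b (fun z => G z ![a, d]) y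
      - pd d (fun z => G z ![a, b]) y)

/-- The covariant derivative of a covariant tensor field with respect to the Levi-Civita
connection of `G`; the differentiation index is the first one:
`∇_a T_{i₁ … i_r} = ∂_a T_{i₁ … i_r} - ∑_s Γᶜ_{a i_s} T_{i₁ … c … i_r}`. -/
def covDeriv {n r : ℕ} (G : CoordTensor n 2) (T : CoordTensor n r) : CoordTensor n (r + 1) :=
  fun y I =>
    pd (I 0) (fun z => T z (Fin.tail I)) y
      - ∑ s : Fin r, ∑ c : Fin n,
          christoffel G y c (I 0) (Fin.tail I s) * T y (Function.update (Fin.tail I) s c)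

/-- The iterated covariant derivative `∇ᵖ T`. -/
def iterCovDeriv {n r : ℕ} (G : CoordTensor n 2) (T : CoordTensor n r) :
    (p : ℕ) → CoordTensor n (r + p)
  | 0 => T
  | p + 1 => covDeriv G (iterCovDeriv G T p)

/-- The norm of a covariant tensor with components `T` at the point `y`:
`|T|² = g^{i₁ j₁} ⋯ g^{i_r j_r} T_{i₁ … i_r} T_{j₁ … j_r}`. -/
def tensorNorm {n r : ℕ} (G : CoordTensor n 2) (y : EuclideanSpace ℝ (Fin n))
    (T : (Fin r → Fin n) → ℝ) : ℝ :=
  Real.sqrt (∑ I : Fin r → Fin n, ∑ J : Fin r → Fin n,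
    (∏ s : Fin r, invMetric G y (I s) (J s)) * T I * T J)

/-- The components `R_{ij}{}ᵐ{}_k := ⟨dyᵐ, ∇_j ∇_i ∂_k - ∇_i ∇_j ∂_k⟩` of the Riemann curvature
operator with lower indices `i j k` and upper index `m`. -/
def riemannOp {n : ℕ} (G : CoordTensor n 2) (y : EuclideanSpace ℝ (Fin n))
    (m i j k : Fin n) : ℝ :=
  pd j (fun z => christoffel G z m i k) y - pd i (fun z => christoffel G z m j k) y
    + ∑ p, (christoffel G y p i k * christoffel G y m j p
      - christoffel G y p j k * christoffel G y m i p)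

/-- The Riemann curvature tensor `R_{ijkl}`, with the sign for which `R_{ijij} > 0` (for `i ≠ j`,
in an orthonormal frame) on round spheres. -/
def riemann {n : ℕ} (G : CoordTensor n 2) : CoordTensor n 4 :=
  fun y I => ∑ m, G y ![I 3, m] * riemannOp G y m (I 0) (I 1) (I 2)

/-- The Ricci tensor `R_{ij} = gᵏˡ R_{ikjl}`. -/
def ricci {n : ℕ} (G : CoordTensor n 2) : CoordTensor n 2 :=
  fun y I => ∑ k, ∑ l, invMetric G y k l * riemann G y ![I 0, k, I 1, l]

/-- The symmetric tensor `h_{ij} = gᵏᵖ gˡ𐞥 H_{ikl} H_{jpq}`. -/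
def hTensor {n : ℕ} (G : CoordTensor n 2) (H : CoordTensor n 3) : CoordTensor n 2 :=
  fun y I => ∑ k, ∑ p, ∑ l, ∑ q,
    invMetric G y k p * invMetric G y l q * H y ![I 0, k, l] * H y ![I 1, p, q]

/-- The exterior derivative of a form of degree `r`:
`(dα)_{i₀ … i_r} = ∑_s (-1)ˢ ∂_{i_s} α_{i₀ … î_s … i_r}`. -/
def extD {n r : ℕ} (α : CoordTensor n r) : CoordTensor n (r + 1) :=
  fun y I => ∑ s : Fin (r + 1), (-1 : ℝ) ^ (s : ℕ) *
    pd (I s) (fun z => α z (fun u => I (s.succAbove u))) y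

/-- The adjoint `d*` of `d` with respect to the metric:
`(d*α)_{i₁ … i_r} = - gʲᵏ ∇_j α_{k i₁ … i_r}`. -/
def codiff {n r : ℕ} (G : CoordTensor n 2) (α : CoordTensor n (r + 1)) : CoordTensor n r :=
  fun y I => - ∑ j, ∑ k, invMetric G y j k *
    covDeriv G α y (Fin.cons j (Fin.cons k I : Fin (r + 1) → Fin n) : Fin (r + 2) → Fin n)

/-- The Laplace-Beltrami operator `□ = -(d d* + d* d)` on forms of positive degree. -/
def laplaceBeltrami {n r : ℕ} (G : CoordTensor n 2) (α : CoordTensor n (r + 1)) : CoordTensor n (r + 1) :=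
  fun y I => -(extD (codiff G α) y I + codiff G (extD α) y I)

/-! ### Tensor fields on a manifold -/

variable {n : ℕ} {M : Type*} [TopologicalSpace M] [ChartedSpace (EuclideanSpace ℝ (Fin n)) M]

/-- A family of bilinear forms on the tangent spaces (a covariant tensor field of rank two). -/
abbrev BilinField (n : ℕ) (M : Type*) [TopologicalSpace M]
    [ChartedSpace (EuclideanSpace ℝ (Fin n)) M] :=
  ∀ x : M, TangentSpace (𝓡 n) x →L[ℝ] TangentSpace (𝓡 n) x →L[ℝ] ℝ

/-- A 3-form: a family of alternating trilinear forms on the tangent spaces. -/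
abbrev ThreeForm (n : ℕ) (M : Type*) [TopologicalSpace M]
    [ChartedSpace (EuclideanSpace ℝ (Fin n)) M] :=
  ∀ x : M, TangentSpace (𝓡 n) x [⋀^Fin 3]→L[ℝ] ℝ

/-- The coordinate vector field `∂/∂yⁱ` of the chart `e`, at the point with coordinates `y`. -/
def coordVec (e : OpenPartialHomeomorph M (EuclideanSpace ℝ (Fin n)))
    (y : EuclideanSpace ℝ (Fin n)) (i : Fin n) : TangentSpace (𝓡 n) (e.symm y) :=
  mfderiv (𝓡 n) (𝓡 n) e.symm y (EuclideanSpace.single i (1 : ℝ))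

/-- The components `g_{ij}` of a field of bilinear forms in the chart `e`. -/
def bilinComp (e : OpenPartialHomeomorph M (EuclideanSpace ℝ (Fin n)))
    (g : BilinField n M) : CoordTensor n 2 :=
  fun y I => g (e.symm y) (coordVec e y (I 0)) (coordVec e y (I 1))

/-- The components `H_{ijk}` of a 3-form in the chart `e`. -/
def formComp (e : OpenPartialHomeomorph M (EuclideanSpace ℝ (Fin n)))
    (H : ThreeForm n M) : CoordTensor n 3 :=
  fun y I => H (e.symm y) (fun s => coordVec e y (I s))

/-- `(g(t), H(t))` is a smooth solution to the generalized Ricci flow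
`∂g/∂t = -2 Ric(g) + h / 2`, `∂H/∂t = □_{g(t)} H`
on the set `W` of space-time (an open subset of `M × ℝ` in applications): on `W`, the `g(t)` are
Riemannian metrics, both tensors are smooth in space and time together, and the two evolution
equations hold. Nothing is required off `W`. Tensor fields are smooth if their components in the
charts of the atlas are, and a tensor equation is an equation of components in every chart. -/
structure IsSolutionOn (W : Set (M × ℝ)) (g : ℝ → BilinField n M)
    (H : ℝ → ThreeForm n M) : Prop where
  symm : ∀ x t, (x, t) ∈ W → ∀ v w : TangentSpace (𝓡 n) x, g t x v w = g t x w v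
  pos : ∀ x t, (x, t) ∈ W → ∀ v : TangentSpace (𝓡 n) x, v ≠ 0 → 0 < g t x v v
  smooth_metric : ∀ e ∈ atlas (EuclideanSpace ℝ (Fin n)) M, ∀ I : Fin 2 → Fin n,
    ContDiffOn ℝ ∞ (fun z : EuclideanSpace ℝ (Fin n) × ℝ => bilinComp e (g z.2) z.1 I)
      {z | z.1 ∈ e.target ∧ (e.symm z.1, z.2) ∈ W}
  smooth_form : ∀ e ∈ atlas (EuclideanSpace ℝ (Fin n)) M, ∀ I : Fin 3 → Fin n,
    ContDiffOn ℝ ∞ (fun z : EuclideanSpace ℝ (Fin n) × ℝ => formComp e (H z.2) z.1 I)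
      {z | z.1 ∈ e.target ∧ (e.symm z.1, z.2) ∈ W}
  evol_metric : ∀ e ∈ atlas (EuclideanSpace ℝ (Fin n)) M, ∀ y ∈ e.target, ∀ t,
    (e.symm y, t) ∈ W → ∀ I : Fin 2 → Fin n,
      HasDerivAt (fun s => bilinComp e (g s) y I)
        (-2 * ricci (bilinComp e (g t)) y I
          + (1 / 2) * hTensor (bilinComp e (g t)) (formComp e (H t)) y I) t
  evol_form : ∀ e ∈ atlas (EuclideanSpace ℝ (Fin n)) M, ∀ y ∈ e.target, ∀ t,
    (e.symm y, t) ∈ W → ∀ I : Fin 3 → Fin n,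
      HasDerivAt (fun s => formComp e (H s) y I)
        (laplaceBeltrami (bilinComp e (g t)) (formComp e (H t)) y I) t

/-! ### Pointwise norms

The norms below are computed in the preferred chart at `x`; as all the quantities are tensors, any
other chart around `x` gives the same value. -/

/-- `|ᵍ∇ᵖ a|_g (x)` for a field `a` of bilinear forms. -/
def normCovBilin (g a : BilinField n M) (p : ℕ) (x : M) : ℝ :=
  let e := chartAt (EuclideanSpace ℝ (Fin n)) x
  tensorNorm (bilinComp e g) (e x) (iterCovDeriv (bilinComp e g) (bilinComp e a) p (e x))

/-- `|ᵍ∇ᵖ H|_g (x)` for a 3-form `H`. -/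
def normCovForm (g : BilinField n M) (H : ThreeForm n M) (p : ℕ) (x : M) : ℝ :=
  let e := chartAt (EuclideanSpace ℝ (Fin n)) x
  tensorNorm (bilinComp e g) (e x) (iterCovDeriv (bilinComp e g) (formComp e H) p (e x))

/-- `|ᵍ∇ᵖ Rm(g)|_g (x)`. -/
def normCovRm (g : BilinField n M) (p : ℕ) (x : M) : ℝ :=
  let e := chartAt (EuclideanSpace ℝ (Fin n)) x
  tensorNorm (bilinComp e g) (e x)
    (iterCovDeriv (bilinComp e g) (riemann (bilinComp e g)) p (e x))

/-- `|∂𐞥/∂t𐞥 ᵍ∇ᵖ a(t)|_g (x)` for a time-dependent field `a` of bilinear forms and a fixed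
metric `g`. -/
def normTimeCovBilin (g : BilinField n M) (a : ℝ → BilinField n M) (q p : ℕ) (x : M)
    (t : ℝ) : ℝ :=
  let e := chartAt (EuclideanSpace ℝ (Fin n)) x
  tensorNorm (bilinComp e g) (e x) fun I =>
    iteratedDeriv q (fun s => iterCovDeriv (bilinComp e g) (bilinComp e (a s)) p (e x) I) t

/-- `|∂𐞥/∂t𐞥 ᵍ∇ᵖ H(t)|_g (x)` for a time-dependent 3-form `H` and a fixed metric `g`. -/
def normTimeCovForm (g : BilinField n M) (H : ℝ → ThreeForm n M) (q p : ℕ) (x : M)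
    (t : ℝ) : ℝ :=
  let e := chartAt (EuclideanSpace ℝ (Fin n)) x
  tensorNorm (bilinComp e g) (e x) fun I =>
    iteratedDeriv q (fun s => iterCovDeriv (bilinComp e g) (formComp e (H s)) p (e x) I) t

end GRF

end

namespace GRF

/-! ### Partial derivatives -/

section PartialDerivatives

variable {n : ℕ}

/-! The uniform equivalence comes from the flow equation alone. In an orthonormal frame of `g_k(t)`,
Ric(V,V) is a sum of n values of Rm and h(V,V) a sum of n² squares of values of H, so the time
derivative of `g_k(V,V)` is at most `C'` times `g_k(V,V)`, with `C'` depending only on n and the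
bound for Rm and H (`abs_ricci_le`, `abs_hTensor_le`). Integrating in both time directions gives the
exponential factor (`exp_bounds_of_abs_deriv_le`).

The derivative bounds are proved for partial derivatives of components in a fixed coordinate ball,
by induction on the spatial order. Suppose the derivatives of `g_k` up to order p are bounded, and
let w be the sum of the absolute values of those of order p+1. The covariant derivatives of Rm and H
are bounded to every order by hypothesis, and ∂T = ∇T + Γ∗T, so p+1 partial derivatives of Rm or H
involve Γ only to order p, hence `g_k` only to order p+1, and its top order only linearly
(`JetBdd.of_iterCovDeriv`). Thus ∂ₜ∂^{p+1}g = ∂^{p+1}(-2 Ric + h/2) is O(1 + w): no derivative is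
lost although Ric contains two derivatives of the metric. Grönwall's inequality, started from the
bounds at time t₀, closes the induction (`LocalSolution.jetBdd_succ`). The form H is then bounded to
every spatial order, and time derivatives follow because the flow equations trade each of them for
spatial ones (`LocalSolution.timeJetBdd`).

Three passages surround this argument. Norms are read off in the preferred chart of each point,
which varies with the point without any uniformity, so they are first moved to one chart near each
point. This needs the transformation laws of the connection and of the curvature
(`IsPullback.christoffel_eq`, `IsPullback.riemannOp_eq`, `tensorNorm_eq_of_pullback`). On a closed
coordinate ball the jets of the background metric are bounded, so background covariant derivatives
and partial derivatives control each other. Compactness of K leaves finitely many balls. -/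

theorem pd_congr {f g : EuclideanSpace ℝ (Fin n) → ℝ} {y : EuclideanSpace ℝ (Fin n)} (a : Fin n)
    (h : f =ᶠ[nhds y] g) : pd a f y = pd a g y := by
  unfold pd
  rw [h.fderiv_eq]

theorem pd_congr_of_eqOn {f g : EuclideanSpace ℝ (Fin n) → ℝ} {y : EuclideanSpace ℝ (Fin n)}
    {U : Set (EuclideanSpace ℝ (Fin n))} (hU : IsOpen U) (hy : y ∈ U) (a : Fin n)
    (h : ∀ z ∈ U, f z = g z) : pd a f y = pd a g y :=
  pd_congr a (Filter.eventually_of_mem (hU.mem_nhds hy) h)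

theorem pd_sub {f g : EuclideanSpace ℝ (Fin n) → ℝ} {y : EuclideanSpace ℝ (Fin n)} (a : Fin n)
    (hf : DifferentiableAt ℝ f y) (hg : DifferentiableAt ℝ g y) :
    pd a (fun z => f z - g z) y = pd a f y - pd a g y := by
  unfold pd
  rw [fderiv_fun_sub hf hg]; rfl

theorem pd_mul {f g : EuclideanSpace ℝ (Fin n) → ℝ} {y : EuclideanSpace ℝ (Fin n)} (a : Fin n)
    (hf : DifferentiableAt ℝ f y) (hg : DifferentiableAt ℝ g y) :
    pd a (fun z => f z * g z) y = pd a f y * g y + f y * pd a g y := by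
  unfold pd
  rw [fderiv_fun_mul hf hg]
  simp; ring

theorem pd_sum {α : Type*} {s : Finset α} {f : α → EuclideanSpace ℝ (Fin n) → ℝ}
    {y : EuclideanSpace ℝ (Fin n)} (a : Fin n)
    (hf : ∀ i ∈ s, DifferentiableAt ℝ (f i) y) :
    pd a (fun z => ∑ i ∈ s, f i z) y = ∑ i ∈ s, pd a (f i) y := by
  unfold pd
  rw [fderiv_fun_sum hf]
  simp

theorem pd_prod {α : Type*} [DecidableEq α] {s : Finset α} {f : α → EuclideanSpace ℝ (Fin n) → ℝ}
    {y : EuclideanSpace ℝ (Fin n)} (a : Fin n)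
    (hf : ∀ i ∈ s, DifferentiableAt ℝ (f i) y) :
    pd a (fun z => ∏ i ∈ s, f i z) y = ∑ i ∈ s, pd a (f i) y * ∏ j ∈ s.erase i, f j y := by
  unfold pd
  rw [(HasFDerivAt.finsetProd fun i hi => (hf i hi).hasFDerivAt).fderiv]
  simp [mul_comm]

theorem fderiv_eq_sum_pd (f : EuclideanSpace ℝ (Fin n) → ℝ) (y v : EuclideanSpace ℝ (Fin n)) :
    fderiv ℝ f y v = ∑ b, v b * pd b f y := by
  have hv : v = ∑ b, v b • EuclideanSpace.single b (1 : ℝ) := by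
    ext i
    simp [Finset.sum_apply, Pi.single_apply]
  conv_lhs => rw [hv]
  simp [pd]

theorem pd_comp {f : EuclideanSpace ℝ (Fin n) → ℝ}
    {φ : EuclideanSpace ℝ (Fin n) → EuclideanSpace ℝ (Fin n)} {y : EuclideanSpace ℝ (Fin n)}
    (a : Fin n) (hf : DifferentiableAt ℝ f (φ y)) (hφ : DifferentiableAt ℝ φ y) :
    pd a (fun z => f (φ z)) y = ∑ b, pd a (fun z => φ z b) y * pd b f (φ y) := by
  have h1 : fderiv ℝ (fun z => f (φ z)) y = (fderiv ℝ f (φ y)).comp (fderiv ℝ φ y) :=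
    fderiv_comp y hf hφ
  have h2 : ∀ b, pd a (fun z => φ z b) y = fderiv ℝ φ y (EuclideanSpace.single a 1) b := by
    intro b
    have := ((EuclideanSpace.proj (𝕜 := ℝ) b).hasFDerivAt.comp y hφ.hasFDerivAt).fderiv
    unfold pd
    have h3 : (fun z => φ z b) = (EuclideanSpace.proj (𝕜 := ℝ) b) ∘ φ := rfl
    rw [h3, this]; rfl
  simp only [h2]
  unfold pd
  rw [h1, ContinuousLinearMap.comp_apply, fderiv_eq_sum_pd]
  rfl

theorem contDiffOn_pd {f : EuclideanSpace ℝ (Fin n) → ℝ} {U : Set (EuclideanSpace ℝ (Fin n))}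
    (hU : IsOpen U) (hf : ContDiffOn ℝ ∞ f U) (a : Fin n) : ContDiffOn ℝ ∞ (pd a f) U := by
  have h := hf.fderiv_of_isOpen hU (m := ∞) (by simp)
  exact h.clm_apply contDiffOn_const

theorem differentiableAt_of_contDiffOn {f : EuclideanSpace ℝ (Fin n) → ℝ}
    {U : Set (EuclideanSpace ℝ (Fin n))} {y : EuclideanSpace ℝ (Fin n)}
    (hU : IsOpen U) (hf : ContDiffOn ℝ ∞ f U) (hy : y ∈ U) : DifferentiableAt ℝ f y :=
  (hf.contDiffAt (hU.mem_nhds hy)).differentiableAt (by simp)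

theorem pd_comm {f : EuclideanSpace ℝ (Fin n) → ℝ} {U : Set (EuclideanSpace ℝ (Fin n))}
    (hU : IsOpen U) (hf : ContDiffOn ℝ ∞ f U) {y : EuclideanSpace ℝ (Fin n)} (hy : y ∈ U)
    (a b : Fin n) : pd a (pd b f) y = pd b (pd a f) y := by
  have hc := hf.contDiffAt (hU.mem_nhds hy)
  have hs : IsSymmSndFDerivAt ℝ f y := hc.isSymmSndFDerivAt (by simp; exact WithTop.coe_le_coe.2 le_top)
  have hd : DifferentiableAt ℝ (fderiv ℝ f) y :=
    (hc.fderiv_right (m := 1) (by norm_cast)).differentiableAt (by simp)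
  have key : ∀ v w : EuclideanSpace ℝ (Fin n),
      fderiv ℝ (fun z => fderiv ℝ f z v) y w = fderiv ℝ (fderiv ℝ f) y w v := by
    intro v w
    have := (hd.hasFDerivAt.clm_apply (hasFDerivAt_const v y)).fderiv
    rw [this]; simp
  unfold pd
  rw [key, key]
  exact hs _ _

end PartialDerivatives

/-! ### Behaviour of coordinate tensors under a change of coordinates -/

section Pullback

variable {n r : ℕ}

/-- The Jacobian matrix `∂φʲ/∂yⁱ`. -/
noncomputable def jac (φ : EuclideanSpace ℝ (Fin n) → EuclideanSpace ℝ (Fin n))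
    (y : EuclideanSpace ℝ (Fin n)) (j i : Fin n) : ℝ :=
  pd i (fun z => φ z j) y

/-- On `U`, the tensor field `T'` is the pullback of `T` under `φ`. -/
def IsPullback (φ : EuclideanSpace ℝ (Fin n) → EuclideanSpace ℝ (Fin n))
    (U : Set (EuclideanSpace ℝ (Fin n))) (T' T : CoordTensor n r) : Prop :=
  ∀ y ∈ U, ∀ I, T' y I = ∑ J : Fin r → Fin n, (∏ s, jac φ y (J s) (I s)) * T (φ y) J

/-- Smoothness of all the components of a tensor field. -/
def SmoothTensorOn (U : Set (EuclideanSpace ℝ (Fin n))) (T : CoordTensor n r) : Prop :=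
  ∀ I, ContDiffOn ℝ ∞ (fun z => T z I) U

theorem contDiffOn_jac {φ : EuclideanSpace ℝ (Fin n) → EuclideanSpace ℝ (Fin n)}
    {U : Set (EuclideanSpace ℝ (Fin n))} (hU : IsOpen U) (hφ : ContDiffOn ℝ ∞ φ U) (j i : Fin n) :
    ContDiffOn ℝ ∞ (fun y => jac φ y j i) U :=
  contDiffOn_pd hU ((contDiffOn_euclidean.1 hφ) j) i

theorem pd_jac_comm {φ : EuclideanSpace ℝ (Fin n) → EuclideanSpace ℝ (Fin n)}
    {U : Set (EuclideanSpace ℝ (Fin n))} (hU : IsOpen U) (hφ : ContDiffOn ℝ ∞ φ U)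
    {y : EuclideanSpace ℝ (Fin n)} (hy : y ∈ U) (a b j : Fin n) :
    pd a (fun z => jac φ z j b) y = pd b (fun z => jac φ z j a) y :=
  pd_comm hU ((contDiffOn_euclidean.1 hφ) j) hy a b

theorem sum_fin_succ_fun {n r : ℕ} (f : (Fin (r + 1) → Fin n) → ℝ) :
    ∑ J, f J = ∑ d, ∑ J : Fin r → Fin n, f (Fin.cons d J) := by
  rw [← Fintype.sum_prod_type']
  exact (Fintype.sum_equiv (Fin.consEquiv fun _ => Fin n) _ _ fun _ => rfl).symm

/-- The map (J, e) ↦ (`Function.update J s e`, J s) is an involution. It exchanges the tensor index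
replaced by a Christoffel term with the index summed in that term. -/
theorem sum_update_swap {n r : ℕ} (s : Fin r) (f : (Fin r → Fin n) → Fin n → ℝ) :
    ∑ J, ∑ e, f J e = ∑ J, ∑ e, f (Function.update J s e) (J s) := by
  rw [← Fintype.sum_prod_type', ← Fintype.sum_prod_type']
  refine Finset.sum_bij' (fun p _ => (Function.update p.1 s p.2, p.1 s))
    (fun p _ => (Function.update p.1 s p.2, p.1 s)) ?_ ?_ ?_ ?_ ?_ <;> simp

theorem prod_update_right {n r : ℕ} (F : Fin n → Fin n → ℝ) (J i : Fin r → Fin n) (s : Fin r)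
    (c : Fin n) :
    ∏ u, F (J u) (Function.update i s c u)
      = F (J s) c * ∏ u ∈ Finset.univ.erase s, F (J u) (i u) := by
  rw [← Finset.mul_prod_erase _ _ (Finset.mem_univ s)]
  congr 1
  · simp
  · exact Finset.prod_congr rfl fun u hu => by rw [Function.update_of_ne (Finset.ne_of_mem_erase hu)]

theorem prod_update_left {n r : ℕ} (F : Fin n → Fin n → ℝ) (J i : Fin r → Fin n) (s : Fin r)
    (c : Fin n) :
    ∏ u ∈ Finset.univ.erase s, F (Function.update J s c u) (i u)
      = ∏ u ∈ Finset.univ.erase s, F (J u) (i u) :=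
  Finset.prod_congr rfl fun u hu => by rw [Function.update_of_ne (Finset.ne_of_mem_erase hu)]

/-- The covariant derivative commutes with pullback if the Christoffel symbols transform as those
of a connection. -/
theorem IsPullback.covDeriv_of_christoffel
    {φ : EuclideanSpace ℝ (Fin n) → EuclideanSpace ℝ (Fin n)}
    {U V : Set (EuclideanSpace ℝ (Fin n))} (hU : IsOpen U) (hV : IsOpen V)
    (hφ : ContDiffOn ℝ ∞ φ U) (hm : MapsTo φ U V) {G' G : CoordTensor n 2}
    (hΓ : ∀ y ∈ U, ∀ f a b, ∑ c, christoffel G' y c a b * jac φ y f c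
      = (∑ d, ∑ e, christoffel G (φ y) f d e * jac φ y d a * jac φ y e b)
        + pd a (fun z => jac φ z f b) y)
    {T' T : CoordTensor n r} (hT : SmoothTensorOn V T) (h : IsPullback φ U T' T) :
    IsPullback φ U (covDeriv G' T') (covDeriv G T) := by
  intro y hy I
  set a := I 0 with ha
  set i : Fin r → Fin n := Fin.tail I with hi
  set F : Fin n → Fin n → ℝ := jac φ y with hF
  have hφd : DifferentiableAt ℝ φ y :=
    (hφ.contDiffAt (hU.mem_nhds hy)).differentiableAt (by simp)
  have hTd : ∀ J, DifferentiableAt ℝ (fun z => T z J) (φ y) := fun J =>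
    differentiableAt_of_contDiffOn hV (hT J) (hm hy)
  have hFd : ∀ j k, DifferentiableAt ℝ (fun z => jac φ z j k) y := fun j k =>
    differentiableAt_of_contDiffOn hU (contDiffOn_jac hU hφ j k) hy
  have hprodd : ∀ J : Fin r → Fin n,
      DifferentiableAt ℝ (fun z => ∏ s, jac φ z (J s) (i s)) y := fun J =>
    (HasFDerivAt.finsetProd (u := Finset.univ) (g := fun s z => jac φ z (J s) (i s))
      fun s _ => (hFd _ _).hasFDerivAt).differentiableAt
  have hTφ : ∀ J, DifferentiableAt ℝ (fun z => T (φ z) J) y := fun J =>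
    (hTd J).comp y hφd
  -- Leibniz: the derivative falls on a Jacobian factor, producing second derivatives of φ, or on T
  -- ∘ φ.
  have h1 : pd a (fun z => T' z i) y = ∑ J : Fin r → Fin n,
      ((∑ s, pd a (fun z => jac φ z (J s) (i s)) y
          * ∏ u ∈ Finset.univ.erase s, F (J u) (i u)) * T (φ y) J
        + (∏ s, F (J s) (i s)) * ∑ d, F d a * pd d (fun z => T z J) (φ y)) := by
    rw [pd_congr_of_eqOn hU hy a fun z hz => h z hz i,
      pd_sum a fun J _ => (hprodd J).fun_mul (hTφ J)]
    refine Finset.sum_congr rfl fun J _ => ?_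
    rw [pd_mul a (hprodd J) (hTφ J), pd_prod a fun s _ => hFd _ _,
      pd_comp a (hTd J) hφd]
    rfl
  -- The inhomogeneous term of the law for Γ produces exactly the second derivatives of φ that occur
  -- in `h1`; they cancel in the covariant derivative.
  have h2 : ∀ s : Fin r, ∑ c, christoffel G' y c a (i s) * T' y (Function.update i s c)
      = ∑ J : Fin r → Fin n, ((∑ d, ∑ e, christoffel G (φ y) (J s) d e * F d a * F e (i s))
        + pd a (fun z => jac φ z (J s) (i s)) y)
          * ((∏ u ∈ Finset.univ.erase s, F (J u) (i u)) * T (φ y) J) := by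
    intro s
    have : ∀ c, christoffel G' y c a (i s) * T' y (Function.update i s c)
        = ∑ J : Fin r → Fin n, (christoffel G' y c a (i s) * F (J s) c)
          * ((∏ u ∈ Finset.univ.erase s, F (J u) (i u)) * T (φ y) J) := by
      intro c
      rw [h y hy, Finset.mul_sum]
      refine Finset.sum_congr rfl fun J _ => ?_
      rw [prod_update_right]
      ring
    rw [Finset.sum_congr rfl fun c _ => this c, Finset.sum_comm]
    refine Finset.sum_congr rfl fun J _ => ?_
    rw [← Finset.sum_mul, hΓ y hy]
  have h3 : ∀ (s : Fin r) (d : Fin n), ∑ J : Fin r → Fin n, ∑ e,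
      christoffel G (φ y) (J s) d e * F d a * F e (i s)
        * ((∏ u ∈ Finset.univ.erase s, F (J u) (i u)) * T (φ y) J)
      = ∑ J : Fin r → Fin n, F d a * (∏ u, F (J u) (i u))
        * ∑ c, christoffel G (φ y) c d (J s) * T (φ y) (Function.update J s c) := by
    intro s d
    rw [sum_update_swap s]
    refine Finset.sum_congr rfl fun J _ => ?_
    rw [Finset.mul_sum]
    refine Finset.sum_congr rfl fun c _ => ?_
    rw [prod_update_left, ← Finset.mul_prod_erase _ _ (Finset.mem_univ s)]
    simp only [Function.update_self]
    ring
  have hR : ∑ J : Fin (r + 1) → Fin n, (∏ s, F (J s) (I s)) * covDeriv G T (φ y) J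
      = ∑ d, ∑ J : Fin r → Fin n, F d a * (∏ u, F (J u) (i u))
        * (pd d (fun z => T z J) (φ y)
          - ∑ s, ∑ c, christoffel G (φ y) c d (J s) * T (φ y) (Function.update J s c)) := by
    rw [sum_fin_succ_fun]
    refine Finset.sum_congr rfl fun d _ => Finset.sum_congr rfl fun J _ => ?_
    rw [Fin.prod_univ_succ]
    simp only [Fin.cons_zero, Fin.cons_succ]
    rfl
  rw [hR]
  have hL : covDeriv G' T' y I = pd a (fun z => T' z i) y
      - ∑ s, ∑ c, christoffel G' y c a (i s) * T' y (Function.update i s c) := rfl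
  rw [hL, h1, Finset.sum_congr rfl fun s _ => h2 s]
  simp only [add_mul, Finset.sum_add_distrib, mul_sub, Finset.sum_sub_distrib]
  have e1 : ∑ J : Fin r → Fin n, (∑ s, pd a (fun z => jac φ z (J s) (i s)) y
          * ∏ u ∈ Finset.univ.erase s, F (J u) (i u)) * T (φ y) J
      = ∑ s, ∑ J : Fin r → Fin n, pd a (fun z => jac φ z (J s) (i s)) y
          * ((∏ u ∈ Finset.univ.erase s, F (J u) (i u)) * T (φ y) J) := by
    rw [Finset.sum_comm]
    refine Finset.sum_congr rfl fun J _ => ?_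
    rw [Finset.sum_mul]
    exact Finset.sum_congr rfl fun s _ => by ring
  have e2 : ∑ J : Fin r → Fin n, (∏ s, F (J s) (i s)) * ∑ d, F d a * pd d (fun z => T z J) (φ y)
      = ∑ d, ∑ J : Fin r → Fin n, F d a * (∏ u, F (J u) (i u)) * pd d (fun z => T z J) (φ y) := by
    rw [Finset.sum_comm]
    refine Finset.sum_congr rfl fun J _ => ?_
    rw [Finset.mul_sum]
    exact Finset.sum_congr rfl fun s _ => by ring
  have e3 : ∑ s : Fin r, ∑ J : Fin r → Fin n,
      (∑ d, ∑ e, christoffel G (φ y) (J s) d e * F d a * F e (i s))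
          * ((∏ u ∈ Finset.univ.erase s, F (J u) (i u)) * T (φ y) J)
      = ∑ d, ∑ J : Fin r → Fin n, F d a * (∏ u, F (J u) (i u))
        * ∑ s, ∑ c, christoffel G (φ y) c d (J s) * T (φ y) (Function.update J s c) := by
    have : ∀ d, ∑ J : Fin r → Fin n, F d a * (∏ u, F (J u) (i u))
        * ∑ s, ∑ c, christoffel G (φ y) c d (J s) * T (φ y) (Function.update J s c)
        = ∑ s, ∑ J : Fin r → Fin n, ∑ e,
      christoffel G (φ y) (J s) d e * F d a * F e (i s)
        * ((∏ u ∈ Finset.univ.erase s, F (J u) (i u)) * T (φ y) J) := by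
      intro d
      rw [Finset.sum_congr rfl fun s _ => h3 s d, Finset.sum_comm]
      exact Finset.sum_congr rfl fun J _ => Finset.mul_sum _ _ _
    rw [Finset.sum_congr rfl fun d _ => this d]
    refine Eq.trans ?_ Finset.sum_comm
    refine Finset.sum_congr rfl fun s _ => ?_
    refine Eq.trans ?_ Finset.sum_comm
    refine Finset.sum_congr rfl fun J _ => ?_
    rw [Finset.sum_mul]
    exact Finset.sum_congr rfl fun d _ => Finset.sum_mul _ _ _
  rw [e1, e2, e3]
  ring

end Pullback

/-! ### Smooth dependence of inverse matrices -/

section Smooth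

variable {X : Type*} [NormedAddCommGroup X] [NormedSpace ℝ X] {m : ℕ}

theorem contDiffOn_det {A : X → Matrix (Fin m) (Fin m) ℝ} {U : Set X}
    (h : ∀ i j, ContDiffOn ℝ ∞ (fun x => A x i j) U) :
    ContDiffOn ℝ ∞ (fun x => (A x).det) U := by
  simp only [Matrix.det_apply']
  exact ContDiffOn.sum fun σ _ => contDiffOn_const.mul (contDiffOn_prod fun i _ => h _ _)

/-- Cramer's rule: each entry of the inverse is a quotient of determinants. -/
theorem contDiffOn_matrix_inv {A : X → Matrix (Fin m) (Fin m) ℝ} {U : Set X}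
    (h : ∀ i j, ContDiffOn ℝ ∞ (fun x => A x i j) U) (hdet : ∀ x ∈ U, (A x).det ≠ 0)
    (i j : Fin m) : ContDiffOn ℝ ∞ (fun x => (A x)⁻¹ i j) U := by
  have h1 : ∀ x, (A x)⁻¹ i j = (A x).det⁻¹ * ((A x).updateRow j (Pi.single i 1)).det := by
    intro x
    rw [Matrix.inv_def, Matrix.smul_apply, Matrix.adjugate_apply, smul_eq_mul, Ring.inverse_eq_inv']
  simp only [h1]
  refine ((contDiffOn_det h).inv hdet).mul (contDiffOn_det fun k l => ?_)
  by_cases hk : k = j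
  · subst hk
    simp only [Matrix.updateRow_self]
    exact contDiffOn_const
  · simp only [Matrix.updateRow_ne hk]
    exact h k l

end Smooth

/-! ### Metrics in coordinates and their connection -/

section Metric

variable {n : ℕ}

theorem sum_fin_one_fun (f : (Fin 1 → Fin n) → ℝ) : ∑ J, f J = ∑ j, f ![j] := by
  rw [sum_fin_succ_fun]
  exact Finset.sum_congr rfl fun d _ => Fintype.sum_unique _

theorem sum_fin_two_fun (f : (Fin 2 → Fin n) → ℝ) : ∑ J, f J = ∑ j, ∑ k, f ![j, k] := by
  rw [sum_fin_succ_fun]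
  exact Finset.sum_congr rfl fun d _ => sum_fin_one_fun _

theorem sum_fin_three_fun (f : (Fin 3 → Fin n) → ℝ) :
    ∑ J, f J = ∑ j, ∑ k, ∑ l, f ![j, k, l] := by
  rw [sum_fin_succ_fun]
  exact Finset.sum_congr rfl fun d _ => sum_fin_two_fun _

theorem sum_fin_four_fun (f : (Fin 4 → Fin n) → ℝ) :
    ∑ J, f J = ∑ j, ∑ k, ∑ l, ∑ m, f ![j, k, l, m] := by
  rw [sum_fin_succ_fun]
  exact Finset.sum_congr rfl fun d _ => sum_fin_three_fun _

/-- The matrix `(g_{ij})`. -/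
def gram (G : CoordTensor n 2) (y : EuclideanSpace ℝ (Fin n)) : Matrix (Fin n) (Fin n) ℝ :=
  Matrix.of fun a b => G y ![a, b]

theorem gram_apply (G : CoordTensor n 2) (y : EuclideanSpace ℝ (Fin n)) (a b : Fin n) :
    gram G y a b = G y ![a, b] := rfl

theorem invMetric_eq (G : CoordTensor n 2) (y : EuclideanSpace ℝ (Fin n)) (a b : Fin n) :
    invMetric G y a b = (gram G y)⁻¹ a b := rfl

/-- `G` is a smooth Riemannian metric on `V`. -/
structure IsMetricOn (V : Set (EuclideanSpace ℝ (Fin n))) (G : CoordTensor n 2) : Prop where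
  smooth : SmoothTensorOn V G
  posDef : ∀ y ∈ V, (gram G y).PosDef

variable {V : Set (EuclideanSpace ℝ (Fin n))} {G : CoordTensor n 2}

theorem gram_symm_apply {y : EuclideanSpace ℝ (Fin n)} (h : (gram G y).PosDef) (a b : Fin n) :
    G y ![a, b] = G y ![b, a] := by
  have := h.1.apply a b
  simpa [gram] using this.symm

theorem IsMetricOn.symm (h : IsMetricOn V G) {y : EuclideanSpace ℝ (Fin n)} (hy : y ∈ V)
    (a b : Fin n) : G y ![a, b] = G y ![b, a] :=
  gram_symm_apply (h.posDef y hy) a b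

theorem IsMetricOn.det_ne_zero (h : IsMetricOn V G) {y : EuclideanSpace ℝ (Fin n)} (hy : y ∈ V) :
    (gram G y).det ≠ 0 := (h.posDef y hy).det_pos.ne'

theorem IsMetricOn.contDiffOn_invMetric (h : IsMetricOn V G) (i j : Fin n) :
    ContDiffOn ℝ ∞ (fun y => invMetric G y i j) V :=
  contDiffOn_matrix_inv (A := gram G) (fun a b => h.smooth ![a, b])
    (fun _ hy => h.det_ne_zero hy) i j

theorem IsMetricOn.contDiffOn_christoffel (h : IsMetricOn V G) (hV : IsOpen V) (c a b : Fin n) :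
    ContDiffOn ℝ ∞ (fun y => christoffel G y c a b) V := by
  unfold christoffel
  refine contDiffOn_const.mul (ContDiffOn.sum fun d _ => (h.contDiffOn_invMetric c d).mul ?_)
  exact ((contDiffOn_pd hV (h.smooth _) a).add (contDiffOn_pd hV (h.smooth _) b)).sub
    (contDiffOn_pd hV (h.smooth _) d)

theorem smoothTensorOn_covDeriv {r : ℕ} (h : IsMetricOn V G) (hV : IsOpen V) {T : CoordTensor n r}
    (hT : SmoothTensorOn V T) : SmoothTensorOn V (covDeriv G T) := fun _ =>
  (contDiffOn_pd hV (hT _) _).sub (ContDiffOn.sum fun _ _ => ContDiffOn.sum fun _ _ =>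
    (h.contDiffOn_christoffel hV _ _ _).mul (hT _))

theorem smoothTensorOn_iterCovDeriv {r : ℕ} (h : IsMetricOn V G) (hV : IsOpen V)
    {T : CoordTensor n r} (hT : SmoothTensorOn V T) (p : ℕ) :
    SmoothTensorOn V (iterCovDeriv G T p) := by
  induction p with
  | zero => exact hT
  | succ p ih => exact smoothTensorOn_covDeriv h hV ih

theorem smoothTensorOn_riemann (h : IsMetricOn V G) (hV : IsOpen V) :
    SmoothTensorOn V (riemann G) := by
  intro I
  have hΓ := h.contDiffOn_christoffel hV
  refine ContDiffOn.sum fun m _ => (h.smooth _).mul ?_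
  exact ((contDiffOn_pd hV (hΓ _ _ _) _).sub (contDiffOn_pd hV (hΓ _ _ _) _)).add
    (ContDiffOn.sum fun p _ => ((hΓ _ _ _).mul (hΓ _ _ _)).sub ((hΓ _ _ _).mul (hΓ _ _ _)))

theorem IsMetricOn.christoffel_symm (h : IsMetricOn V G) (hV : IsOpen V)
    {y : EuclideanSpace ℝ (Fin n)} (hy : y ∈ V) (c a b : Fin n) :
    christoffel G y c a b = christoffel G y c b a := by
  unfold christoffel
  congr 1
  refine Finset.sum_congr rfl fun d _ => ?_
  rw [pd_congr_of_eqOn hV hy d fun z hz => h.symm hz a b]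
  ring

/-! ### The Ricci identity -/

theorem covDeriv_one (G : CoordTensor n 2) (θ : CoordTensor n 1) (y : EuclideanSpace ℝ (Fin n))
    (b c : Fin n) : covDeriv G θ y ![b, c]
      = pd b (fun z => θ z ![c]) y - ∑ e, christoffel G y e b c * θ y ![e] := by
  have h1 : Fin.tail ![b, c] = ![c] := rfl
  have h2 : ∀ e : Fin n, Function.update ![c] 0 e = ![e] := fun e => by
    ext i; fin_cases i; rfl
  simp only [covDeriv, h1, Fin.sum_univ_one, h2]
  rfl

theorem covDeriv_two (G : CoordTensor n 2) (S : CoordTensor n 2) (y : EuclideanSpace ℝ (Fin n))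
    (a b c : Fin n) : covDeriv G S y ![a, b, c]
      = pd a (fun z => S z ![b, c]) y - (∑ e, christoffel G y e a b * S y ![e, c]
        + ∑ e, christoffel G y e a c * S y ![b, e]) := by
  have h1 : Fin.tail ![a, b, c] = ![b, c] := rfl
  have h2 : ∀ e : Fin n, Function.update ![b, c] 0 e = ![e, c] := fun e => by
    ext i; fin_cases i <;> rfl
  have h3 : ∀ e : Fin n, Function.update ![b, c] 1 e = ![b, e] := fun e => by
    ext i; fin_cases i <;> rfl
  simp only [covDeriv, h1, Fin.sum_univ_two, h2, h3]
  rfl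

/-- The Ricci identity for one-forms. -/
theorem ricci_identity (h : IsMetricOn V G) (hV : IsOpen V) {θ : CoordTensor n 1}
    (hθ : SmoothTensorOn V θ) {y : EuclideanSpace ℝ (Fin n)} (hy : y ∈ V) (a b c : Fin n) :
    covDeriv G (covDeriv G θ) y ![a, b, c] - covDeriv G (covDeriv G θ) y ![b, a, c]
      = ∑ m, riemannOp G y m a b c * θ y ![m] := by
  have hΓd : ∀ e a b, DifferentiableAt ℝ (fun z => christoffel G z e a b) y := fun e a b =>
    differentiableAt_of_contDiffOn hV (h.contDiffOn_christoffel hV e a b) hy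
  have hθd : ∀ I, DifferentiableAt ℝ (fun z => θ z I) y := fun I =>
    differentiableAt_of_contDiffOn hV (hθ I) hy
  have hpd : ∀ b I, DifferentiableAt ℝ (pd b (fun z => θ z I)) y := fun b I =>
    differentiableAt_of_contDiffOn hV (contDiffOn_pd hV (hθ I) b) hy
  have key : ∀ a b, pd a (fun z => covDeriv G θ z ![b, c]) y
      = pd a (pd b (fun z => θ z ![c])) y - ∑ e, (pd a (fun z => christoffel G z e b c) y * θ y ![e]
        + christoffel G y e b c * pd a (fun z => θ z ![e]) y) := by
    intro a b
    simp only [covDeriv_one]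
    rw [pd_sub a (hpd b _) (DifferentiableAt.fun_sum fun e _ => (hΓd e b c).fun_mul (hθd _)),
      pd_sum a fun e _ => (hΓd e b c).fun_mul (hθd _)]
    congr 1
    exact Finset.sum_congr rfl fun e _ => pd_mul a (hΓd e b c) (hθd _)
  rw [covDeriv_two, covDeriv_two, key, key, pd_comm hV (hθ ![c]) hy a b]
  -- The connection is torsion free, so the corrections in the first slot cancel on
  -- antisymmetrizing.
  have hs : ∑ e, christoffel G y e a b * covDeriv G θ y ![e, c]
      = ∑ e, christoffel G y e b a * covDeriv G θ y ![e, c] :=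
    Finset.sum_congr rfl fun e _ => by rw [h.christoffel_symm hV hy]
  rw [hs]
  simp only [covDeriv_one, mul_sub, Finset.mul_sum, Finset.sum_add_distrib, Finset.sum_sub_distrib,
    riemannOp, add_mul, sub_mul, Finset.sum_mul]
  have e1 : ∀ a b, ∑ e, ∑ i, christoffel G y e a c * (christoffel G y i b e * θ y ![i])
      = ∑ m, ∑ p, christoffel G y p a c * christoffel G y m b p * θ y ![m] := by
    intro a b
    rw [Finset.sum_comm]
    exact Finset.sum_congr rfl fun m _ => Finset.sum_congr rfl fun p _ => by ring
  rw [e1, e1]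
  ring

/-! ### Transformation of the connection and of the curvature -/

variable {φ : EuclideanSpace ℝ (Fin n) → EuclideanSpace ℝ (Fin n)}
  {U : Set (EuclideanSpace ℝ (Fin n))} {G' : CoordTensor n 2}

theorem IsPullback.apply_two {T' T : CoordTensor n 2} (h : IsPullback φ U T' T)
    {y : EuclideanSpace ℝ (Fin n)} (hy : y ∈ U) (a b : Fin n) :
    T' y ![a, b] = ∑ j, ∑ k, jac φ y j a * jac φ y k b * T (φ y) ![j, k] := by
  rw [h y hy, sum_fin_two_fun]
  simp [Fin.prod_univ_two]

theorem IsPullback.gram_eq (h : IsPullback φ U G' G) {y : EuclideanSpace ℝ (Fin n)} (hy : y ∈ U) :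
    gram G' y = (Matrix.of (jac φ y)).transpose * gram G (φ y) * Matrix.of (jac φ y) := by
  ext a b
  rw [gram_apply, h.apply_two hy]
  simp only [Matrix.mul_apply, Matrix.transpose_apply, Matrix.of_apply, gram_apply, Finset.sum_mul]
  rw [Finset.sum_comm]
  exact Finset.sum_congr rfl fun j _ => Finset.sum_congr rfl fun k _ => by ring

/-- With F the Jacobian, G' = FᵀGF, so nondegeneracy of G' already forces F to be invertible. In
this form the inverse Jacobian never appears in later computations. -/
theorem IsPullback.inv_gram_eq (h : IsPullback φ U G' G) {y : EuclideanSpace ℝ (Fin n)}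
    (hy : y ∈ U) (hdet : (gram G' y).det ≠ 0) :
    Matrix.of (jac φ y) * (gram G' y)⁻¹ * (Matrix.of (jac φ y)).transpose = (gram G (φ y))⁻¹ := by
  have h1 := h.gram_eq hy
  set F := Matrix.of (jac φ y)
  have hF : F.det ≠ 0 := by
    intro h0
    rw [h1, Matrix.det_mul, h0, mul_zero] at hdet
    exact hdet rfl
  have hFu : IsUnit F.det := hF.isUnit
  have hFt : IsUnit F.transpose.det := by rwa [Matrix.det_transpose]
  rw [h1, Matrix.mul_inv_rev, Matrix.mul_inv_rev, Matrix.mul_nonsing_inv_cancel_left _ _ hFu,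
    Matrix.mul_assoc, Matrix.nonsing_inv_mul _ hFt, Matrix.mul_one]

/-- The transformation law of the Christoffel symbols. -/
theorem IsPullback.christoffel_eq (hU : IsOpen U) (hV : IsOpen V) (hφ : ContDiffOn ℝ ∞ φ U)
    (hm : MapsTo φ U V) (hG' : IsMetricOn U G') (hG : IsMetricOn V G) (h : IsPullback φ U G' G)
    {y : EuclideanSpace ℝ (Fin n)} (hy : y ∈ U) (f a b : Fin n) :
    ∑ c, christoffel G' y c a b * jac φ y f c
      = (∑ d, ∑ e, christoffel G (φ y) f d e * jac φ y d a * jac φ y e b)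
        + pd a (fun z => jac φ z f b) y := by
  set F : Fin n → Fin n → ℝ := jac φ y with hF
  have hφd : DifferentiableAt ℝ φ y :=
    (hφ.contDiffAt (hU.mem_nhds hy)).differentiableAt (by simp)
  have hTd : ∀ J, DifferentiableAt ℝ (fun z => G z J) (φ y) := fun J =>
    differentiableAt_of_contDiffOn hV (hG.smooth J) (hm hy)
  have hFd : ∀ j k, DifferentiableAt ℝ (fun z => jac φ z j k) y := fun j k =>
    differentiableAt_of_contDiffOn hU (contDiffOn_jac hU hφ j k) hy
  have hTφ : ∀ J, DifferentiableAt ℝ (fun z => G (φ z) J) y := fun J =>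
    (hTd J).comp y hφd
  -- A derivative of G' splits into terms `D` with second derivatives of φ and terms `K` with
  -- derivatives of G. As `D a b d` is symmetric in a and b, the Christoffel combination keeps only
  -- `D a b d`, twice.
  let D : Fin n → Fin n → Fin n → ℝ := fun a b d => ∑ j, ∑ k,
    pd a (fun z => jac φ z j b) y * F k d * G (φ y) ![j, k]
  let K : Fin n → Fin n → Fin n → ℝ := fun a b d => ∑ j, ∑ k, ∑ p,
    F j b * F k d * (F p a * pd p (fun z => G z ![j, k]) (φ y))
  have hpd : ∀ a b d, pd a (fun z => G' z ![b, d]) y = D a b d + D a d b + K a b d := by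
    intro a b d
    have hD : D a d b = ∑ j, ∑ k,
        pd a (fun z => jac φ z k d) y * F j b * G (φ y) ![j, k] := by
      simp only [D]
      rw [Finset.sum_comm]
      exact Finset.sum_congr rfl fun j _ => Finset.sum_congr rfl fun k _ => by
        rw [hG.symm (hm hy)]
    rw [hD, pd_congr_of_eqOn hU hy a fun z hz => h.apply_two hz b d,
      pd_sum a fun j _ => DifferentiableAt.fun_sum fun k _ => ((hFd _ _).fun_mul (hFd _ _)).fun_mul (hTφ _)]
    simp only [D, K, ← Finset.sum_add_distrib]
    refine Finset.sum_congr rfl fun j _ => ?_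
    rw [pd_sum a fun k _ => ((hFd _ _).fun_mul (hFd _ _)).fun_mul (hTφ _)]
    refine Finset.sum_congr rfl fun k _ => ?_
    rw [pd_mul a ((hFd _ _).fun_mul (hFd _ _)) (hTφ _), pd_mul a (hFd _ _) (hFd _ _),
      pd_comp a (hTd _) hφd, Finset.mul_sum]
    rw [← Finset.mul_sum, ← Finset.mul_sum]
    simp only [hF, jac]
    ring
  have hDs : ∀ a b d, D a b d = D b a d := fun a b d => by
    simp only [D, pd_jac_comm hU hφ hy a b]
  let L : Fin n → Fin n → Fin n → ℝ := fun p q k =>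
    (1 / 2) * (pd p (fun z => G z ![q, k]) (φ y) + pd q (fun z => G z ![p, k]) (φ y)
      - pd k (fun z => G z ![p, q]) (φ y))
  let X : Fin n → ℝ := fun k => (∑ p, ∑ q, F p a * F q b * L p q k)
    + ∑ j, pd a (fun z => jac φ z j b) y * G (φ y) ![j, k]
  have hX : ∀ d, (1 / 2) * (pd a (fun z => G' z ![b, d]) y + pd b (fun z => G' z ![a, d]) y
      - pd d (fun z => G' z ![a, b]) y) = ∑ k, F k d * X k := by
    intro d
    rw [hpd, hpd, hpd, hDs b a d, hDs d a b, hDs d b a]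
    have e1 : ∑ k, F k d * X k = D a b d + (1 / 2) * (K a b d + K b a d - K d a b) := by
      have e0 : ∑ k, F k d * ∑ j, pd a (fun z => jac φ z j b) y * G (φ y) ![j, k] = D a b d := by
        simp only [D, Finset.mul_sum]
        rw [Finset.sum_comm]
        exact Finset.sum_congr rfl fun j _ => Finset.sum_congr rfl fun k _ => by ring
      have k1 : K a b d = ∑ k, ∑ p, ∑ q,
          F k d * (F p a * F q b * pd p (fun z => G z ![q, k]) (φ y)) := by
        simp only [K]
        rw [Finset.sum_comm]
        refine Finset.sum_congr rfl fun k _ => ?_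
        rw [Finset.sum_comm]
        exact Finset.sum_congr rfl fun p _ => Finset.sum_congr rfl fun q _ => by ring
      have k2 : K b a d = ∑ k, ∑ p, ∑ q,
          F k d * (F p a * F q b * pd q (fun z => G z ![p, k]) (φ y)) := by
        simp only [K]
        rw [Finset.sum_comm]
        exact Finset.sum_congr rfl fun k _ => Finset.sum_congr rfl fun p _ =>
          Finset.sum_congr rfl fun q _ => by ring
      have k3 : K d a b = ∑ k, ∑ p, ∑ q,
          F k d * (F p a * F q b * pd k (fun z => G z ![p, q]) (φ y)) := by
        simp only [K]
        rw [Finset.sum_congr rfl fun j _ => Finset.sum_comm, Finset.sum_comm]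
        exact Finset.sum_congr rfl fun k _ => Finset.sum_congr rfl fun p _ =>
          Finset.sum_congr rfl fun q _ => by ring
      rw [k1, k2, k3]
      simp only [X, mul_add, Finset.sum_add_distrib]
      rw [e0, add_comm]
      congr 1
      simp only [L, Finset.mul_sum, ← Finset.sum_add_distrib, ← Finset.sum_sub_distrib]
      exact Finset.sum_congr rfl fun k _ => Finset.sum_congr rfl fun p _ =>
          Finset.sum_congr rfl fun q _ => by ring
    rw [e1]; ring
  have hΓ' : ∀ c, christoffel G' y c a b = ∑ d, invMetric G' y c d * ∑ k, F k d * X k := by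
    intro c
    unfold christoffel
    rw [Finset.mul_sum]
    refine Finset.sum_congr rfl fun d _ => ?_
    rw [← hX]; ring
  have hΓ : ∀ d e, christoffel G (φ y) f d e = ∑ k, invMetric G (φ y) f k * L d e k := by
    intro d e
    unfold christoffel
    rw [Finset.mul_sum]
    exact Finset.sum_congr rfl fun k _ => by simp only [L]; ring
  have hinv : ∀ k, ∑ c, ∑ d, F f c * invMetric G' y c d * F k d = invMetric G (φ y) f k := by
    intro k
    rw [invMetric_eq, ← h.inv_gram_eq hy (hG'.det_ne_zero hy)]
    simp only [Matrix.mul_apply, Matrix.transpose_apply, Matrix.of_apply, Finset.sum_mul]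
    rw [Finset.sum_comm]
    rfl
  have hone : ∀ j, ∑ k, invMetric G (φ y) f k * G (φ y) ![j, k] = if f = j then 1 else 0 := by
    intro j
    have := congrFun (congrFun (Matrix.nonsing_inv_mul (gram G (φ y))
      (hG.det_ne_zero (hm hy)).isUnit) f) j
    rw [Matrix.mul_apply, Matrix.one_apply] at this
    rw [← this]
    exact Finset.sum_congr rfl fun k _ => by rw [hG.symm (hm hy) j k]; rfl
  have hXf : ∑ c, christoffel G' y c a b * F f c = ∑ k, invMetric G (φ y) f k * X k := by
    simp only [hΓ', ← hinv, Finset.mul_sum, Finset.sum_mul]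
    rw [Finset.sum_congr rfl fun c _ => Finset.sum_comm, Finset.sum_comm]
    exact Finset.sum_congr rfl fun k _ => Finset.sum_congr rfl fun c _ =>
      Finset.sum_congr rfl fun d _ => by ring
  rw [hXf]
  simp only [X, mul_add, Finset.sum_add_distrib]
  congr 1
  · simp only [hΓ, Finset.mul_sum, Finset.sum_mul]
    rw [Finset.sum_comm]
    refine Finset.sum_congr rfl fun d _ => ?_
    rw [Finset.sum_comm]
    exact Finset.sum_congr rfl fun e _ => Finset.sum_congr rfl fun k _ => by ring
  · have : ∀ k, invMetric G (φ y) f k * ∑ j, pd a (fun z => jac φ z j b) y * G (φ y) ![j, k]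
        = ∑ j, pd a (fun z => jac φ z j b) y * (invMetric G (φ y) f k * G (φ y) ![j, k]) := by
      intro k
      rw [Finset.mul_sum]
      exact Finset.sum_congr rfl fun j _ => by ring
    rw [Finset.sum_congr rfl fun k _ => this k, Finset.sum_comm]
    simp only [← Finset.mul_sum, hone]
    simp

/-- The covariant derivative is natural under changes of coordinates. -/
theorem IsPullback.covDeriv {r : ℕ} (hU : IsOpen U) (hV : IsOpen V) (hφ : ContDiffOn ℝ ∞ φ U)
    (hm : MapsTo φ U V) (hG' : IsMetricOn U G') (hG : IsMetricOn V G) (h : IsPullback φ U G' G)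
    {T' T : CoordTensor n r} (hT : SmoothTensorOn V T) (hTT : IsPullback φ U T' T) :
    IsPullback φ U (covDeriv G' T') (covDeriv G T) :=
  IsPullback.covDeriv_of_christoffel hU hV hφ hm
    (fun _ hy f a b => h.christoffel_eq hU hV hφ hm hG' hG hy f a b) hT hTT

theorem IsPullback.iterCovDeriv {r : ℕ} (hU : IsOpen U) (hV : IsOpen V) (hφ : ContDiffOn ℝ ∞ φ U)
    (hm : MapsTo φ U V) (hG' : IsMetricOn U G') (hG : IsMetricOn V G) (h : IsPullback φ U G' G)
    {T' T : CoordTensor n r} (hT : SmoothTensorOn V T) (hTT : IsPullback φ U T' T) (p : ℕ) :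
    IsPullback φ U (iterCovDeriv G' T' p) (iterCovDeriv G T p) := by
  induction p with
  | zero => exact hTT
  | succ p ih =>
    exact IsPullback.covDeriv hU hV hφ hm hG' hG h (smoothTensorOn_iterCovDeriv hG hV hT p) ih

/-- The Ricci identity makes this a consequence of naturality of ∇∇. It is applied to the coordinate
form θ = dy^f on the target and to its pullback θ', whose components are a row of the Jacobian; the
law for Γ need not be differentiated. -/
theorem IsPullback.riemannOp_eq (hU : IsOpen U) (hV : IsOpen V) (hφ : ContDiffOn ℝ ∞ φ U)
    (hm : MapsTo φ U V) (hG' : IsMetricOn U G') (hG : IsMetricOn V G) (h : IsPullback φ U G' G)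
    {y : EuclideanSpace ℝ (Fin n)} (hy : y ∈ U) (f a b c : Fin n) :
    ∑ m, riemannOp G' y m a b c * jac φ y f m
      = ∑ p, ∑ q, ∑ s, jac φ y p a * jac φ y q b * jac φ y s c * riemannOp G (φ y) f p q s := by
  let θ : CoordTensor n 1 := fun _ J => if J 0 = f then 1 else 0
  let θ' : CoordTensor n 1 := fun z I => jac φ z f (I 0)
  have hθ : SmoothTensorOn V θ := fun I => contDiffOn_const
  have hθ' : SmoothTensorOn U θ' := fun I => contDiffOn_jac hU hφ f (I 0)
  have hθθ : IsPullback φ U θ' θ := by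
    intro z hz I
    rw [sum_fin_one_fun]
    simp [θ, θ']
  have h2 := h.covDeriv hU hV hφ hm hG' hG (smoothTensorOn_covDeriv hG hV hθ)
    (h.covDeriv hU hV hφ hm hG' hG hθ hθθ)
  have h3 : ∀ a b, GRF.covDeriv G' (GRF.covDeriv G' θ') y ![a, b, c] = ∑ p, ∑ q, ∑ s,
      jac φ y p a * jac φ y q b * jac φ y s c
        * GRF.covDeriv G (GRF.covDeriv G θ) (φ y) ![p, q, s] := by
    intro a b
    rw [h2 y hy, sum_fin_three_fun]
    simp [Fin.prod_univ_three]
  have h4 := ricci_identity hG' hU hθ' hy a b c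
  have h5 : ∀ p q s, GRF.covDeriv G (GRF.covDeriv G θ) (φ y) ![p, q, s]
      - GRF.covDeriv G (GRF.covDeriv G θ) (φ y) ![q, p, s] = riemannOp G (φ y) f p q s := by
    intro p q s
    rw [ricci_identity hG hV hθ (hm hy)]
    simp [θ]
  have h6 : ∑ m, riemannOp G' y m a b c * jac φ y f m = ∑ m, riemannOp G' y m a b c * θ' y ![m] :=
    rfl
  rw [h6, ← h4, h3 a b, h3 b a]
  rw [Finset.sum_comm (f := fun p q => ∑ s, jac φ y p b * jac φ y q a * jac φ y s c
        * GRF.covDeriv G (GRF.covDeriv G θ) (φ y) ![p, q, s])]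
  simp only [← h5, mul_sub, Finset.sum_sub_distrib]
  congr 1
  exact Finset.sum_congr rfl fun p _ => Finset.sum_congr rfl fun q _ =>
    Finset.sum_congr rfl fun s _ => by ring

/-- The curvature tensor is natural under changes of coordinates. -/
theorem IsPullback.riemann (hU : IsOpen U) (hV : IsOpen V) (hφ : ContDiffOn ℝ ∞ φ U)
    (hm : MapsTo φ U V) (hG' : IsMetricOn U G') (hG : IsMetricOn V G) (h : IsPullback φ U G' G) :
    IsPullback φ U (riemann G') (riemann G) := by
  intro y hy I
  rw [sum_fin_four_fun]
  unfold GRF.riemann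
  simp only [h.apply_two hy]
  have h1 : ∀ j, (∑ k, ∑ m, jac φ y j (I 3) * jac φ y k m * G (φ y) ![j, k]
      * riemannOp G' y m (I 0) (I 1) (I 2)) = ∑ p, ∑ q, ∑ s, ∑ k,
        jac φ y p (I 0) * jac φ y q (I 1) * jac φ y s (I 2) * jac φ y j (I 3)
          * (G (φ y) ![j, k] * riemannOp G (φ y) k p q s) := by
    intro j
    have : ∀ k, (∑ m, jac φ y j (I 3) * jac φ y k m * G (φ y) ![j, k]
        * riemannOp G' y m (I 0) (I 1) (I 2)) = jac φ y j (I 3) * G (φ y) ![j, k] *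
          ∑ m, riemannOp G' y m (I 0) (I 1) (I 2) * jac φ y k m := by
      intro k
      rw [Finset.mul_sum]
      exact Finset.sum_congr rfl fun m _ => by ring
    simp only [this, h.riemannOp_eq hU hV hφ hm hG' hG hy, Finset.mul_sum]
    rw [Finset.sum_comm]
    refine Finset.sum_congr rfl fun p _ => ?_
    rw [Finset.sum_comm]
    refine Finset.sum_congr rfl fun q _ => ?_
    rw [Finset.sum_comm]
    exact Finset.sum_congr rfl fun s _ => Finset.sum_congr rfl fun k _ => by ring
  have h2 : ∑ m, (∑ j, ∑ k, jac φ y j (I 3) * jac φ y k m * G (φ y) ![j, k])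
      * riemannOp G' y m (I 0) (I 1) (I 2) = ∑ j, ∑ k, ∑ m,
        jac φ y j (I 3) * jac φ y k m * G (φ y) ![j, k] * riemannOp G' y m (I 0) (I 1) (I 2) := by
    simp only [Finset.sum_mul]
    rw [Finset.sum_comm]
    exact Finset.sum_congr rfl fun j _ => Finset.sum_comm
  simp only [Matrix.cons_val_zero, Matrix.cons_val_one, Matrix.cons_val] at h1 h2 ⊢
  rw [h2]
  simp only [h1, Fin.prod_univ_four, Matrix.cons_val_zero, Matrix.cons_val_one, Matrix.cons_val,
    Finset.mul_sum]
  rw [Finset.sum_comm]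
  refine Finset.sum_congr rfl fun p _ => ?_
  rw [Finset.sum_comm]
  refine Finset.sum_congr rfl fun q _ => ?_
  rw [Finset.sum_comm]

/-- The norm of a tensor does not depend on the coordinates. -/
theorem tensorNorm_eq_of_pullback {r : ℕ} (h : IsPullback φ U G' G)
    {y : EuclideanSpace ℝ (Fin n)} (hy : y ∈ U) (hdet : (gram G' y).det ≠ 0)
    {T' T : (Fin r → Fin n) → ℝ}
    (hT : ∀ I, T' I = ∑ J : Fin r → Fin n, (∏ s, jac φ y (J s) (I s)) * T J) :
    tensorNorm G' y T' = tensorNorm G (φ y) T := by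
  unfold tensorNorm
  congr 1
  have hinv : ∀ k l, ∑ c, ∑ d, jac φ y k c * invMetric G' y c d * jac φ y l d
      = invMetric G (φ y) k l := by
    intro k l
    rw [invMetric_eq, ← h.inv_gram_eq hy hdet]
    simp only [Matrix.mul_apply, Matrix.transpose_apply, Matrix.of_apply, Finset.sum_mul]
    rw [Finset.sum_comm]
    rfl
  have hprod : ∀ A B : Fin r → Fin n, ∑ I : Fin r → Fin n, ∑ J : Fin r → Fin n,
      ∏ s, (jac φ y (A s) (I s) * invMetric G' y (I s) (J s) * jac φ y (B s) (J s))
      = ∏ s, invMetric G (φ y) (A s) (B s) := by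
    intro A B
    simp only [← hinv, Finset.prod_univ_sum, Fintype.piFinset_univ]
  calc ∑ I : Fin r → Fin n, ∑ J : Fin r → Fin n, (∏ s, invMetric G' y (I s) (J s)) * T' I * T' J
      = ∑ I : Fin r → Fin n, ∑ J : Fin r → Fin n, ∑ A : Fin r → Fin n, ∑ B : Fin r → Fin n,
          (∏ s, (jac φ y (A s) (I s) * invMetric G' y (I s) (J s)
          * jac φ y (B s) (J s))) * (T A * T B) := by
        refine Finset.sum_congr rfl fun I _ => Finset.sum_congr rfl fun J _ => ?_
        rw [hT I, hT J, mul_assoc, Finset.sum_mul_sum, Finset.mul_sum]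
        refine Finset.sum_congr rfl fun A _ => ?_
        rw [Finset.mul_sum]
        refine Finset.sum_congr rfl fun B _ => ?_
        rw [Finset.prod_mul_distrib, Finset.prod_mul_distrib]
        ring
    _ = ∑ A : Fin r → Fin n, ∑ B : Fin r → Fin n, (∑ I : Fin r → Fin n, ∑ J : Fin r → Fin n,
          ∏ s, (jac φ y (A s) (I s) * invMetric G' y (I s) (J s)
          * jac φ y (B s) (J s))) * (T A * T B) := by
        simp only [Finset.sum_mul]
        rw [Finset.sum_congr rfl fun I _ => Finset.sum_comm, Finset.sum_comm]
        refine Finset.sum_congr rfl fun A _ => ?_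
        rw [Finset.sum_congr rfl fun I _ => Finset.sum_comm, Finset.sum_comm]
    _ = _ := by
        simp only [hprod]
        exact Finset.sum_congr rfl fun A _ => Finset.sum_congr rfl fun B _ => by ring

end Metric

/-! ### Pointwise estimates for the norm of a tensor -/

section Norm

variable {n r : ℕ} {G : CoordTensor n 2} {y : EuclideanSpace ℝ (Fin n)}

/-- The quadratic form of the metric. -/
def quad (G : CoordTensor n 2) (y : EuclideanSpace ℝ (Fin n)) (v : Fin n → ℝ) : ℝ :=
  ∑ a, ∑ b, v a * v b * G y ![a, b]

/-- The value of a covariant tensor on a family of vectors. -/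
def tensorEval (T : (Fin r → Fin n) → ℝ) (v : Fin r → Fin n → ℝ) : ℝ :=
  ∑ I : Fin r → Fin n, T I * ∏ s, v s (I s)

theorem tensorNorm_nonneg (G : CoordTensor n 2) (y : EuclideanSpace ℝ (Fin n))
    (T : (Fin r → Fin n) → ℝ) : 0 ≤ tensorNorm G y T := Real.sqrt_nonneg _

open scoped MatrixOrder Matrix.Norms.L2Operator in
/-- Existence of orthonormal frames: `Q` is the dual frame. -/
theorem exists_frame (h : (gram G y).PosDef) : ∃ P Q : Matrix (Fin n) (Fin n) ℝ,
    P * Q = 1 ∧ Q * P = 1 ∧ Q.transpose * Q = gram G y ∧ P * P.transpose = (gram G y)⁻¹ := by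
  obtain ⟨Q, hQ⟩ := CStarAlgebra.nonneg_iff_eq_star_mul_self.mp h.posSemidef.nonneg
  have hQ' : gram G y = Q.transpose * Q := by
    rw [hQ, Matrix.star_eq_conjTranspose, Matrix.conjTranspose_eq_transpose_of_trivial]
  have hdet : Q.det ≠ 0 := by
    intro h0
    have := h.det_pos
    rw [hQ', Matrix.det_mul, h0, mul_zero] at this
    exact this.false
  refine ⟨Q⁻¹, Q, Matrix.nonsing_inv_mul _ hdet.isUnit, Matrix.mul_nonsing_inv _ hdet.isUnit,
    hQ'.symm, ?_⟩
  rw [hQ', Matrix.mul_inv_rev, Matrix.transpose_nonsing_inv]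

theorem quad_eq_of_frame {Q : Matrix (Fin n) (Fin n) ℝ} (hQ : Q.transpose * Q = gram G y)
    (v : Fin n → ℝ) : quad G y v = ∑ k, (∑ a, Q k a * v a) ^ 2 := by
  have : ∀ a b, G y ![a, b] = ∑ k, Q k a * Q k b := by
    intro a b
    rw [← gram_apply G y, ← hQ, Matrix.mul_apply]; rfl
  have h2 : ∀ k, (∑ a, Q k a * v a) ^ 2 = ∑ a, ∑ b, v a * v b * (Q k a * Q k b) := by
    intro k
    rw [sq, Finset.sum_mul_sum]
    exact Finset.sum_congr rfl fun a _ => Finset.sum_congr rfl fun b _ => by ring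
  simp only [quad, this, h2, Finset.mul_sum]
  rw [Finset.sum_congr rfl fun a _ => Finset.sum_comm, Finset.sum_comm]

/-- Since g^{ij} = ∑ₖ P_{ik}P_{jk}, the contraction splits in every slot. The columns of P form an
orthonormal frame, in which the norm is the Euclidean one. -/
theorem tensorNorm_eq_of_frame {P : Matrix (Fin n) (Fin n) ℝ}
    (hP : P * P.transpose = (gram G y)⁻¹) (T : (Fin r → Fin n) → ℝ) :
    tensorNorm G y T
      = Real.sqrt (∑ K : Fin r → Fin n, (tensorEval T fun s a => P a (K s)) ^ 2) := by
  unfold tensorNorm tensorEval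
  congr 1
  have h1 : ∀ I J : Fin r → Fin n, ∏ s, invMetric G y (I s) (J s)
      = ∑ K : Fin r → Fin n, ∏ s, (P (I s) (K s) * P (J s) (K s)) := by
    intro I J
    have : ∀ a b, invMetric G y a b = ∑ k, P a k * P b k := by
      intro a b
      rw [invMetric_eq, ← hP, Matrix.mul_apply]; rfl
    simp only [this, Finset.prod_univ_sum, Fintype.piFinset_univ]
  have h2 : ∀ K : Fin r → Fin n, (∑ I : Fin r → Fin n, T I * ∏ s, P (I s) (K s)) ^ 2
      = ∑ I : Fin r → Fin n, ∑ J : Fin r → Fin n,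
        (∏ s, (P (I s) (K s) * P (J s) (K s))) * T I * T J := by
    intro K
    rw [sq, Finset.sum_mul_sum]
    refine Finset.sum_congr rfl fun I _ => Finset.sum_congr rfl fun J _ => ?_
    rw [Finset.prod_mul_distrib]
    ring
  simp only [h1, h2, Finset.sum_mul]
  rw [Finset.sum_congr rfl fun a _ => Finset.sum_comm, Finset.sum_comm]

/-- `|T(v₁, …, v_r)| ≤ |T| |v₁| ⋯ |v_r|`. -/
theorem abs_tensorEval_le (h : (gram G y).PosDef) (T : (Fin r → Fin n) → ℝ)
    (v : Fin r → Fin n → ℝ) :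
    |tensorEval T v| ≤ tensorNorm G y T * ∏ s, Real.sqrt (quad G y (v s)) := by
  obtain ⟨P, Q, hPQ, -, hQ, hP⟩ := exists_frame h
  set w : Fin r → Fin n → ℝ := fun s k => ∑ a, Q k a * v s a with hw
  have hv : ∀ s a, v s a = ∑ k, P a k * w s k := by
    intro s a
    have : P.mulVec (Q.mulVec (v s)) = v s := by
      rw [Matrix.mulVec_mulVec, hPQ, Matrix.one_mulVec]
    exact (congrFun this a).symm
  -- Expanding each vector in the frame, with coordinates `w`, reduces the claim to Cauchy–Schwarz
  -- over multi-indices.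
  have h1 : tensorEval T v
      = ∑ K : Fin r → Fin n, (tensorEval T fun s a => P a (K s)) * ∏ s, w s (K s) := by
    unfold tensorEval
    simp only [hv, Finset.prod_univ_sum, Fintype.piFinset_univ, Finset.mul_sum, Finset.sum_mul]
    rw [Finset.sum_comm]
    refine Finset.sum_congr rfl fun K _ => Finset.sum_congr rfl fun I _ => ?_
    rw [Finset.prod_mul_distrib]
    ring
  have h2 : ∏ s, Real.sqrt (quad G y (v s))
      = Real.sqrt (∑ K : Fin r → Fin n, (∏ s, w s (K s)) ^ 2) := by
    rw [← Real.sqrt_prod]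
    · have hq : ∀ s, quad G y (v s) = ∑ k, w s k ^ 2 := fun s => quad_eq_of_frame hQ _
      congr 1
      simp only [hq, ← Finset.prod_pow, Finset.prod_univ_sum,
        Fintype.piFinset_univ]
    · intro s _
      rw [quad_eq_of_frame hQ]
      positivity
  rw [tensorNorm_eq_of_frame hP, h2, h1, abs_le]
  refine ⟨?_, Real.sum_mul_le_sqrt_mul_sqrt _ _ _⟩
  rw [neg_le, ← Finset.sum_neg_distrib]
  refine (le_of_eq ?_).trans ((Real.sum_mul_le_sqrt_mul_sqrt Finset.univ
    (fun K => -(tensorEval T fun s a => P a (K s))) (fun K : Fin r → Fin n => ∏ s, w s (K s))).trans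
      (le_of_eq ?_))
  · simp
  · simp

theorem abs_component_le (h : (gram G y).PosDef) (T : (Fin r → Fin n) → ℝ) (I : Fin r → Fin n) :
    |T I| ≤ tensorNorm G y T * ∏ s, Real.sqrt (G y ![I s, I s]) := by
  have h1 := abs_tensorEval_le h T fun s => Pi.single (I s) 1
  have h2 : ∀ a, quad G y (Pi.single a 1) = G y ![a, a] := by
    intro a
    unfold quad
    rw [Finset.sum_eq_single a (fun b _ hb => by simp [Pi.single_eq_of_ne hb]) (by simp),
      Finset.sum_eq_single a (fun b _ hb => by simp [Pi.single_eq_of_ne hb]) (by simp)]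
    simp
  have h3 : tensorEval T (fun s => Pi.single (I s) 1) = T I := by
    unfold tensorEval
    rw [Finset.sum_eq_single I _ (by simp)]
    · simp
    · intro J _ hJ
      obtain ⟨s, hs⟩ := Function.ne_iff.1 hJ
      rw [Finset.prod_eq_zero (Finset.mem_univ s) (Pi.single_eq_of_ne hs _), mul_zero]
  simpa only [h2, h3] using h1

/-- Deliberately crude: only uniformity matters when component bounds are turned back into norms. -/
theorem tensorNorm_le {c b : ℝ} (hg : ∀ i j, |invMetric G y i j| ≤ c) {T : (Fin r → Fin n) → ℝ}
    (hT : ∀ I, |T I| ≤ b) :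
    tensorNorm G y T ≤ Real.sqrt (∑ _I : Fin r → Fin n, ∑ _J : Fin r → Fin n, c ^ r * b * b) := by
  refine Real.sqrt_le_sqrt (Finset.sum_le_sum fun I _ => Finset.sum_le_sum fun J _ => ?_)
  refine (le_abs_self _).trans ?_
  rw [abs_mul, abs_mul, Finset.abs_prod]
  have h1 : ∏ s, |invMetric G y (I s) (J s)| ≤ c ^ r :=
    (Finset.prod_le_prod (fun _ _ => abs_nonneg _) fun _ _ => hg _ _).trans (by simp)
  have h2 : 0 ≤ ∏ s, |invMetric G y (I s) (J s)| := Finset.prod_nonneg fun _ _ => abs_nonneg _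
  have h3 := hT I
  have h4 := hT J
  have h5 := abs_nonneg (T I)
  have h6 := abs_nonneg (T J)
  exact mul_le_mul (mul_le_mul h1 h3 h5 (h2.trans h1)) h4 h6
    (mul_nonneg (h2.trans h1) (h5.trans h3))

/-- Let w be the i-th column of the inverse. Then g(w,w) = wᵢ, so c|w|² ≤ wᵢ; this gives first wᵢ ≤
1/c and then |wₖ| ≤ 1/c for every k. -/
theorem abs_invMetric_le (h : (gram G y).PosDef) {c : ℝ} (hc : 0 < c)
    (hG : ∀ v, c * ∑ a, v a ^ 2 ≤ quad G y v) (i j : Fin n) : |invMetric G y i j| ≤ c⁻¹ := by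
  set w : Fin n → ℝ := fun b => invMetric G y b i with hw
  have hGw : ∀ a, ∑ b, w b * G y ![a, b] = if a = i then 1 else 0 := by
    intro a
    have := congrFun (congrFun (Matrix.mul_nonsing_inv (gram G y) h.det_pos.ne'.isUnit) a) i
    rw [Matrix.mul_apply, Matrix.one_apply] at this
    rw [← this]
    exact Finset.sum_congr rfl fun b _ => mul_comm _ _
  have hq : quad G y w = w i := by
    unfold quad
    simp only [mul_assoc, ← Finset.mul_sum, hGw]
    simp
  have h1 := hG w
  rw [hq] at h1
  have hle : ∀ k, w k ^ 2 ≤ ∑ a, w a ^ 2 := fun k =>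
    Finset.single_le_sum (f := fun a => w a ^ 2) (fun a _ => sq_nonneg _) (Finset.mem_univ k)
  have hi : c * w i ^ 2 ≤ w i := (mul_le_mul_of_nonneg_left (hle i) hc.le).trans h1
  have hwi0 : 0 ≤ w i := le_trans (by positivity) hi
  have hwi : w i ≤ c⁻¹ := by
    rcases hwi0.eq_or_lt with h0 | h0
    · rw [← h0]; positivity
    · rw [le_inv_comm₀ h0 hc, ← one_div, le_div_iff₀ h0]
      nlinarith
  have hj : ∀ k, |w k| ≤ c⁻¹ := by
    intro k
    have h2 : c * w k ^ 2 ≤ c⁻¹ := ((mul_le_mul_of_nonneg_left (hle k) hc.le).trans h1).trans hwi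
    refine abs_le_of_sq_le_sq ?_ (by positivity)
    have h3 : w k ^ 2 ≤ c⁻¹ * c⁻¹ := by
      rw [← div_eq_mul_inv, le_div_iff₀ hc]; linarith
    nlinarith
  have hsymm : invMetric G y i j = invMetric G y j i := by
    have := h.inv.1.apply i j
    simpa [invMetric_eq] using this.symm
  rw [hsymm]
  exact hj j

theorem quad_frame {P Q : Matrix (Fin n) (Fin n) ℝ} (hQP : Q * P = 1)
    (hQ : Q.transpose * Q = gram G y) (k : Fin n) : quad G y (fun a => P a k) = 1 := by
  rw [quad_eq_of_frame hQ]
  have : ∀ l, ∑ a, Q l a * P a k = if l = k then 1 else 0 := fun l => by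
    rw [← Matrix.mul_apply, hQP, Matrix.one_apply]
  simp [this]

theorem quad_nonneg (h : (gram G y).PosDef) (v : Fin n → ℝ) : 0 ≤ quad G y v := by
  obtain ⟨P, Q, -, -, hQ, -⟩ := exists_frame h
  rw [quad_eq_of_frame hQ]
  positivity

theorem tensorEval_three (T : (Fin 3 → Fin n) → ℝ) (v : Fin 3 → Fin n → ℝ) :
    tensorEval T v = ∑ i, ∑ j, ∑ k, T ![i, j, k] * (v 0 i * v 1 j * v 2 k) := by
  unfold tensorEval
  rw [sum_fin_three_fun]
  simp [Fin.prod_univ_three]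

theorem tensorEval_four (T : (Fin 4 → Fin n) → ℝ) (v : Fin 4 → Fin n → ℝ) :
    tensorEval T v = ∑ i, ∑ j, ∑ k, ∑ l, T ![i, j, k, l] * (v 0 i * v 1 j * v 2 k * v 3 l) := by
  unfold tensorEval
  rw [sum_fin_four_fun]
  simp [Fin.prod_univ_four]

/-- `|Ric(V, V)| ≤ n |Rm| |V|²`. -/
theorem abs_ricci_le (h : (gram G y).PosDef) (V : Fin n → ℝ) :
    |∑ i, ∑ j, V i * V j * ricci G y ![i, j]|
      ≤ n * tensorNorm G y (riemann G y) * quad G y V := by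
  obtain ⟨P, Q, -, hQP, hQ, hP⟩ := exists_frame h
  have hinv : ∀ a b, invMetric G y a b = ∑ k, P a k * P b k := by
    intro a b
    rw [invMetric_eq, ← hP, Matrix.mul_apply]; rfl
  -- Trace in an orthonormal frame: Ric(V,V) = ∑ₐ Rm(V,eₐ,V,eₐ), and each term is at most |Rm||V|².
  have h1 : ∑ i, ∑ j, V i * V j * ricci G y ![i, j]
      = ∑ a, tensorEval (riemann G y) ![V, fun k => P k a, V, fun k => P k a] := by
    simp only [tensorEval_four, ricci, hinv, Finset.sum_mul, Finset.mul_sum]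
    simp only [Matrix.cons_val_zero, Matrix.cons_val_one, Matrix.cons_val]
    rw [Finset.sum_comm (s := Finset.univ) (t := Finset.univ) (f := fun a i => ∑ j, ∑ k, ∑ l,
      riemann G y ![i, j, k, l] * (V i * P j a * V k * P l a))]
    refine Finset.sum_congr rfl fun i _ => ?_
    refine Finset.sum_comm.trans (Eq.trans ?_ Finset.sum_comm)
    refine Finset.sum_congr rfl fun j _ => ?_
    refine Eq.trans ?_ Finset.sum_comm
    refine Finset.sum_congr rfl fun k _ => ?_
    refine Eq.trans ?_ Finset.sum_comm
    refine Finset.sum_congr rfl fun l _ => ?_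
    exact Finset.sum_congr rfl fun a _ => by ring
  rw [h1]
  refine (Finset.abs_sum_le_sum_abs _ _).trans ?_
  have h2 : ∀ a, |tensorEval (riemann G y) ![V, fun k => P k a, V, fun k => P k a]|
      ≤ tensorNorm G y (riemann G y) * quad G y V := by
    intro a
    refine (abs_tensorEval_le h _ _).trans (le_of_eq ?_)
    rw [Fin.prod_univ_four]
    simp only [Matrix.cons_val_zero, Matrix.cons_val_one, Matrix.cons_val, quad_frame hQP hQ]
    rw [Real.sqrt_one, mul_one, mul_one, Real.mul_self_sqrt (quad_nonneg h V)]
  refine (Finset.sum_le_sum fun a _ => h2 a).trans (le_of_eq ?_)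
  simp [mul_assoc]

/-- `|h(V, V)| ≤ n² |H|² |V|²`. -/
theorem abs_hTensor_le (h : (gram G y).PosDef) (H : CoordTensor n 3) (V : Fin n → ℝ) :
    |∑ i, ∑ j, V i * V j * hTensor G H y ![i, j]|
      ≤ n ^ 2 * tensorNorm G y (H y) ^ 2 * quad G y V := by
  obtain ⟨P, Q, -, hQP, hQ, hP⟩ := exists_frame h
  have hinv : ∀ a b, invMetric G y a b = ∑ k, P a k * P b k := by
    intro a b
    rw [invMetric_eq, ← hP, Matrix.mul_apply]; rfl
  -- In an orthonormal frame h(V,V) = ∑ H(V,eₐ,e_b)².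
  have h1 : ∑ i, ∑ j, V i * V j * hTensor G H y ![i, j]
      = ∑ a, ∑ b, tensorEval (H y) ![V, fun k => P k a, fun k => P k b] ^ 2 := by
    have e : ∀ a b, tensorEval (H y) ![V, fun k => P k a, fun k => P k b] ^ 2
        = ∑ i, ∑ j, ∑ k, ∑ p, ∑ l, ∑ q, V i * V j *
          (P k a * P p a * (P l b * P q b) * H y ![i, k, l] * H y ![j, p, q]) := by
      intro a b
      rw [tensorEval_three, sq, Finset.sum_mul_sum]
      refine Finset.sum_congr rfl fun i _ => Finset.sum_congr rfl fun j _ => ?_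
      rw [Finset.sum_mul_sum]
      refine Finset.sum_congr rfl fun k _ => Finset.sum_congr rfl fun p _ => ?_
      rw [Finset.sum_mul_sum]
      refine Finset.sum_congr rfl fun l _ => Finset.sum_congr rfl fun q _ => ?_
      simp only [Matrix.cons_val_zero, Matrix.cons_val_one, Matrix.cons_val]
      ring
    simp only [e]
    have s1 : ∀ f : Fin n → Fin n → Fin n → Fin n → ℝ,
        ∑ a, ∑ b, ∑ i, ∑ j, f a b i j = ∑ i, ∑ j, ∑ a, ∑ b, f a b i j := by
      intro f
      rw [Finset.sum_congr rfl fun a _ => Finset.sum_comm, Finset.sum_comm]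
      refine Finset.sum_congr rfl fun i _ => ?_
      rw [Finset.sum_congr rfl fun a _ => Finset.sum_comm, Finset.sum_comm]
    rw [s1]
    refine Finset.sum_congr rfl fun i _ => Finset.sum_congr rfl fun j _ => ?_
    rw [s1]
    simp only [hTensor, hinv, Finset.mul_sum]
    refine Finset.sum_congr rfl fun k _ => Finset.sum_congr rfl fun p _ => ?_
    rw [s1]
    refine Finset.sum_congr rfl fun l _ => Finset.sum_congr rfl fun q _ => ?_
    simp only [← Finset.mul_sum, ← Finset.sum_mul]
    rfl
  rw [h1]
  refine (Finset.abs_sum_le_sum_abs _ _).trans ?_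
  have h2 : ∀ a b, tensorEval (H y) ![V, fun k => P k a, fun k => P k b] ^ 2
      ≤ tensorNorm G y (H y) ^ 2 * quad G y V := by
    intro a b
    have h3 := abs_tensorEval_le h (H y) ![V, fun k => P k a, fun k => P k b]
    rw [Fin.prod_univ_three] at h3
    simp only [Matrix.cons_val_zero, Matrix.cons_val_one, Matrix.cons_val, quad_frame hQP hQ] at h3
    rw [Real.sqrt_one, mul_one, mul_one] at h3
    have h4 := pow_le_pow_left₀ (abs_nonneg _) h3 2
    rwa [sq_abs, mul_pow, Real.sq_sqrt (quad_nonneg h V)] at h4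
  have h5 : ∀ a, |∑ b, tensorEval (H y) ![V, fun k => P k a, fun k => P k b] ^ 2|
      ≤ ∑ _b : Fin n, tensorNorm G y (H y) ^ 2 * quad G y V := by
    intro a
    rw [abs_of_nonneg (by positivity)]
    exact Finset.sum_le_sum fun b _ => h2 a b
  refine (Finset.sum_le_sum fun a _ => h5 a).trans (le_of_eq ?_)
  simp
  ring

end Norm

/-! ### Families of functions with uniformly bounded jets -/

section Jets

variable {n : ℕ} {ι : Type*}

/-- A family of functions of space and time. -/
abbrev Fam (ι : Type*) (n : ℕ) : Type _ := ι → EuclideanSpace ℝ (Fin n) × ℝ → ℝ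

/-- Open sets `dom k` of space-time on which the members of a family live, with subsets `core k`
on which uniform bounds are considered. -/
structure FamDomain (ι : Type*) (n : ℕ) where
  dom : ι → Set (EuclideanSpace ℝ (Fin n) × ℝ)
  core : ι → Set (EuclideanSpace ℝ (Fin n) × ℝ)
  isOpen : ∀ k, IsOpen (dom k)
  subset : ∀ k, core k ⊆ dom k

/-- The derivative of a family in the direction `v`. -/
noncomputable def dirDeriv (v : EuclideanSpace ℝ (Fin n) × ℝ) (f : Fam ι n) : Fam ι n :=
  fun k z => fderiv ℝ (f k) z v

/-- The `a`-th coordinate direction in space. -/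
noncomputable def spaceDir (a : Fin n) : EuclideanSpace ℝ (Fin n) × ℝ :=
  (EuclideanSpace.single a 1, 0)

/-- The time direction. -/
def timeDir (n : ℕ) : EuclideanSpace ℝ (Fin n) × ℝ := (0, 1)

variable (D : FamDomain ι n) (w : Fam ι n)

def SmoothFam (f : Fam ι n) : Prop := ∀ k, ContDiffOn ℝ ∞ (f k) (D.dom k)

/-- `f = O(1 + w)` uniformly on the cores. -/
def BddFam (f : Fam ι n) : Prop :=
  ∃ c : ℝ, 0 ≤ c ∧ ∀ k, ∀ z ∈ D.core k, |f k z| ≤ c * (1 + w k z)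

/-- The spatial derivatives of `f` of order `< p` are uniformly bounded, and those of order `p` are
`O(1 + w)`. -/
def JetBdd : ℕ → Fam ι n → Prop
  | 0, f => SmoothFam D f ∧ BddFam D w f
  | p + 1, f => SmoothFam D f ∧ BddFam D 0 f ∧ ∀ a, JetBdd p (dirDeriv (spaceDir a) f)

/-- All mixed derivatives with at most `q` derivatives in time are uniformly bounded. -/
def TimeJetBdd : ℕ → Fam ι n → Prop
  | 0, f => ∀ p, JetBdd D 0 p f
  | q + 1, f => (∀ p, JetBdd D 0 p f) ∧ TimeJetBdd q (dirDeriv (timeDir n) f)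

variable {D w}

/-! ### Smooth families and families of size O(1 + w) -/

section Basic

theorem SmoothFam.differentiableAt {f : Fam ι n} (hf : SmoothFam D f) {k : ι}
    {z : EuclideanSpace ℝ (Fin n) × ℝ} (hz : z ∈ D.dom k) : DifferentiableAt ℝ (f k) z :=
  ((hf k).contDiffAt ((D.isOpen k).mem_nhds hz)).differentiableAt (by simp)

theorem SmoothFam.congr {f g : Fam ι n} (hf : SmoothFam D f) (h : ∀ k, EqOn (g k) (f k) (D.dom k)) :
    SmoothFam D g := fun k => (hf k).congr (h k)

theorem SmoothFam.dirDeriv {f : Fam ι n} (hf : SmoothFam D f) (v : EuclideanSpace ℝ (Fin n) × ℝ) :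
    SmoothFam D (dirDeriv v f) := fun k =>
  ((hf k).fderiv_of_isOpen (D.isOpen k) (m := ∞) (by simp)).clm_apply contDiffOn_const

theorem SmoothFam.const (c : ℝ) : SmoothFam D (fun _ _ => c) := fun _ => contDiffOn_const

theorem SmoothFam.add {f g : Fam ι n} (hf : SmoothFam D f) (hg : SmoothFam D g) :
    SmoothFam D (fun k z => f k z + g k z) := fun k => (hf k).add (hg k)

theorem SmoothFam.mul {f g : Fam ι n} (hf : SmoothFam D f) (hg : SmoothFam D g) :
    SmoothFam D (fun k z => f k z * g k z) := fun k => (hf k).mul (hg k)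

theorem dirDeriv_congr {f g : Fam ι n} (h : ∀ k, EqOn (g k) (f k) (D.dom k))
    (v : EuclideanSpace ℝ (Fin n) × ℝ) (k : ι) :
    EqOn (dirDeriv v g k) (dirDeriv v f k) (D.dom k) := fun z hz => by
  unfold dirDeriv
  rw [((h k).eventuallyEq_of_mem ((D.isOpen k).mem_nhds hz)).fderiv_eq]

theorem dirDeriv_add {f g : Fam ι n} (hf : SmoothFam D f) (hg : SmoothFam D g)
    (v : EuclideanSpace ℝ (Fin n) × ℝ) (k : ι) :
    EqOn (dirDeriv v (fun k z => f k z + g k z) k)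
      ((fun k z => dirDeriv v f k z + dirDeriv v g k z : Fam ι n) k) (D.dom k) := fun z hz => by
  unfold dirDeriv
  rw [fderiv_fun_add (hf.differentiableAt hz) (hg.differentiableAt hz)]; rfl

/-- The differentiated factor comes first in both summands, matching `JetBdd.mul`, where only the
second factor has to be bounded outright. -/
theorem dirDeriv_mul {f g : Fam ι n} (hf : SmoothFam D f) (hg : SmoothFam D g)
    (v : EuclideanSpace ℝ (Fin n) × ℝ) (k : ι) :
    EqOn (dirDeriv v (fun k z => f k z * g k z) k)
      ((fun k z => dirDeriv v f k z * g k z + dirDeriv v g k z * f k z : Fam ι n) k)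
      (D.dom k) := fun z hz => by
  unfold dirDeriv
  rw [fderiv_fun_mul (hf.differentiableAt hz) (hg.differentiableAt hz)]
  simp; ring

theorem dirDeriv_const (c : ℝ) (v : EuclideanSpace ℝ (Fin n) × ℝ) :
    dirDeriv v (fun (_ : ι) _ => c) = fun _ _ => 0 := by
  funext k z
  simp [dirDeriv]

theorem dirDeriv_comm {f : Fam ι n} (hf : SmoothFam D f) (v u : EuclideanSpace ℝ (Fin n) × ℝ)
    (k : ι) : EqOn (dirDeriv v (dirDeriv u f) k) (dirDeriv u (dirDeriv v f) k) (D.dom k) :=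
  fun z hz => by
  have hc := (hf k).contDiffAt ((D.isOpen k).mem_nhds hz)
  have hs : IsSymmSndFDerivAt ℝ (f k) z :=
    hc.isSymmSndFDerivAt (by simp; exact WithTop.coe_le_coe.2 le_top)
  have hd : DifferentiableAt ℝ (fderiv ℝ (f k)) z :=
    (hc.fderiv_right (m := 1) (by norm_cast)).differentiableAt (by simp)
  have key : ∀ v u : EuclideanSpace ℝ (Fin n) × ℝ,
      fderiv ℝ (fun x => fderiv ℝ (f k) x v) z u = fderiv ℝ (fderiv ℝ (f k)) z u v := by
    intro v u
    rw [(hd.hasFDerivAt.clm_apply (hasFDerivAt_const v z)).fderiv]; simp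
  unfold dirDeriv
  rw [key, key]
  exact hs _ _

theorem BddFam.congr {f g : Fam ι n} (hf : BddFam D w f) (h : ∀ k, EqOn (g k) (f k) (D.dom k)) :
    BddFam D w g := by
  obtain ⟨c, hc, hb⟩ := hf
  exact ⟨c, hc, fun k z hz => by rw [h k (D.subset k hz)]; exact hb k z hz⟩

theorem BddFam.of_zero (hw : ∀ k z, 0 ≤ w k z) {f : Fam ι n} (hf : BddFam D 0 f) :
    BddFam D w f := by
  obtain ⟨c, hc, hb⟩ := hf
  refine ⟨c, hc, fun k z hz => (hb k z hz).trans ?_⟩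
  have := hw k z
  simp only [Pi.zero_apply]
  nlinarith

theorem BddFam.const (hw : ∀ k z, 0 ≤ w k z) (c : ℝ) : BddFam D w (fun _ _ => c) :=
  BddFam.of_zero hw ⟨|c|, abs_nonneg c, fun k z _ => by simp⟩

theorem BddFam.add {f g : Fam ι n} (hf : BddFam D w f) (hg : BddFam D w g) :
    BddFam D w (fun k z => f k z + g k z) := by
  obtain ⟨c, hc, hb⟩ := hf
  obtain ⟨c', hc', hb'⟩ := hg
  refine ⟨c + c', add_nonneg hc hc', fun k z hz => (abs_add_le _ _).trans ?_⟩
  rw [add_mul]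
  exact add_le_add (hb k z hz) (hb' k z hz)

/-- One factor carries weight 0 because a product of two O(1 + w) terms would be quadratic in w, and
Grönwall's inequality needs linear growth. -/
theorem BddFam.mul {f g : Fam ι n} (hf : BddFam D w f) (hg : BddFam D 0 g) :
    BddFam D w (fun k z => f k z * g k z) := by
  obtain ⟨c, hc, hb⟩ := hf
  obtain ⟨c', hc', hb'⟩ := hg
  refine ⟨c * c', mul_nonneg hc hc', fun k z hz => ?_⟩
  have h1 := hb k z hz
  have h2 := hb' k z hz
  simp only [Pi.zero_apply, add_zero, mul_one] at h2
  rw [abs_mul]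
  refine (mul_le_mul h1 h2 (abs_nonneg _) ((abs_nonneg _).trans h1)).trans (le_of_eq (by ring))

end Basic

/-! ### Calculus of spatial jets with a weight at top order -/

section JetBdd

theorem JetBdd.smooth {p : ℕ} {f : Fam ι n} (h : JetBdd D w p f) : SmoothFam D f := by
  cases p <;> exact h.1

theorem JetBdd.bdd {p : ℕ} {f : Fam ι n} (h : JetBdd D w (p + 1) f) : BddFam D 0 f := h.2.1

theorem JetBdd.congr {p : ℕ} {f g : Fam ι n} (hf : JetBdd D w p f)
    (h : ∀ k, EqOn (g k) (f k) (D.dom k)) : JetBdd D w p g := by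
  induction p generalizing f g with
  | zero => exact ⟨hf.1.congr h, hf.2.congr h⟩
  | succ p ih =>
    exact ⟨hf.1.congr h, hf.2.1.congr h, fun a => ih (hf.2.2 a) (dirDeriv_congr h _)⟩

theorem JetBdd.of_succ (hw : ∀ k z, 0 ≤ w k z) {p : ℕ} {f : Fam ι n} (hf : JetBdd D w (p + 1) f) :
    JetBdd D w p f := by
  induction p generalizing f with
  | zero => exact ⟨hf.1, hf.2.1.of_zero hw⟩
  | succ p ih => exact ⟨hf.1, hf.2.1, fun a => ih (hf.2.2 a)⟩

theorem JetBdd.mono (hw : ∀ k z, 0 ≤ w k z) {p q : ℕ} (hpq : p ≤ q) {f : Fam ι n}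
    (hf : JetBdd D w q f) : JetBdd D w p f := by
  induction hpq with
  | refl => exact hf
  | step _ ih => exact ih (hf.of_succ hw)

theorem JetBdd.const (hw : ∀ k z, 0 ≤ w k z) (p : ℕ) (c : ℝ) : JetBdd D w p (fun _ _ => c) := by
  induction p generalizing c with
  | zero => exact ⟨SmoothFam.const c, BddFam.const hw c⟩
  | succ p ih =>
    refine ⟨SmoothFam.const c, BddFam.const (fun _ _ => le_rfl) c, fun a => ?_⟩
    rw [dirDeriv_const]
    exact ih 0

theorem JetBdd.add {p : ℕ} {f g : Fam ι n} (hf : JetBdd D w p f) (hg : JetBdd D w p g) :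
    JetBdd D w p (fun k z => f k z + g k z) := by
  induction p generalizing f g with
  | zero => exact ⟨hf.1.add hg.1, hf.2.add hg.2⟩
  | succ p ih =>
    exact ⟨hf.1.add hg.1, hf.2.1.add hg.2.1, fun a =>
      (ih (hf.2.2 a) (hg.2.2 a)).congr (dirDeriv_add hf.1 hg.1 _)⟩

/-- A derivative of top order falls entirely on one factor while the other stays undifferentiated
and bounded, so the weight enters linearly. The bound on g adds information only for p = 0; for
positive p it is part of the jet bound. -/
theorem JetBdd.mul (hw : ∀ k z, 0 ≤ w k z) {p : ℕ} {f g : Fam ι n} (hf : JetBdd D w p f)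
    (hg : JetBdd D w p g) (hgb : BddFam D 0 g) : JetBdd D w p (fun k z => f k z * g k z) := by
  induction p generalizing f g with
  | zero => exact ⟨hf.1.mul hg.1, hf.2.mul hgb⟩
  | succ p ih =>
    exact ⟨hf.1.mul hg.1, hf.2.1.mul hgb, fun a =>
      ((ih (hf.2.2 a) (hg.of_succ hw) hgb).add (ih (hg.2.2 a) (hf.of_succ hw) hf.2.1)).congr
        (dirDeriv_mul hf.1 hg.1 _)⟩

theorem JetBdd.const_mul (hw : ∀ k z, 0 ≤ w k z) {p : ℕ} {f : Fam ι n} (hf : JetBdd D w p f)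
    (c : ℝ) : JetBdd D w p (fun k z => c * f k z) := by
  have := hf.mul hw (JetBdd.const hw p c) (BddFam.const (fun _ _ => le_rfl) c)
  simpa only [mul_comm c] using this

theorem JetBdd.sub (hw : ∀ k z, 0 ≤ w k z) {p : ℕ} {f g : Fam ι n} (hf : JetBdd D w p f)
    (hg : JetBdd D w p g) : JetBdd D w p (fun k z => f k z - g k z) := by
  have := hf.add (hg.const_mul hw (-1))
  simpa only [neg_one_mul, ← sub_eq_add_neg] using this

theorem JetBdd.sum (hw : ∀ k z, 0 ≤ w k z) {p : ℕ} {α : Type*} {s : Finset α} {f : α → Fam ι n}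
    (hf : ∀ i ∈ s, JetBdd D w p (f i)) : JetBdd D w p (fun k z => ∑ i ∈ s, f i k z) := by
  classical
  induction s using Finset.induction_on with
  | empty => simpa using JetBdd.const hw p 0
  | insert i s hi ih =>
    simp only [Finset.sum_insert hi]
    exact (hf i (Finset.mem_insert_self _ _)).add
      (ih fun j hj => hf j (Finset.mem_insert_of_mem hj))

end JetBdd

/-! ### Calculus of mixed space-time jets -/

section TimeJetBdd

variable {q : ℕ} {f g : Fam ι n}

theorem zero_weight_nonneg : ∀ k z, 0 ≤ (0 : Fam ι n) k z := fun _ _ => le_rfl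

theorem TimeJetBdd.jetBdd (h : TimeJetBdd D q f) (p : ℕ) : JetBdd D 0 p f := by
  cases q
  · exact h p
  · exact h.1 p

theorem TimeJetBdd.smooth (h : TimeJetBdd D q f) : SmoothFam D f := (h.jetBdd 0).1

theorem TimeJetBdd.bdd (h : TimeJetBdd D q f) : BddFam D 0 f := (h.jetBdd 0).2

theorem TimeJetBdd.congr (hf : TimeJetBdd D q f)
    (h : ∀ k, EqOn (g k) (f k) (D.dom k)) : TimeJetBdd D q g := by
  induction q generalizing f g with
  | zero => exact fun p => (hf p).congr h
  | succ q ih => exact ⟨fun p => (hf.1 p).congr h, ih hf.2 (dirDeriv_congr h _)⟩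

theorem TimeJetBdd.of_succ (hf : TimeJetBdd D (q + 1) f) : TimeJetBdd D q f := by
  induction q generalizing f with
  | zero => exact hf.1
  | succ q ih => exact ⟨hf.1, ih hf.2⟩

theorem TimeJetBdd.const (q : ℕ) (c : ℝ) : TimeJetBdd D q (fun _ _ => c) := by
  induction q generalizing c with
  | zero => exact fun p => JetBdd.const zero_weight_nonneg p c
  | succ q ih =>
    refine ⟨fun p => JetBdd.const zero_weight_nonneg p c, ?_⟩
    rw [dirDeriv_const]
    exact ih 0

theorem TimeJetBdd.add (hf : TimeJetBdd D q f) (hg : TimeJetBdd D q g) :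
    TimeJetBdd D q (fun k z => f k z + g k z) := by
  induction q generalizing f g with
  | zero => exact fun p => (hf p).add (hg p)
  | succ q ih =>
    exact ⟨fun p => (hf.1 p).add (hg.1 p),
      (ih hf.2 hg.2).congr (dirDeriv_add hf.smooth hg.smooth _)⟩

theorem TimeJetBdd.mul (hf : TimeJetBdd D q f) (hg : TimeJetBdd D q g) :
    TimeJetBdd D q (fun k z => f k z * g k z) := by
  induction q generalizing f g with
  | zero => exact fun p => (hf p).mul zero_weight_nonneg (hg p) hg.bdd
  | succ q ih =>
    exact ⟨fun p => (hf.1 p).mul zero_weight_nonneg (hg.1 p) hg.bdd,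
      ((ih hf.2 hg.of_succ).add (ih hg.2 hf.of_succ)).congr
        (dirDeriv_mul hf.smooth hg.smooth _)⟩

theorem TimeJetBdd.const_mul (hf : TimeJetBdd D q f) (c : ℝ) :
    TimeJetBdd D q (fun k z => c * f k z) := (TimeJetBdd.const q c).mul hf

theorem TimeJetBdd.neg (hf : TimeJetBdd D q f) : TimeJetBdd D q (fun k z => -f k z) := by
  simpa only [neg_one_mul] using hf.const_mul (-1)

theorem TimeJetBdd.sub (hf : TimeJetBdd D q f) (hg : TimeJetBdd D q g) :
    TimeJetBdd D q (fun k z => f k z - g k z) := by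
  simpa only [← sub_eq_add_neg] using hf.add hg.neg

theorem TimeJetBdd.sum {α : Type*} {s : Finset α} {f : α → Fam ι n}
    (hf : ∀ i ∈ s, TimeJetBdd D q (f i)) : TimeJetBdd D q (fun k z => ∑ i ∈ s, f i k z) := by
  classical
  induction s using Finset.induction_on with
  | empty => simpa using TimeJetBdd.const q 0
  | insert i s hi ih =>
    simp only [Finset.sum_insert hi]
    exact (hf i (Finset.mem_insert_self _ _)).add
      (ih fun j hj => hf j (Finset.mem_insert_of_mem hj))

theorem TimeJetBdd.dirDeriv (hf : TimeJetBdd D q f) (a : Fin n) :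
    TimeJetBdd D q (dirDeriv (spaceDir a) f) := by
  induction q generalizing f with
  | zero => exact fun p => (hf (p + 1)).2.2 a
  | succ q ih =>
    exact ⟨fun p => (hf.1 (p + 1)).2.2 a, (ih hf.2).congr (dirDeriv_comm hf.smooth _ _)⟩

end TimeJetBdd

/-! ### Jets of inverse matrices -/

section Inverse

variable {m : ℕ}

/-- Differentiate A⁻¹A = 1 and multiply by A⁻¹ on the right. -/
theorem fderiv_matrix_inv {X : Type*} [NormedAddCommGroup X] [NormedSpace ℝ X]
    {A : X → Matrix (Fin m) (Fin m) ℝ} {U : Set X} (hU : IsOpen U)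
    (h : ∀ i j, ContDiffOn ℝ ∞ (fun x => A x i j) U) (hdet : ∀ x ∈ U, (A x).det ≠ 0)
    {x : X} (hx : x ∈ U) (v : X) (i j : Fin m) :
    fderiv ℝ (fun x => (A x)⁻¹ i j) x v
      = ∑ c, ∑ d, (-1) * (fderiv ℝ (fun x => A x c d) x v * ((A x)⁻¹ i c * (A x)⁻¹ d j)) := by
  have hAd : ∀ i j, DifferentiableAt ℝ (fun x => A x i j) x := fun i j =>
    ((h i j).contDiffAt (hU.mem_nhds hx)).differentiableAt (by simp)
  have hBd : ∀ i j, DifferentiableAt ℝ (fun x => (A x)⁻¹ i j) x := fun i j =>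
    ((contDiffOn_matrix_inv h hdet i j).contDiffAt (hU.mem_nhds hx)).differentiableAt (by simp)
  have h1 : ∀ d, ∑ c, (fderiv ℝ (fun x => (A x)⁻¹ i c) x v * A x c d
      + (A x)⁻¹ i c * fderiv ℝ (fun x => A x c d) x v) = 0 := by
    intro d
    have e : (fun x => ∑ c, (A x)⁻¹ i c * A x c d) =ᶠ[nhds x]
        fun _ => (1 : Matrix (Fin m) (Fin m) ℝ) i d := by
      filter_upwards [hU.mem_nhds hx] with z hz
      rw [← Matrix.mul_apply, Matrix.nonsing_inv_mul _ (hdet z hz).isUnit]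
    have e2 := e.fderiv_eq (𝕜 := ℝ)
    rw [fderiv_fun_sum fun c _ => DifferentiableAt.fun_mul (𝕜 := ℝ) (hBd i c) (hAd c d)] at e2
    have e3 := congrArg (fun L : X →L[ℝ] ℝ => L v) e2
    have e4 : ∀ c, fderiv ℝ (fun x => (A x)⁻¹ i c * A x c d) x = (A x)⁻¹ i c •
        fderiv ℝ (fun x => A x c d) x + A x c d • fderiv ℝ (fun x => (A x)⁻¹ i c) x := fun c =>
      fderiv_fun_mul (hBd i c) (hAd c d)
    simp only [e4] at e3
    simp at e3
    rw [← e3]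
    exact Finset.sum_congr rfl fun c _ => by ring
  have h2 : ∀ c, ∑ d, A x c d * (A x)⁻¹ d j = if c = j then 1 else 0 := by
    intro c
    rw [← Matrix.mul_apply, Matrix.mul_nonsing_inv _ (hdet x hx).isUnit, Matrix.one_apply]
  have h3 : fderiv ℝ (fun x => (A x)⁻¹ i j) x v
      = ∑ c, fderiv ℝ (fun x => (A x)⁻¹ i c) x v * ∑ d, A x c d * (A x)⁻¹ d j := by
    simp [h2]
  have h4 : ∑ d, (∑ c, (fderiv ℝ (fun x => (A x)⁻¹ i c) x v * A x c d
      + (A x)⁻¹ i c * fderiv ℝ (fun x => A x c d) x v)) * (A x)⁻¹ d j = 0 := by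
    simp [h1]
  simp only [add_mul, Finset.sum_add_distrib, Finset.sum_mul] at h4
  rw [h3]
  simp only [Finset.mul_sum]
  rw [Finset.sum_comm (s := Finset.univ) (t := Finset.univ)] at h4
  rw [Finset.sum_comm (s := Finset.univ) (t := Finset.univ)
    (f := fun d c => (A x)⁻¹ i c * fderiv ℝ (fun x => A x c d) x v * (A x)⁻¹ d j)] at h4
  refine (eq_neg_of_add_eq_zero_left (Eq.trans ?_ h4)).trans (b := -∑ c, ∑ d,
    (A x)⁻¹ i c * fderiv ℝ (fun x => A x c d) x v * (A x)⁻¹ d j) ?_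
  · congr 1
    exact Finset.sum_congr rfl fun c _ => Finset.sum_congr rfl fun d _ => by ring
  · simp only [← Finset.sum_neg_distrib]
    exact Finset.sum_congr rfl fun c _ => Finset.sum_congr rfl fun d _ => by ring

/-- The entries of the inverse of a family of matrices. -/
noncomputable def invFam (A : Fin m → Fin m → Fam ι n) (i j : Fin m) : Fam ι n :=
  fun k z => (Matrix.of fun a b => A a b k z)⁻¹ i j

variable {A : Fin m → Fin m → Fam ι n}

theorem SmoothFam.invFam (hA : ∀ i j, SmoothFam D (A i j))
    (hdet : ∀ k, ∀ z ∈ D.dom k, (Matrix.of fun a b => A a b k z).det ≠ 0) (i j : Fin m) :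
    SmoothFam D (invFam A i j) := fun k =>
  contDiffOn_matrix_inv (A := fun z => Matrix.of fun a b => A a b k z) (fun a b => hA a b k)
    (hdet k) i j

theorem dirDeriv_invFam (hA : ∀ i j, SmoothFam D (A i j))
    (hdet : ∀ k, ∀ z ∈ D.dom k, (Matrix.of fun a b => A a b k z).det ≠ 0)
    (v : EuclideanSpace ℝ (Fin n) × ℝ) (i j : Fin m) (k : ι) :
    EqOn (dirDeriv v (invFam A i j) k) ((fun k z => ∑ c, ∑ d, (-1) * (dirDeriv v (A c d) k z
      * (invFam A i c k z * invFam A d j k z)) : Fam ι n) k) (D.dom k) := fun _ hz =>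
  fderiv_matrix_inv (A := fun z => Matrix.of fun a b => A a b k z) (D.isOpen k)
    (fun a b => hA a b k) (hdet k) hz v i j

/-- By ∂(A⁻¹) = -A⁻¹(∂A)A⁻¹, every derivative of the inverse is polynomial in derivatives of A and
entries of A⁻¹. A bound on A⁻¹ itself is therefore the only extra input. -/
theorem JetBdd.invFam (hw : ∀ k z, 0 ≤ w k z) {p : ℕ} (hA : ∀ i j, JetBdd D w p (A i j))
    (hdet : ∀ k, ∀ z ∈ D.dom k, (Matrix.of fun a b => A a b k z).det ≠ 0)
    (hb : ∀ i j, BddFam D 0 (invFam A i j)) (i j : Fin m) : JetBdd D w p (invFam A i j) := by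
  have hs := SmoothFam.invFam (fun i j => (hA i j).smooth) hdet
  induction p generalizing i j with
  | zero => exact ⟨hs i j, (hb i j).of_zero hw⟩
  | succ p ih =>
    have ih' := ih fun i j => (hA i j).of_succ hw
    refine ⟨hs i j, hb i j, fun a => ?_⟩
    refine JetBdd.congr ?_ (dirDeriv_invFam (fun i j => (hA i j).smooth) hdet _ i j)
    refine JetBdd.sum hw fun c _ => JetBdd.sum hw fun d _ => JetBdd.const_mul hw ?_ _
    exact ((hA c d).2.2 a).mul hw ((ih' i c).mul hw (ih' d j) (hb d j)) ((hb i c).mul (hb d j))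

theorem TimeJetBdd.invFam {q : ℕ} (hA : ∀ i j, TimeJetBdd D q (A i j))
    (hdet : ∀ k, ∀ z ∈ D.dom k, (Matrix.of fun a b => A a b k z).det ≠ 0)
    (hb : ∀ i j, BddFam D 0 (invFam A i j)) (i j : Fin m) : TimeJetBdd D q (invFam A i j) := by
  have h0 : ∀ i j p, JetBdd D 0 p (GRF.invFam A i j) := fun i j p =>
    JetBdd.invFam zero_weight_nonneg (fun i j => (hA i j).jetBdd p) hdet hb i j
  induction q generalizing i j with
  | zero => exact h0 i j
  | succ q ih =>
    have ih' := ih fun i j => (hA i j).of_succ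
    refine ⟨h0 i j, ?_⟩
    refine TimeJetBdd.congr ?_ (dirDeriv_invFam (fun i j => (hA i j).smooth) hdet _ i j)
    refine TimeJetBdd.sum fun c _ => TimeJetBdd.sum fun d _ => TimeJetBdd.const_mul ?_ _
    exact (hA c d).2.mul ((ih' i c).mul (ih' d j))

end Inverse

end Jets

/-! ### Families of tensor fields -/

section TensorFamilies

variable {n r : ℕ} {ι : Type*}

/-- A family of time-dependent tensor fields. -/
abbrev TensorFam (ι : Type*) (n r : ℕ) : Type _ := ι → ℝ → CoordTensor n r

/-- A component of a family of tensor fields. -/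
def TensorFam.comp (T : TensorFam ι n r) (I : Fin r → Fin n) : Fam ι n := fun k z => T k z.2 z.1 I

variable (D : FamDomain ι n)

/-- A family of smooth Riemannian metrics. -/
structure IsMetricFam (g : TensorFam ι n 2) : Prop where
  smooth : ∀ I, SmoothFam D (g.comp I)
  posDef : ∀ k, ∀ z ∈ D.dom k, (gram (g k z.2) z.1).PosDef

/-- The inverse metrics are uniformly bounded on the cores. -/
def InvBdd (g : TensorFam ι n 2) : Prop :=
  ∀ i j, BddFam D 0 (fun k z => invMetric (g k z.2) z.1 i j)

variable {D} {w : Fam ι n}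

theorem pd_eqOn_dirDeriv {F : ι → ℝ → EuclideanSpace ℝ (Fin n) → ℝ}
    (hF : SmoothFam D (fun k z => F k z.2 z.1)) (a : Fin n) (k : ι) :
    EqOn ((fun k z => pd a (F k z.2) z.1 : Fam ι n) k)
      (dirDeriv (spaceDir a) (fun k z => F k z.2 z.1) k) (D.dom k) := by
  intro z hz
  have h1 : HasFDerivAt (fun z : EuclideanSpace ℝ (Fin n) × ℝ => F k z.2 z.1)
      (fderiv ℝ (fun z : EuclideanSpace ℝ (Fin n) × ℝ => F k z.2 z.1) z) (z.1, z.2) :=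
    (hF.differentiableAt hz).hasFDerivAt
  have h2 : HasFDerivAt (fun y : EuclideanSpace ℝ (Fin n) => (y, z.2))
      (ContinuousLinearMap.inl ℝ (EuclideanSpace ℝ (Fin n)) ℝ) z.1 := hasFDerivAt_prodMk_left _ _
  have h3 := (h1.comp z.1 h2).fderiv
  have h4 : ((fun z : EuclideanSpace ℝ (Fin n) × ℝ => F k z.2 z.1) ∘ fun y => (y, z.2))
      = F k z.2 := rfl
  rw [h4] at h3
  simp only [pd, dirDeriv, h3]
  rfl

theorem hasDerivAt_slice {f : Fam ι n} (hf : SmoothFam D f) {k : ι}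
    {z : EuclideanSpace ℝ (Fin n) × ℝ} (hz : z ∈ D.dom k) :
    HasDerivAt (fun s => f k (z.1, s)) (dirDeriv (timeDir n) f k z) z.2 := by
  have h1 : HasFDerivAt (f k) (fderiv ℝ (f k) z) (z.1, z.2) :=
    (hf.differentiableAt hz).hasFDerivAt
  have h2 : HasFDerivAt (fun s : ℝ => (z.1, s))
      (ContinuousLinearMap.inr ℝ (EuclideanSpace ℝ (Fin n)) ℝ) z.2 := hasFDerivAt_prodMk_right _ _
  have h3 := (h1.comp z.2 h2).hasDerivAt
  exact h3

theorem JetBdd.pd {p : ℕ} {F : ι → ℝ → EuclideanSpace ℝ (Fin n) → ℝ}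
    (hF : JetBdd D w (p + 1) (fun k z => F k z.2 z.1)) (a : Fin n) :
    JetBdd D w p (fun k z => pd a (F k z.2) z.1) :=
  (hF.2.2 a).congr (pd_eqOn_dirDeriv hF.1 a)

theorem TimeJetBdd.pd {q : ℕ} {F : ι → ℝ → EuclideanSpace ℝ (Fin n) → ℝ}
    (hF : TimeJetBdd D q (fun k z => F k z.2 z.1)) (a : Fin n) :
    TimeJetBdd D q (fun k z => pd a (F k z.2) z.1) :=
  (hF.dirDeriv a).congr (pd_eqOn_dirDeriv hF.smooth a)

theorem IsMetricFam.det_ne_zero {g : TensorFam ι n 2} (hg : IsMetricFam D g) (k : ι)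
    (z : EuclideanSpace ℝ (Fin n) × ℝ) (hz : z ∈ D.dom k) :
    (Matrix.of fun a b => g.comp ![a, b] k z).det ≠ 0 := (hg.posDef k z hz).det_pos.ne'

/-! ### Tensor operations and mixed derivatives -/

section TimeJets

variable {q : ℕ} {g : TensorFam ι n 2} {H : TensorFam ι n 3}

theorem TimeJetBdd.invMetric (hg : IsMetricFam D g) (hi : InvBdd D g)
    (hgq : ∀ I, TimeJetBdd D q (g.comp I)) (i j : Fin n) :
    TimeJetBdd D q (fun k z => invMetric (g k z.2) z.1 i j) :=
  TimeJetBdd.invFam (fun a b => hgq ![a, b]) hg.det_ne_zero hi i j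

theorem TimeJetBdd.christoffel (hg : IsMetricFam D g) (hi : InvBdd D g)
    (hgq : ∀ I, TimeJetBdd D q (g.comp I)) (c a b : Fin n) :
    TimeJetBdd D q (fun k z => christoffel (g k z.2) z.1 c a b) := by
  unfold GRF.christoffel
  refine TimeJetBdd.const_mul (TimeJetBdd.sum fun d _ => ?_) _
  have hpd : ∀ a I, TimeJetBdd D q (fun k z => GRF.pd a (fun y => g k z.2 y I) z.1) :=
    fun a I => TimeJetBdd.pd (F := fun k t y => g k t y I) (hgq I) a
  exact (TimeJetBdd.invMetric hg hi hgq c d).mul (((hpd _ _).add (hpd _ _)).sub (hpd _ _))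

theorem TimeJetBdd.covDeriv (hg : IsMetricFam D g) (hi : InvBdd D g)
    (hgq : ∀ I, TimeJetBdd D q (g.comp I)) {T : TensorFam ι n r}
    (hT : ∀ I, TimeJetBdd D q (T.comp I)) (I : Fin (r + 1) → Fin n) :
    TimeJetBdd D q (TensorFam.comp (fun k t => covDeriv (g k t) (T k t)) I) := by
  refine TimeJetBdd.sub (TimeJetBdd.pd (F := fun k t y => T k t y (Fin.tail I)) (hT _) _)
    (TimeJetBdd.sum fun s _ => TimeJetBdd.sum fun c _ => ?_)
  exact (TimeJetBdd.christoffel hg hi hgq _ _ _).mul (hT _)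

theorem TimeJetBdd.iterCovDeriv (hg : IsMetricFam D g) (hi : InvBdd D g)
    (hgq : ∀ I, TimeJetBdd D q (g.comp I)) {T : TensorFam ι n r}
    (hT : ∀ I, TimeJetBdd D q (T.comp I)) (p : ℕ) (I : Fin (r + p) → Fin n) :
    TimeJetBdd D q (TensorFam.comp (fun k t => iterCovDeriv (g k t) (T k t) p) I) := by
  induction p with
  | zero => exact hT I
  | succ p ih => exact TimeJetBdd.covDeriv hg hi hgq ih I

theorem TimeJetBdd.riemann (hg : IsMetricFam D g) (hi : InvBdd D g)
    (hgq : ∀ I, TimeJetBdd D q (g.comp I)) (I : Fin 4 → Fin n) :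
    TimeJetBdd D q (TensorFam.comp (fun k t => riemann (g k t)) I) := by
  have hΓ := TimeJetBdd.christoffel hg hi hgq
  have hpd : ∀ a c d e, TimeJetBdd D q
      (fun k z => GRF.pd a (fun y => GRF.christoffel (g k z.2) y c d e) z.1) :=
    fun a c d e => TimeJetBdd.pd (F := fun k t y => GRF.christoffel (g k t) y c d e) (hΓ c d e) a
  unfold TensorFam.comp GRF.riemann riemannOp
  refine TimeJetBdd.sum fun m _ => TimeJetBdd.mul (hgq _) ?_
  exact ((hpd _ _ _ _).sub (hpd _ _ _ _)).add (TimeJetBdd.sum fun p _ =>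
    ((hΓ _ _ _).mul (hΓ _ _ _)).sub ((hΓ _ _ _).mul (hΓ _ _ _)))

theorem TimeJetBdd.ricci (hg : IsMetricFam D g) (hi : InvBdd D g)
    (hgq : ∀ I, TimeJetBdd D q (g.comp I)) (I : Fin 2 → Fin n) :
    TimeJetBdd D q (TensorFam.comp (fun k t => ricci (g k t)) I) := by
  unfold TensorFam.comp GRF.ricci
  exact TimeJetBdd.sum fun _ _ => TimeJetBdd.sum fun _ _ =>
    (TimeJetBdd.invMetric hg hi hgq _ _).mul (TimeJetBdd.riemann hg hi hgq _)

theorem TimeJetBdd.hTensor (hg : IsMetricFam D g) (hi : InvBdd D g)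
    (hgq : ∀ I, TimeJetBdd D q (g.comp I)) (hH : ∀ I, TimeJetBdd D q (H.comp I))
    (I : Fin 2 → Fin n) :
    TimeJetBdd D q (TensorFam.comp (fun k t => hTensor (g k t) (H k t)) I) := by
  unfold TensorFam.comp GRF.hTensor
  exact TimeJetBdd.sum fun _ _ => TimeJetBdd.sum fun _ _ => TimeJetBdd.sum fun _ _ =>
    TimeJetBdd.sum fun _ _ => (((TimeJetBdd.invMetric hg hi hgq _ _).mul
      (TimeJetBdd.invMetric hg hi hgq _ _)).mul (hH _)).mul (hH _)

theorem TimeJetBdd.extD {α : TensorFam ι n r} (hα : ∀ I, TimeJetBdd D q (α.comp I))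
    (I : Fin (r + 1) → Fin n) :
    TimeJetBdd D q (TensorFam.comp (fun k t => extD (α k t)) I) := by
  unfold TensorFam.comp GRF.extD
  exact TimeJetBdd.sum fun _ _ => TimeJetBdd.const_mul
    (TimeJetBdd.pd (F := fun k t y => α k t y _) (hα _) _) _

theorem TimeJetBdd.codiff (hg : IsMetricFam D g) (hi : InvBdd D g)
    (hgq : ∀ I, TimeJetBdd D q (g.comp I)) {α : TensorFam ι n (r + 1)}
    (hα : ∀ I, TimeJetBdd D q (α.comp I)) (I : Fin r → Fin n) :
    TimeJetBdd D q (TensorFam.comp (fun k t => codiff (g k t) (α k t)) I) :=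
  TimeJetBdd.neg (TimeJetBdd.sum fun _ _ => TimeJetBdd.sum fun _ _ =>
    (TimeJetBdd.invMetric hg hi hgq _ _).mul (TimeJetBdd.covDeriv hg hi hgq hα _))

theorem TimeJetBdd.laplaceBeltrami (hg : IsMetricFam D g) (hi : InvBdd D g)
    (hgq : ∀ I, TimeJetBdd D q (g.comp I)) {α : TensorFam ι n (r + 1)}
    (hα : ∀ I, TimeJetBdd D q (α.comp I)) (I : Fin (r + 1) → Fin n) :
    TimeJetBdd D q (TensorFam.comp (fun k t => laplaceBeltrami (g k t) (α k t)) I) :=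
  TimeJetBdd.neg ((TimeJetBdd.extD (TimeJetBdd.codiff hg hi hgq hα) _).add
    (TimeJetBdd.codiff hg hi hgq (TimeJetBdd.extD hα) _))

/-- The time derivatives of a slice. -/
theorem TimeJetBdd.abs_iteratedDeriv_le {f : Fam ι n} (hf : TimeJetBdd D q f) :
    ∃ c : ℝ, ∀ k, ∀ z ∈ D.core k, |iteratedDeriv q (fun s => f k (z.1, s)) z.2| ≤ c := by
  induction q generalizing f with
  | zero =>
    obtain ⟨c, -, hb⟩ := hf.bdd
    exact ⟨c, fun k z hz => by simpa using hb k z hz⟩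
  | succ q ih =>
    obtain ⟨c, hb⟩ := ih hf.2
    refine ⟨c, fun k z hz => ?_⟩
    rw [iteratedDeriv_succ']
    have h1 : (deriv fun s => f k (z.1, s)) =ᶠ[nhds z.2]
        fun s => GRF.dirDeriv (timeDir n) f k (z.1, s) := by
      have h2 : ∀ᶠ s in nhds z.2, (z.1, s) ∈ D.dom k :=
        (Continuous.prodMk_right z.1).continuousAt.eventually_mem
          ((D.isOpen k).mem_nhds (D.subset k hz))
      filter_upwards [h2] with s hs
      exact (hasDerivAt_slice hf.smooth hs).deriv
    rw [h1.iteratedDeriv_eq]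
    exact hb k z hz

theorem contDiffAt_slice {f : Fam ι n} (hf : SmoothFam D f) {k : ι}
    {z : EuclideanSpace ℝ (Fin n) × ℝ} (hz : z ∈ D.dom k) (m : ℕ) :
    ContDiffAt ℝ m (fun s => f k (z.1, s)) z.2 := by
  have h1 : ContDiffAt ℝ m (f k) (z.1, z.2) :=
    ((hf k).contDiffAt ((D.isOpen k).mem_nhds hz)).of_le (by exact_mod_cast le_top)
  exact h1.comp z.2 (contDiffAt_const.prodMk contDiffAt_id)

end TimeJets

/-! ### Smoothness as the case of empty cores -/

section Smoothness

/-- The same domains with nothing to be estimated. -/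
def FamDomain.withoutCore (D : FamDomain ι n) : FamDomain ι n where
  dom := D.dom
  core _ := ∅
  isOpen := D.isOpen
  subset _ := empty_subset _

/-- Over empty cores every bound is vacuous, so the closure properties of `TimeJetBdd` double as
proofs that covariant derivatives and curvature are smooth. -/
theorem SmoothFam.timeJetBdd {f : Fam ι n} (hf : SmoothFam D f) (q : ℕ) :
    TimeJetBdd D.withoutCore q f := by
  have hb : ∀ w f, BddFam D.withoutCore w f := fun _ _ => ⟨0, le_rfl, fun _ _ hz => hz.elim⟩
  have hj : ∀ p, ∀ f, SmoothFam D f → JetBdd D.withoutCore 0 p f := by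
    intro p
    induction p with
    | zero => exact fun f hf => ⟨hf, hb _ _⟩
    | succ p ih => exact fun f hf => ⟨hf, hb _ _, fun a => ih _ (hf.dirDeriv _)⟩
  induction q generalizing f with
  | zero => exact fun p => hj p f hf
  | succ q ih => exact ⟨fun p => hj p f hf, ih (hf.dirDeriv _)⟩

theorem IsMetricFam.withoutCore {g : TensorFam ι n 2} (hg : IsMetricFam D g) :
    IsMetricFam D.withoutCore g := ⟨hg.smooth, hg.posDef⟩

theorem IsMetricFam.invBdd_withoutCore (D : FamDomain ι n) (g : TensorFam ι n 2) :
    InvBdd D.withoutCore g := fun _ _ => ⟨0, le_rfl, fun _ _ hz => hz.elim⟩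

theorem SmoothFam.iterCovDeriv {g : TensorFam ι n 2} (hg : IsMetricFam D g) {T : TensorFam ι n r}
    (hT : ∀ I, SmoothFam D (T.comp I)) (p : ℕ) (I : Fin (r + p) → Fin n) :
    SmoothFam D (TensorFam.comp (fun k t => iterCovDeriv (g k t) (T k t) p) I) :=
  (TimeJetBdd.iterCovDeriv (q := 0) hg.withoutCore (IsMetricFam.invBdd_withoutCore D g)
    (fun I => (hg.smooth I).timeJetBdd 0) (fun I => (hT I).timeJetBdd 0) p I).smooth

theorem SmoothFam.riemann {g : TensorFam ι n 2} (hg : IsMetricFam D g) (I : Fin 4 → Fin n) :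
    SmoothFam D (TensorFam.comp (fun k t => riemann (g k t)) I) :=
  (TimeJetBdd.riemann (q := 0) hg.withoutCore (IsMetricFam.invBdd_withoutCore D g)
    (fun I => (hg.smooth I).timeJetBdd 0) I).smooth

end Smoothness

/-! ### Tensor operations and weighted spatial jets -/

section SpaceJets

variable {p : ℕ} {g : TensorFam ι n 2} {H : TensorFam ι n 3}

theorem JetBdd.mul_succ (hw : ∀ k z, 0 ≤ w k z) {f h : Fam ι n} (hf : JetBdd D w (p + 1) f)
    (hh : JetBdd D w (p + 1) h) : JetBdd D w (p + 1) (fun k z => f k z * h k z) :=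
  hf.mul hw hh hh.bdd

theorem JetBdd.invMetric (hw : ∀ k z, 0 ≤ w k z) (hg : IsMetricFam D g) (hi : InvBdd D g)
    (hgp : ∀ I, JetBdd D w p (g.comp I)) (i j : Fin n) :
    JetBdd D w p (fun k z => invMetric (g k z.2) z.1 i j) :=
  JetBdd.invFam hw (fun a b => hgp ![a, b]) hg.det_ne_zero hi i j

theorem JetBdd.christoffel (hw : ∀ k z, 0 ≤ w k z) (hg : IsMetricFam D g) (hi : InvBdd D g)
    (hgp : ∀ I, JetBdd D w (p + 1) (g.comp I)) (c a b : Fin n) :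
    JetBdd D w p (fun k z => christoffel (g k z.2) z.1 c a b) := by
  unfold GRF.christoffel
  refine JetBdd.const_mul hw (JetBdd.sum hw fun d _ => ?_) _
  have hpd : ∀ a I, JetBdd D w p (fun k z => GRF.pd a (fun y => g k z.2 y I) z.1) :=
    fun a I => JetBdd.pd (F := fun k t y => g k t y I) (hgp I) a
  -- The order of the factors matters: for p = 0 the first derivatives of the metric may be of size
  -- 1 + w, whereas the inverse metric is bounded.
  have := (((hpd a ![b, d]).add (hpd b ![a, d])).sub hw (hpd d ![a, b])).mul hw
    ((JetBdd.invMetric hw hg hi hgp c d).of_succ hw) (hi c d)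
  exact this.congr fun k z _ => mul_comm _ _

/-- Bounds on all covariant derivatives of `T` give bounds on its partial derivatives, with one
order more than is known of the Christoffel symbols. -/
theorem JetBdd.of_iterCovDeriv (hw : ∀ k z, 0 ≤ w k z) (hg : IsMetricFam D g)
    (hΓ : ∀ c a b, JetBdd D w p (fun k z => GRF.christoffel (g k z.2) z.1 c a b))
    {T : TensorFam ι n r} (hT : ∀ I, SmoothFam D (T.comp I))
    (hb : ∀ j I, BddFam D 0 (TensorFam.comp (fun k t => iterCovDeriv (g k t) (T k t) j) I))
    (j : ℕ) (I : Fin (r + j) → Fin n) :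
    JetBdd D w (p + 1) (TensorFam.comp (fun k t => iterCovDeriv (g k t) (T k t) j) I) := by
  have hs := SmoothFam.iterCovDeriv hg hT
  -- Induction on the number m of partial derivatives, for all j at once: ∂∇ʲT = ∇ʲ⁺¹T + Γ∗∇ʲT, so
  -- m+1 derivatives of ∇ʲT need only m of ∇ʲ⁺¹T, ∇ʲT and Γ. Here m ≤ p suffices for Γ, which is the
  -- gain of one order.
  have key : ∀ m, m ≤ p + 1 → ∀ j I,
      JetBdd D w m (TensorFam.comp (fun k t => GRF.iterCovDeriv (g k t) (T k t) j) I) := by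
    intro m
    induction m with
    | zero => exact fun _ j I => ⟨hs j I, (hb j I).of_zero hw⟩
    | succ m ih =>
      intro hm j I
      have ih' := ih (by omega)
      refine ⟨hs j I, hb j I, fun a => ?_⟩
      have h1 : JetBdd D w m (fun k z =>
          TensorFam.comp (fun k t => GRF.iterCovDeriv (g k t) (T k t) (j + 1))
            (Fin.cons a I : Fin (r + j + 1) → Fin n) k z
          + ∑ s : Fin (r + j), ∑ c : Fin n, GRF.christoffel (g k z.2) z.1 c a (I s)
            * TensorFam.comp (fun k t => GRF.iterCovDeriv (g k t) (T k t) j)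
              (Function.update I s c) k z) := by
        refine (ih' (j + 1) _).add (JetBdd.sum hw fun s _ => JetBdd.sum hw fun c _ => ?_)
        exact ((hΓ c a (I s)).mono hw (by omega)).mul hw (ih' j _) (hb j _)
      refine h1.congr fun k z hz => ?_
      refine (pd_eqOn_dirDeriv (F := fun k t y => GRF.iterCovDeriv (g k t) (T k t) j y I)
        (hs j I) a k hz).symm.trans ?_
      simp only [TensorFam.comp, GRF.iterCovDeriv, GRF.covDeriv, Fin.cons_zero, Fin.tail_cons]
      exact (sub_add_cancel _ _).symm
  exact key (p + 1) le_rfl j I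

theorem JetBdd.ricci (hw : ∀ k z, 0 ≤ w k z)
    (hi : ∀ i j, JetBdd D w (p + 1) (fun k z => GRF.invMetric (g k z.2) z.1 i j))
    (hR : ∀ I, JetBdd D w (p + 1) (TensorFam.comp (fun k t => GRF.riemann (g k t)) I))
    (I : Fin 2 → Fin n) :
    JetBdd D w (p + 1) (TensorFam.comp (fun k t => ricci (g k t)) I) := by
  unfold TensorFam.comp GRF.ricci
  exact JetBdd.sum hw fun _ _ => JetBdd.sum hw fun _ _ => (hi _ _).mul_succ hw (hR _)

theorem JetBdd.hTensor (hw : ∀ k z, 0 ≤ w k z)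
    (hi : ∀ i j, JetBdd D w (p + 1) (fun k z => GRF.invMetric (g k z.2) z.1 i j))
    (hH : ∀ I, JetBdd D w (p + 1) (H.comp I)) (I : Fin 2 → Fin n) :
    JetBdd D w (p + 1) (TensorFam.comp (fun k t => hTensor (g k t) (H k t)) I) := by
  unfold TensorFam.comp GRF.hTensor
  exact JetBdd.sum hw fun _ _ => JetBdd.sum hw fun _ _ => JetBdd.sum hw fun _ _ =>
    JetBdd.sum hw fun _ _ => (((hi _ _).mul_succ hw (hi _ _)).mul_succ hw (hH _)).mul_succ hw (hH _)

end SpaceJets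

/-! ### Jets of time-independent functions -/

section Background

/-- Smooth functions of space alone have bounded jets on compact sets. -/
theorem timeJetBdd_of_compact {U L : Set (EuclideanSpace ℝ (Fin n))} (hU : IsOpen U)
    (hL : IsCompact L) (hLU : L ⊆ U) (hdom : ∀ k, ∀ z ∈ D.dom k, z.1 ∈ U)
    (hcore : ∀ k, ∀ z ∈ D.core k, z.1 ∈ L) {f : EuclideanSpace ℝ (Fin n) → ℝ}
    (hf : ContDiffOn ℝ ∞ f U) (q : ℕ) : TimeJetBdd D q (fun _ z => f z.1) := by
  have hs : ∀ f, ContDiffOn ℝ ∞ f U → SmoothFam D (fun _ z => f z.1) := fun f hf k =>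
    hf.comp contDiff_fst.contDiffOn (hdom k)
  have hj : ∀ p, ∀ f, ContDiffOn ℝ ∞ f U → JetBdd D 0 p (fun _ z => f z.1) := by
    intro p
    induction p with
    | zero =>
      intro f hf
      obtain ⟨c, hc⟩ := hL.exists_bound_of_continuousOn (hf.continuousOn.mono hLU)
      refine ⟨hs f hf, |c|, abs_nonneg c, fun k z hz => ?_⟩
      simpa using (hc z.1 (hcore k z hz)).trans (le_abs_self c)
    | succ p ih =>
      intro f hf
      obtain ⟨c, hc⟩ := hL.exists_bound_of_continuousOn (hf.continuousOn.mono hLU)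
      refine ⟨hs f hf, ⟨|c|, abs_nonneg c, fun k z hz => ?_⟩, fun a => ?_⟩
      · simpa using (hc z.1 (hcore k z hz)).trans (le_abs_self c)
      · exact (ih (pd a f) (contDiffOn_pd hU hf a)).congr fun k z hz =>
          (pd_eqOn_dirDeriv (F := fun _ _ => f) (hs f hf) a k hz).symm
  have hz : ∀ k, EqOn (dirDeriv (timeDir n) (fun (_ : ι) z => f z.1) k) (fun _ => 0)
      (D.dom k) := fun k z hz =>
    (hasDerivAt_slice (hs f hf) hz).unique (hasDerivAt_const z.2 (f z.1))
  cases q with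
  | zero => exact fun p => hj p f hf
  | succ q => exact ⟨fun p => hj p f hf, (TimeJetBdd.const q 0).congr hz⟩

end Background

end TensorFamilies

/-! ### Grönwall estimates -/

section Gronwall

/-- Times before t₀ are reached by applying the forward inequality to s ↦ u(-s). Monotonicity of the
Grönwall bound in the elapsed time replaces it by the full length ψ - β. -/
theorem norm_le_gronwallBound_two_sided {V : Type*} [NormedAddCommGroup V] [NormedSpace ℝ V]
    {u u' : ℝ → V} {β ψ t₀ δ K ε : ℝ} (ht₀ : t₀ ∈ Icc β ψ) (hδ : 0 ≤ δ) (hK : 0 ≤ K) (hε : 0 ≤ ε)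
    (hu : ∀ t ∈ Icc β ψ, HasDerivAt u (u' t) t) (h0 : ‖u t₀‖ ≤ δ)
    (hb : ∀ t ∈ Icc β ψ, ‖u' t‖ ≤ K * ‖u t‖ + ε) {t : ℝ} (ht : t ∈ Icc β ψ) :
    ‖u t‖ ≤ gronwallBound δ K ε (ψ - β) := by
  rcases le_total t₀ t with h | h
  · have h1 := norm_le_gronwallBound_of_norm_deriv_right_le (f := u) (f' := u') (δ := δ) (K := K)
      (ε := ε) (a := t₀) (b := t)
      (fun s hs => (hu s ⟨ht₀.1.trans hs.1, hs.2.trans ht.2⟩).continuousAt.continuousWithinAt)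
      (fun s hs => (hu s ⟨ht₀.1.trans hs.1, hs.2.le.trans ht.2⟩).hasDerivWithinAt) h0
      (fun s hs => hb s ⟨ht₀.1.trans hs.1, hs.2.le.trans ht.2⟩) t ⟨h, le_rfl⟩
    exact h1.trans (gronwallBound_mono hδ hε hK (by linarith [ht₀.1, ht.2]))
  · have hv : ∀ s ∈ Icc (-t₀) (-t), HasDerivAt (fun s => u (-s)) (-u' (-s)) s := by
      intro s hs
      have h2 := (hu (-s) ⟨by linarith [ht.1, hs.2], by linarith [ht₀.2, hs.1]⟩).scomp s
        (hasDerivAt_neg s)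
      have h3 : HasDerivAt (fun s => u (-s)) ((-1 : ℝ) • u' (-s)) s := h2
      simpa using h3
    have h1 := norm_le_gronwallBound_of_norm_deriv_right_le (f := fun s => u (-s))
      (f' := fun s => -u' (-s)) (δ := δ) (K := K) (ε := ε) (a := -t₀) (b := -t)
      (fun s hs => (hv s hs).continuousAt.continuousWithinAt)
      (fun s hs => (hv s ⟨hs.1, hs.2.le⟩).hasDerivWithinAt) (by simpa using h0)
      (fun s hs => by
        rw [norm_neg]
        exact hb (-s) ⟨by linarith [ht.1, hs.2], by linarith [ht₀.2, hs.1]⟩)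
      (-t) ⟨by linarith, le_rfl⟩
    rw [neg_neg] at h1
    exact h1.trans (gronwallBound_mono hδ hε hK (by linarith [ht₀.2, ht.1]))

/-- A function with logarithmic derivative bounded by `C` grows and decays at most like
`exp (C |t - t₀|)`. -/
theorem exp_bounds_of_abs_deriv_le {u u' : ℝ → ℝ} {β ψ t₀ C : ℝ} (ht₀ : t₀ ∈ Icc β ψ)
    (hu : ∀ t ∈ Icc β ψ, HasDerivAt u (u' t) t) (hb : ∀ t ∈ Icc β ψ, |u' t| ≤ C * u t)
    {t : ℝ} (ht : t ∈ Icc β ψ) :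
    Real.exp (-(C * |t - t₀|)) * u t₀ ≤ u t ∧ u t ≤ Real.exp (C * |t - t₀|) * u t₀ := by
  have hd : ∀ c : ℝ, ∀ s ∈ Icc β ψ, HasDerivAt (fun s => Real.exp (c * s) * u s)
      (Real.exp (c * s) * (c * u s + u' s)) s := by
    intro c s hs
    have h1 : HasDerivAt (fun s => Real.exp (c * s)) (Real.exp (c * s) * c) s := by
      simpa using ((hasDerivAt_id s).const_mul c).exp
    refine (h1.mul (hu s hs)).congr_deriv (by ring)
  -- The bound |u'| ≤ Cu makes e^{Cs}u increasing and e^{-Cs}u decreasing. Each handles one side of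
  -- the estimate on each side of t₀, without a logarithm or a division by u.
  have hmono : MonotoneOn (fun s => Real.exp (C * s) * u s) (Icc β ψ) := by
    refine monotoneOn_of_hasDerivWithinAt_nonneg (convex_Icc _ _)
      (fun s hs => (hd C s hs).continuousAt.continuousWithinAt)
      (fun s hs => (hd C s (interior_subset hs)).hasDerivWithinAt) fun s hs => ?_
    have := abs_le.1 (hb s (interior_subset hs))
    exact mul_nonneg (Real.exp_pos _).le (by linarith)
  have hanti : AntitoneOn (fun s => Real.exp (-C * s) * u s) (Icc β ψ) := by
    refine antitoneOn_of_hasDerivWithinAt_nonpos (convex_Icc _ _)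
      (fun s hs => (hd (-C) s hs).continuousAt.continuousWithinAt)
      (fun s hs => (hd (-C) s (interior_subset hs)).hasDerivWithinAt) fun s hs => ?_
    have := abs_le.1 (hb s (interior_subset hs))
    exact mul_nonpos_of_nonneg_of_nonpos (Real.exp_pos _).le (by linarith)
  have key : ∀ a b x y : ℝ, Real.exp a * x ≤ Real.exp b * y → Real.exp (a - b) * x ≤ y := by
    intro a b x y h
    rw [Real.exp_sub, div_mul_eq_mul_div, div_le_iff₀ (Real.exp_pos b)]
    linarith
  have key' : ∀ a b x y : ℝ, Real.exp a * x ≤ Real.exp b * y → x ≤ Real.exp (b - a) * y := by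
    intro a b x y h
    rw [Real.exp_sub, div_mul_eq_mul_div, le_div_iff₀ (Real.exp_pos a)]
    linarith
  rcases le_total t₀ t with h | h
  · rw [abs_of_nonneg (sub_nonneg.2 h)]
    constructor
    · convert key _ _ _ _ (hmono ht₀ ht h) using 3; ring
    · convert key' _ _ _ _ (hanti ht₀ ht h) using 3; ring
  · rw [abs_of_nonpos (sub_nonpos.2 h)]
    constructor
    · convert key _ _ _ _ (hanti ht ht₀ h) using 3; ring
    · convert key' _ _ _ _ (hmono ht ht₀ h) using 3; ring

end Gronwall

/-! ### Iterated spatial derivatives indexed by lists -/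

section IteratedDerivatives

variable {n : ℕ} {ι : Type*} {D : FamDomain ι n} {w : Fam ι n}

/-- Iterated spatial derivatives. -/
noncomputable def multiDeriv : List (Fin n) → Fam ι n → Fam ι n
  | [], f => f
  | a :: l, f => multiDeriv l (dirDeriv (spaceDir a) f)

theorem SmoothFam.multiDeriv {f : Fam ι n} (hf : SmoothFam D f) (l : List (Fin n)) :
    SmoothFam D (multiDeriv l f) := by
  induction l generalizing f with
  | nil => exact hf
  | cons a l ih => exact ih (hf.dirDeriv _)

theorem multiDeriv_congr {f g : Fam ι n} (h : ∀ k, EqOn (g k) (f k) (D.dom k)) (l : List (Fin n))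
    (k : ι) : EqOn (multiDeriv l g k) (multiDeriv l f k) (D.dom k) := by
  induction l generalizing f g k with
  | nil => exact h k
  | cons a l ih => exact ih (fun k => dirDeriv_congr h _ k) k

theorem dirDeriv_multiDeriv {f : Fam ι n} (hf : SmoothFam D f)
    (v : EuclideanSpace ℝ (Fin n) × ℝ) (l : List (Fin n)) (k : ι) :
    EqOn (dirDeriv v (multiDeriv l f) k) (multiDeriv l (dirDeriv v f) k) (D.dom k) := by
  induction l generalizing f with
  | nil => exact fun _ _ => rfl
  | cons a l ih =>
    exact (ih (hf.dirDeriv _)).trans (multiDeriv_congr (fun k => dirDeriv_comm hf _ _ k) l k)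

theorem JetBdd.bdd_multiDeriv {p : ℕ} {f : Fam ι n} (hf : JetBdd D w p f) {l : List (Fin n)}
    (hl : l.length = p) : BddFam D w (multiDeriv l f) := by
  induction p generalizing f l with
  | zero =>
    rw [List.length_eq_zero_iff] at hl
    subst hl
    exact hf.2
  | succ p ih =>
    obtain ⟨a, l, rfl⟩ := List.exists_cons_of_length_eq_add_one hl
    exact ih (hf.2.2 a) (by simpa using hl)

/-- Serves both ends of the Grönwall step: with a weight dominating the top derivatives by
construction, and with weight 0 once these are known to be bounded. -/
theorem JetBdd.succ_of_multiDeriv {p : ℕ} {f : Fam ι n} (hf : JetBdd D 0 p f)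
    (h : ∀ l : List (Fin n), l.length = p + 1 → BddFam D w (multiDeriv l f)) :
    JetBdd D w (p + 1) f := by
  induction p generalizing f with
  | zero => exact ⟨hf.1, hf.2, fun a => ⟨hf.1.dirDeriv _, h [a] rfl⟩⟩
  | succ p ih =>
    exact ⟨hf.1, hf.2.1, fun a => ih (hf.2.2 a) fun l hl => h (a :: l) (by simp [hl])⟩

end IteratedDerivatives

/-! ### The estimates in a coordinate chart -/

section Local

variable {n : ℕ} {ι : Type*} {D : FamDomain ι n}

/-- The part of the cores at time `t₀`. -/
def FamDomain.atTime (D : FamDomain ι n) (t₀ : ℝ) : FamDomain ι n where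
  dom := D.dom
  core k := {z ∈ D.core k | z.2 = t₀}
  isOpen := D.isOpen
  subset k := fun _ hz => D.subset k hz.1

theorem exists_uniform_bdd {α : Type*} [Finite α] {w : Fam ι n} {f : α → Fam ι n}
    (h : ∀ i, BddFam D w (f i)) (hw : ∀ k z, 0 ≤ w k z) :
    ∃ c : ℝ, 0 ≤ c ∧ ∀ i k, ∀ z ∈ D.core k, |f i k z| ≤ c * (1 + w k z) := by
  cases nonempty_fintype α
  choose c hc hb using h
  refine ⟨∑ i, c i, Finset.sum_nonneg fun i _ => hc i, fun i k z hz => (hb i k z hz).trans ?_⟩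
  exact mul_le_mul_of_nonneg_right (Finset.single_le_sum (fun i _ => hc i) (Finset.mem_univ i))
    (by linarith [hw k z])

/-- A family of solutions in coordinates, together with uniform intrinsic bounds. -/
structure LocalSolution (D : FamDomain ι n) (S : Set (EuclideanSpace ℝ (Fin n))) (β ψ : ℝ)
    (g : TensorFam ι n 2) (H : TensorFam ι n 3) : Prop where
  core_eq : ∀ k, D.core k = S ×ˢ Icc β ψ
  metric : IsMetricFam D g
  smooth_form : ∀ I, SmoothFam D (H.comp I)
  evol_metric : ∀ k, ∀ z ∈ D.dom k, ∀ I, HasDerivAt (fun s => g k s z.1 I)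
    (-2 * ricci (g k z.2) z.1 I + (1 / 2) * hTensor (g k z.2) (H k z.2) z.1 I) z.2
  evol_form : ∀ k, ∀ z ∈ D.dom k, ∀ I, HasDerivAt (fun s => H k s z.1 I)
    (laplaceBeltrami (g k z.2) (H k z.2) z.1 I) z.2
  metric_bdd : ∀ I, BddFam D 0 (g.comp I)
  inv_bdd : InvBdd D g
  curvature_bdd : ∀ j I,
    BddFam D 0 (TensorFam.comp (fun k t => iterCovDeriv (g k t) (riemann (g k t)) j) I)
  form_bdd : ∀ j I, BddFam D 0 (TensorFam.comp (fun k t => iterCovDeriv (g k t) (H k t) j) I)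

variable {S : Set (EuclideanSpace ℝ (Fin n))} {β ψ t₀ : ℝ} {g : TensorFam ι n 2}
  {H : TensorFam ι n 3}

theorem LocalSolution.timeDeriv_metric (h : LocalSolution D S β ψ g H) (I : Fin 2 → Fin n) (k : ι) :
    EqOn (dirDeriv (timeDir n) (g.comp I) k) ((fun k z =>
      (-2) * TensorFam.comp (fun k t => ricci (g k t)) I k z
      + (1 / 2) * TensorFam.comp (fun k t => hTensor (g k t) (H k t)) I k z : Fam ι n) k)
      (D.dom k) := fun z hz =>
  (hasDerivAt_slice (h.metric.smooth I) hz).unique (h.evol_metric k z hz I)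

theorem LocalSolution.timeDeriv_form (h : LocalSolution D S β ψ g H) (I : Fin 3 → Fin n) (k : ι) :
    EqOn (dirDeriv (timeDir n) (H.comp I) k)
      (TensorFam.comp (fun k t => laplaceBeltrami (g k t) (H k t)) I k) (D.dom k) := fun z hz =>
  (hasDerivAt_slice (h.smooth_form I) hz).unique (h.evol_form k z hz I)

/-- All intrinsic derivatives of H are bounded and converting them uses Γ only to order p, that is,
the metric to order p+1. -/
theorem LocalSolution.jetBdd_form {w : Fam ι n} (hw : ∀ k z, 0 ≤ w k z)
    (h : LocalSolution D S β ψ g H) {p : ℕ} (hg : ∀ I, JetBdd D w (p + 1) (g.comp I))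
    (I : Fin 3 → Fin n) : JetBdd D w (p + 1) (H.comp I) :=
  JetBdd.of_iterCovDeriv hw h.metric (JetBdd.christoffel hw h.metric h.inv_bdd hg)
    h.smooth_form h.form_bdd 0 I

/-- The point where no derivative is lost: Ric is treated as a contraction of Rm, whose intrinsic
derivatives are bounded, rather than as a second-order expression in the metric. -/
theorem LocalSolution.jetBdd_timeDeriv {w : Fam ι n} (hw : ∀ k z, 0 ≤ w k z)
    (h : LocalSolution D S β ψ g H) {p : ℕ} (hg : ∀ I, JetBdd D w (p + 1) (g.comp I))
    (I : Fin 2 → Fin n) : JetBdd D w (p + 1) (dirDeriv (timeDir n) (g.comp I)) := by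
  have hi := JetBdd.invMetric hw h.metric h.inv_bdd hg
  have hR : ∀ I, JetBdd D w (p + 1) (TensorFam.comp (fun k t => riemann (g k t)) I) :=
    JetBdd.of_iterCovDeriv (T := fun k t => riemann (g k t)) hw h.metric
      (JetBdd.christoffel hw h.metric h.inv_bdd hg)
      (SmoothFam.riemann h.metric) h.curvature_bdd 0
  have hH := h.jetBdd_form hw hg
  exact (((JetBdd.ricci hw hi hR I).const_mul hw (-2)).add
    ((JetBdd.hTensor hw hi hH I).const_mul hw (1 / 2))).congr (h.timeDeriv_metric I)

/-- The inductive step for the spatial derivatives of the metrics. -/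
theorem LocalSolution.jetBdd_succ (h : LocalSolution D S β ψ g H) (ht₀ : t₀ ∈ Icc β ψ) {p : ℕ}
    (hinit : ∀ I, JetBdd (D.atTime t₀) 0 (p + 1) (g.comp I))
    (hg : ∀ I, JetBdd D 0 p (g.comp I)) (I : Fin 2 → Fin n) : JetBdd D 0 (p + 1) (g.comp I) := by
  -- All derivatives of order p+1 of all components form one finite system, with the weight `w`
  -- equal to its ℓ¹ size. The top-order estimate in `hgw` then holds with constant 1 by
  -- construction.
  let A := List.Vector (Fin n) (p + 1) × (Fin 2 → Fin n)
  let f : A → Fam ι n := fun i => multiDeriv i.1.toList (g.comp i.2)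
  let w : Fam ι n := fun k z => ∑ i, |f i k z|
  have hw : ∀ k z, 0 ≤ w k z := fun k z => Finset.sum_nonneg fun i _ => abs_nonneg _
  have hfs : ∀ i, SmoothFam D (f i) := fun i => (h.metric.smooth i.2).multiDeriv _
  have hgw : ∀ I, JetBdd D w (p + 1) (g.comp I) := fun I =>
    (hg I).succ_of_multiDeriv fun l hl => ⟨1, zero_le_one, fun k z _ => by
      have : |multiDeriv l (g.comp I) k z| ≤ w k z :=
        Finset.single_le_sum (f := fun i => |f i k z|) (fun i _ => abs_nonneg _)
          (Finset.mem_univ (⟨⟨l, hl⟩, I⟩ : A))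
      linarith⟩
  -- Time and space derivatives commute, so the flow equation bounds the time derivative of the
  -- system by a multiple of 1 + w.
  have hf' : ∀ i, BddFam D w (dirDeriv (timeDir n) (f i)) := fun i =>
    ((h.jetBdd_timeDeriv hw hgw i.2).bdd_multiDeriv i.1.toList_length).congr fun k =>
      dirDeriv_multiDeriv (h.metric.smooth i.2) _ _ k
  obtain ⟨c, hc, hb⟩ := exists_uniform_bdd hf' hw
  have hf0 : ∀ i, BddFam (D.atTime t₀) 0 (f i) := fun i =>
    (hinit i.2).bdd_multiDeriv i.1.toList_length
  obtain ⟨δ, hδ, hb0⟩ := exists_uniform_bdd hf0 zero_weight_nonneg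
  have hbound : ∀ i k, ∀ z ∈ D.core k,
      |f i k z| ≤ gronwallBound δ (c * Fintype.card A) c (ψ - β) := by
    intro i k z hz
    have hz' := hz
    rw [h.core_eq] at hz'
    have hmem : ∀ t ∈ Icc β ψ, (z.1, t) ∈ D.core k := fun t ht => by
      rw [h.core_eq]; exact ⟨hz'.1, ht⟩
    let u : ℝ → A → ℝ := fun t i => f i k (z.1, t)
    -- The norm of `u` is the sup norm; comparing it with the ℓ¹ weight accounts for the cardinality
    -- in the Grönwall constant.
    have hwu : ∀ t, w k (z.1, t) ≤ Fintype.card A * ‖u t‖ := by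
      intro t
      have : ∀ i ∈ Finset.univ, |f i k (z.1, t)| ≤ ‖u t‖ := fun i _ => norm_le_pi_norm (u t) i
      simpa using Finset.sum_le_card_nsmul _ _ _ this
    have hmain := norm_le_gronwallBound_two_sided (u := u)
      (u' := fun t i => dirDeriv (timeDir n) (f i) k (z.1, t)) (δ := δ)
      (K := c * Fintype.card A) (ε := c) ht₀ hδ (by positivity) hc
      (fun t ht => hasDerivAt_pi.2 fun i => hasDerivAt_slice (hfs i) (D.subset k (hmem t ht)))
      ((pi_norm_le_iff_of_nonneg hδ).2 fun i => by
        simpa using hb0 i k (z.1, t₀) ⟨hmem t₀ ht₀, rfl⟩)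
      (fun t ht => (pi_norm_le_iff_of_nonneg (by positivity)).2 fun i => by
        have h1 := hb i k (z.1, t) (hmem t ht)
        have h2 := mul_le_mul_of_nonneg_left (hwu t) hc
        rw [Real.norm_eq_abs]
        linarith) hz'.2
    exact (norm_le_pi_norm (u z.2) i).trans hmain
  refine (hg I).succ_of_multiDeriv fun l hl => ?_
  refine ⟨|gronwallBound δ (c * Fintype.card A) c (ψ - β)|, abs_nonneg _, fun k z hz => ?_⟩
  simp only [Pi.zero_apply, add_zero, mul_one]
  exact (hbound (⟨⟨l, hl⟩, I⟩ : A) k z hz).trans (le_abs_self _)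

/-- All derivatives of the solutions in space and time are uniformly bounded. -/
theorem LocalSolution.timeJetBdd (h : LocalSolution D S β ψ g H) (ht₀ : t₀ ∈ Icc β ψ)
    (hinit : ∀ p I, JetBdd (D.atTime t₀) 0 p (g.comp I)) (q : ℕ) :
    (∀ I, TimeJetBdd D q (g.comp I)) ∧ ∀ I, TimeJetBdd D q (H.comp I) := by
  have hg : ∀ p I, JetBdd D 0 p (g.comp I) := by
    intro p
    induction p with
    | zero => exact fun I => ⟨h.metric.smooth I, h.metric_bdd I⟩
    | succ p ih => exact h.jetBdd_succ ht₀ (hinit (p + 1)) ih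
  have hH : ∀ p I, JetBdd D 0 p (H.comp I) := fun p I =>
    (h.jetBdd_form zero_weight_nonneg (hg (p + 1)) I).of_succ zero_weight_nonneg
  -- The right-hand sides of the flow equations are built from spatial derivatives and inverse
  -- metrics, and these operations preserve control of q time derivatives. One more time derivative
  -- follows.
  induction q with
  | zero => exact ⟨fun I p => hg p I, fun I p => hH p I⟩
  | succ q ih =>
    refine ⟨fun I => ⟨fun p => hg p I, ?_⟩, fun I => ⟨fun p => hH p I, ?_⟩⟩
    · exact (((TimeJetBdd.ricci h.metric h.inv_bdd ih.1 I).const_mul (-2)).add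
        ((TimeJetBdd.hTensor h.metric h.inv_bdd ih.1 ih.2 I).const_mul (1 / 2))).congr
        (h.timeDeriv_metric I)
    · exact (TimeJetBdd.laplaceBeltrami h.metric h.inv_bdd ih.1 ih.2 I).congr
        (h.timeDeriv_form I)

end Local

/-! ### Chart domains -/

section ChartDomains

variable {n r : ℕ} {M : Type*} [TopologicalSpace M]
  {e : OpenPartialHomeomorph M (EuclideanSpace ℝ (Fin n))}

/-- The transition map between two charts. -/
def transition (e e' : OpenPartialHomeomorph M (EuclideanSpace ℝ (Fin n))) :
    EuclideanSpace ℝ (Fin n) → EuclideanSpace ℝ (Fin n) := fun y => e' (e.symm y)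

/-- The image under the chart `e` of an open set `O`. -/
def chartDom (e : OpenPartialHomeomorph M (EuclideanSpace ℝ (Fin n))) (O : Set M) :
    Set (EuclideanSpace ℝ (Fin n)) := e.target ∩ e.symm ⁻¹' O

theorem isOpen_chartDom (e : OpenPartialHomeomorph M (EuclideanSpace ℝ (Fin n))) {O : Set M}
    (hO : IsOpen O) : IsOpen (chartDom e O) := e.isOpen_inter_preimage_symm hO

theorem mapsTo_transition (e e' : OpenPartialHomeomorph M (EuclideanSpace ℝ (Fin n))) (O : Set M) :
    MapsTo (transition e e') (chartDom e (e'.source ∩ O)) (chartDom e' O) := fun y hy =>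
  ⟨e'.map_source hy.2.1, by
    simp only [transition, mem_preimage, e'.left_inv hy.2.1]; exact hy.2.2⟩

theorem transition_apply {e e' : OpenPartialHomeomorph M (EuclideanSpace ℝ (Fin n))} {x : M}
    (hx : x ∈ e.source) : transition e e' (e x) = e' x := by
  simp [transition, e.left_inv hx]

theorem mem_chartDom {e : OpenPartialHomeomorph M (EuclideanSpace ℝ (Fin n))} {O : Set M} {x : M}
    (hx : x ∈ e.source) (hO : x ∈ O) : e x ∈ chartDom e O :=
  ⟨e.map_source hx, by simpa [e.left_inv hx] using hO⟩

theorem chartDom_mono (e : OpenPartialHomeomorph M (EuclideanSpace ℝ (Fin n))) {O O' : Set M}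
    (h : O ⊆ O') : chartDom e O ⊆ chartDom e O' := fun _ hy => ⟨hy.1, h hy.2⟩

/-- The points of space-time, in the coordinates of the chart `e`, which belong to `W`. -/
def chartSpaceTime (e : OpenPartialHomeomorph M (EuclideanSpace ℝ (Fin n))) (W : Set (M × ℝ)) :
    Set (EuclideanSpace ℝ (Fin n) × ℝ) := {z | z.1 ∈ e.target ∧ (e.symm z.1, z.2) ∈ W}

/-- The slice of `W` at the time `t`. -/
def timeSlice (W : Set (M × ℝ)) (t : ℝ) : Set M := {x | (x, t) ∈ W}

theorem isOpen_timeSlice {W : Set (M × ℝ)} (hW : IsOpen W) (t : ℝ) : IsOpen (timeSlice W t) :=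
  hW.preimage (by fun_prop)

theorem isOpen_chartSpaceTime (e : OpenPartialHomeomorph M (EuclideanSpace ℝ (Fin n)))
    {W : Set (M × ℝ)} (hW : IsOpen W) : IsOpen (chartSpaceTime e W) := by
  have h : ContinuousOn (fun z : EuclideanSpace ℝ (Fin n) × ℝ => (e.symm z.1, z.2))
      (e.target ×ˢ univ) :=
    (e.continuousOn_symm.comp continuousOn_fst fun z hz => hz.1).prodMk continuousOn_snd
  have := h.isOpen_inter_preimage (e.open_target.prod isOpen_univ) hW
  convert this using 1
  ext z
  simp [chartSpaceTime]

theorem smoothTensorOn_timeSlice {W : Set (M × ℝ)} {T : ℝ → CoordTensor n r}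
    (hT : ∀ I, ContDiffOn ℝ ∞ (fun z : EuclideanSpace ℝ (Fin n) × ℝ => T z.2 z.1 I)
      (chartSpaceTime e W)) (t : ℝ) : SmoothTensorOn (chartDom e (timeSlice W t)) (T t) :=
  fun I => (hT I).comp (f := fun y : EuclideanSpace ℝ (Fin n) => (y, t))
    (by fun_prop) fun y hy => ⟨hy.1, hy.2⟩

end ChartDomains

/-! ### Components of tensor fields in the charts of a manifold -/

section Charts

variable {n : ℕ} {M : Type*} [TopologicalSpace M] [ChartedSpace (EuclideanSpace ℝ (Fin n)) M]

/-- All tangent spaces are definitionally the model space. Reading vectors there avoids transport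
along equalities such as `e.symm (e x) = x`. -/
theorem bilin_congr (a : BilinField n M) {p q : M} (h : p = q) (v w : EuclideanSpace ℝ (Fin n)) :
    (a p : EuclideanSpace ℝ (Fin n) →L[ℝ] EuclideanSpace ℝ (Fin n) →L[ℝ] ℝ) v w
      = (a q : EuclideanSpace ℝ (Fin n) →L[ℝ] EuclideanSpace ℝ (Fin n) →L[ℝ] ℝ) v w := by
  subst h; rfl

theorem form_congr (H : ThreeForm n M) {p q : M} (h : p = q)
    (v : Fin 3 → EuclideanSpace ℝ (Fin n)) :
    (H p : EuclideanSpace ℝ (Fin n) [⋀^Fin 3]→L[ℝ] ℝ) v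
      = (H q : EuclideanSpace ℝ (Fin n) [⋀^Fin 3]→L[ℝ] ℝ) v := by
  subst h; rfl

/-- The tangent vector with coordinates `v`. -/
noncomputable def tangentOf (e : OpenPartialHomeomorph M (EuclideanSpace ℝ (Fin n)))
    (y : EuclideanSpace ℝ (Fin n)) (v : EuclideanSpace ℝ (Fin n)) : EuclideanSpace ℝ (Fin n) :=
  mfderiv (𝓡 n) (𝓡 n) e.symm y v

theorem tangentOf_eq_sum (e : OpenPartialHomeomorph M (EuclideanSpace ℝ (Fin n)))
    (y v : EuclideanSpace ℝ (Fin n)) :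
    tangentOf e y v = ∑ i, v i • (coordVec e y i : EuclideanSpace ℝ (Fin n)) := by
  have hv : v = ∑ b, v b • EuclideanSpace.single b (1 : ℝ) := by
    ext i
    simp [Finset.sum_apply, Pi.single_apply]
  let L : EuclideanSpace ℝ (Fin n) →L[ℝ] EuclideanSpace ℝ (Fin n) :=
    mfderiv (𝓡 n) (𝓡 n) e.symm y
  change L v = ∑ i, v i • L (EuclideanSpace.single i 1)
  conv_lhs => rw [hv]
  simp only [map_sum, map_smul]

theorem bilin_sum (L : EuclideanSpace ℝ (Fin n) →L[ℝ] EuclideanSpace ℝ (Fin n) →L[ℝ] ℝ)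
    (u : Fin n → EuclideanSpace ℝ (Fin n)) (a b : Fin n → ℝ) :
    L (∑ i, a i • u i) (∑ j, b j • u j) = ∑ i, ∑ j, a i * b j * L (u i) (u j) := by
  simp only [map_sum, map_smul, sum_apply, smul_apply, smul_eq_mul, Finset.mul_sum]
  rw [Finset.sum_comm]
  exact Finset.sum_congr rfl fun i _ => Finset.sum_congr rfl fun j _ => by ring

theorem quad_bilinComp (e : OpenPartialHomeomorph M (EuclideanSpace ℝ (Fin n)))
    (a : BilinField n M) (y v : EuclideanSpace ℝ (Fin n)) :
    quad (bilinComp e a) y v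
      = (a (e.symm y) : EuclideanSpace ℝ (Fin n) →L[ℝ] EuclideanSpace ℝ (Fin n) →L[ℝ] ℝ)
        (tangentOf e y v) (tangentOf e y v) := by
  let L : EuclideanSpace ℝ (Fin n) →L[ℝ] EuclideanSpace ℝ (Fin n) →L[ℝ] ℝ := a (e.symm y)
  change quad (bilinComp e a) y v = L (tangentOf e y v) (tangentOf e y v)
  rw [tangentOf_eq_sum]
  exact (bilin_sum L (coordVec e y) v v).symm

variable [IsManifold (𝓡 n) ∞ M]

theorem contDiffOn_transition {e e' : OpenPartialHomeomorph M (EuclideanSpace ℝ (Fin n))}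
    (he : e ∈ atlas (EuclideanSpace ℝ (Fin n)) M) (he' : e' ∈ atlas (EuclideanSpace ℝ (Fin n)) M)
    (O : Set M) : ContDiffOn ℝ ∞ (transition e e') (chartDom e (e'.source ∩ O)) := by
  have h1 := contMDiffOn_symm_of_mem_maximalAtlas (I := 𝓡 n) (n := ∞)
    (IsManifold.subset_maximalAtlas he)
  have h2 := contMDiffOn_of_mem_maximalAtlas (I := 𝓡 n) (n := ∞)
    (IsManifold.subset_maximalAtlas he')
  rw [← contMDiffOn_iff_contDiffOn]
  exact h2.comp (h1.mono fun y hy => hy.1) fun y hy => hy.2.1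

theorem mdifferentiable_of_atlas {e : OpenPartialHomeomorph M (EuclideanSpace ℝ (Fin n))}
    (he : e ∈ atlas (EuclideanSpace ℝ (Fin n)) M) : e.MDifferentiable (𝓡 n) (𝓡 n) :=
  have : IsManifold (𝓡 n) 1 M := IsManifold.of_le (n := ∞) (by norm_cast)
  mdifferentiable_of_mem_atlas he

/-- The transformation law of coordinate vectors. -/
theorem coordVec_eq_sum {e e' : OpenPartialHomeomorph M (EuclideanSpace ℝ (Fin n))}
    (he : e ∈ atlas (EuclideanSpace ℝ (Fin n)) M) (he' : e' ∈ atlas (EuclideanSpace ℝ (Fin n)) M)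
    {y : EuclideanSpace ℝ (Fin n)} (hy : y ∈ chartDom e e'.source) (i : Fin n) :
    (coordVec e y i : EuclideanSpace ℝ (Fin n))
      = ∑ j, jac (transition e e') y j i •
        (coordVec e' (transition e e' y) j : EuclideanSpace ℝ (Fin n)) := by
  have hopen := isOpen_chartDom e e'.open_source
  -- The law is the chain rule for this factorization.
  have h1 : e.symm =ᶠ[nhds y] e'.symm ∘ transition e e' := by
    filter_upwards [hopen.mem_nhds hy] with z hz
    exact (e'.left_inv hz.2).symm
  have hφ : DifferentiableAt ℝ (transition e e') y := by
    have := contDiffOn_transition he he' univ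
    rw [inter_univ] at this
    exact (this.contDiffAt (hopen.mem_nhds hy)).differentiableAt (by simp)
  have h2 : MDifferentiableAt (𝓡 n) (𝓡 n) e'.symm (transition e e' y) :=
    (mdifferentiable_of_atlas he').mdifferentiableAt_symm (e'.map_source hy.2)
  have h3 : mfderiv (𝓡 n) (𝓡 n) (e'.symm ∘ transition e e') y
      = (mfderiv (𝓡 n) (𝓡 n) e'.symm (transition e e' y)).comp
        (mfderiv (𝓡 n) (𝓡 n) (transition e e') y) := mfderiv_comp y h2 hφ.mdifferentiableAt
  have h4 : ∀ v : EuclideanSpace ℝ (Fin n), tangentOf e y v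
      = tangentOf e' (transition e e' y) (fderiv ℝ (transition e e') y v) := by
    intro v
    have h5 := congrArg (fun L : EuclideanSpace ℝ (Fin n) →L[ℝ] EuclideanSpace ℝ (Fin n) => L v)
      (h1.mfderiv_eq (I := 𝓡 n) (I' := 𝓡 n))
    have h6 := congrArg (fun L : EuclideanSpace ℝ (Fin n) →L[ℝ] EuclideanSpace ℝ (Fin n) => L v) h3
    rw [mfderiv_eq_fderiv] at h6
    exact h5.trans h6
  have h5 : (coordVec e y i : EuclideanSpace ℝ (Fin n))
      = tangentOf e y (EuclideanSpace.single i 1) := rfl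
  rw [h5, h4, tangentOf_eq_sum]
  refine Finset.sum_congr rfl fun j _ => ?_
  congr 1
  have := ((EuclideanSpace.proj (𝕜 := ℝ) j).hasFDerivAt.comp y hφ.hasFDerivAt).fderiv
  unfold jac pd
  have h3 : (fun z => transition e e' z j)
    = (EuclideanSpace.proj (𝕜 := ℝ) j) ∘ transition e e' := rfl
  rw [h3, this]; rfl

theorem isPullback_bilinComp {e e' : OpenPartialHomeomorph M (EuclideanSpace ℝ (Fin n))}
    (he : e ∈ atlas (EuclideanSpace ℝ (Fin n)) M) (he' : e' ∈ atlas (EuclideanSpace ℝ (Fin n)) M)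
    (a : BilinField n M) :
    IsPullback (transition e e') (chartDom e e'.source) (bilinComp e a) (bilinComp e' a) := by
  intro y hy I
  have hp : e.symm y = e'.symm (transition e e' y) := (e'.left_inv hy.2).symm
  let L : EuclideanSpace ℝ (Fin n) →L[ℝ] EuclideanSpace ℝ (Fin n) →L[ℝ] ℝ :=
    a (e'.symm (transition e e' y))
  have h1 : bilinComp e a y I = L (coordVec e y (I 0)) (coordVec e y (I 1)) :=
    bilin_congr a hp _ _
  have h2 : ∀ J, bilinComp e' a (transition e e' y) J
      = L (coordVec e' (transition e e' y) (J 0)) (coordVec e' (transition e e' y) (J 1)) :=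
    fun J => rfl
  rw [h1, coordVec_eq_sum he he' hy, coordVec_eq_sum he he' hy, sum_fin_two_fun]
  refine (bilin_sum L (coordVec e' (transition e e' y)) _ _).trans ?_
  refine Finset.sum_congr rfl fun j _ => Finset.sum_congr rfl fun k _ => ?_
  rw [h2, Fin.prod_univ_two]
  rfl

theorem isPullback_formComp {e e' : OpenPartialHomeomorph M (EuclideanSpace ℝ (Fin n))}
    (he : e ∈ atlas (EuclideanSpace ℝ (Fin n)) M) (he' : e' ∈ atlas (EuclideanSpace ℝ (Fin n)) M)
    (H : ThreeForm n M) :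
    IsPullback (transition e e') (chartDom e e'.source) (formComp e H) (formComp e' H) := by
  intro y hy I
  have hp : e.symm y = e'.symm (transition e e' y) := (e'.left_inv hy.2).symm
  let L : EuclideanSpace ℝ (Fin n) [⋀^Fin 3]→L[ℝ] ℝ := H (e'.symm (transition e e' y))
  have h1 : formComp e H y I = L fun s => coordVec e y (I s) := form_congr H hp _
  have h2 : ∀ J, formComp e' H (transition e e' y) J
      = L fun s => coordVec e' (transition e e' y) (J s) := fun J => rfl
  rw [h1]
  simp only [h2]
  have h3 : (fun s => (coordVec e y (I s) : EuclideanSpace ℝ (Fin n)))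
      = fun s => ∑ j, jac (transition e e') y j (I s) •
        (coordVec e' (transition e e' y) j : EuclideanSpace ℝ (Fin n)) :=
    funext fun s => coordVec_eq_sum he he' hy (I s)
  rw [h3]
  have h4 := L.toContinuousMultilinearMap.map_sum fun s j =>
    jac (transition e e') y j (I s) •
      (coordVec e' (transition e e' y) j : EuclideanSpace ℝ (Fin n))
  refine h4.trans (Finset.sum_congr rfl fun J _ => ?_)
  exact L.toContinuousMultilinearMap.map_smul_univ _ _

theorem tangentOf_injective {e : OpenPartialHomeomorph M (EuclideanSpace ℝ (Fin n))}
    (he : e ∈ atlas (EuclideanSpace ℝ (Fin n)) M) {y : EuclideanSpace ℝ (Fin n)}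
    (hy : y ∈ e.target) : Function.Injective (tangentOf e y) :=
  (mdifferentiable_of_atlas he).symm.mfderiv_injective hy

theorem tangentOf_surjective {e : OpenPartialHomeomorph M (EuclideanSpace ℝ (Fin n))}
    (he : e ∈ atlas (EuclideanSpace ℝ (Fin n)) M) {y : EuclideanSpace ℝ (Fin n)}
    (hy : y ∈ e.target) : Function.Surjective (tangentOf e y) :=
  (mdifferentiable_of_atlas he).symm.mfderiv_surjective hy

/-- The Gram form at v is the metric on the tangent vector with coordinates v, which is nonzero for
v ≠ 0 because the differential of `e.symm` is injective. -/
theorem posDef_gram_bilinComp {e : OpenPartialHomeomorph M (EuclideanSpace ℝ (Fin n))}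
    (he : e ∈ atlas (EuclideanSpace ℝ (Fin n)) M) {y : EuclideanSpace ℝ (Fin n)}
    (hy : y ∈ e.target) {a : BilinField n M}
    (hs : ∀ v w : TangentSpace (𝓡 n) (e.symm y), a (e.symm y) v w = a (e.symm y) w v)
    (hp : ∀ v : TangentSpace (𝓡 n) (e.symm y), v ≠ 0 → 0 < a (e.symm y) v v) :
    (gram (bilinComp e a) y).PosDef := by
  refine Matrix.PosDef.of_dotProduct_mulVec_pos ?_ fun v hv => ?_
  · ext i j
    simpa [gram, bilinComp] using hs _ _
  · have h1 : star v ⬝ᵥ (gram (bilinComp e a) y).mulVec v = quad (bilinComp e a) y v := by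
      simp only [dotProduct, Matrix.mulVec, quad, gram_apply, Finset.mul_sum]
      exact Finset.sum_congr rfl fun i _ => Finset.sum_congr rfl fun j _ => by
        simp only [star_trivial]; ring
    rw [h1]
    have h2 := quad_bilinComp e a y (WithLp.toLp 2 v)
    refine lt_of_lt_of_eq (hp _ fun h0 => hv ?_) h2.symm
    have h3 : tangentOf e y (WithLp.toLp 2 v) = tangentOf e y 0 :=
      h0.trans (map_zero (mfderiv (𝓡 n) (𝓡 n) e.symm y)).symm
    have h4 := tangentOf_injective he hy h3
    funext i
    exact congrArg (fun u : EuclideanSpace ℝ (Fin n) => u i) h4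

/-- A coordinate field is the image of a constant section under the tangent map of `e.symm`. It is
used to read smooth components off the bundle notion of a smooth metric. -/
theorem contMDiffOn_coordVec {e : OpenPartialHomeomorph M (EuclideanSpace ℝ (Fin n))}
    (he : e ∈ atlas (EuclideanSpace ℝ (Fin n)) M) (i : Fin n) :
    ContMDiffOn (𝓡 n) ((𝓡 n).prod 𝓘(ℝ, EuclideanSpace ℝ (Fin n))) ∞
      (fun y => (Bundle.TotalSpace.mk' (EuclideanSpace ℝ (Fin n))
        (E := fun x : M => TangentSpace (𝓡 n) x) (e.symm y) (coordVec e y i))) e.target := by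
  have : IsManifold (𝓡 n) 1 M := IsManifold.of_le (n := ∞) (by norm_cast)
  have h1 := contMDiffOn_symm_of_mem_maximalAtlas (I := 𝓡 n) (n := ∞)
    (IsManifold.subset_maximalAtlas he)
  have h2 := h1.contMDiffOn_tangentMapWithin (m := ∞) (by simp) e.open_target.uniqueMDiffOn
  have h3 : ContMDiffOn (𝓡 n) (𝓡 n).tangent ∞ (fun y : EuclideanSpace ℝ (Fin n) =>
      (⟨y, EuclideanSpace.single i (1 : ℝ)⟩ :
        TangentBundle (𝓡 n) (EuclideanSpace ℝ (Fin n)))) e.target :=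
    contMDiffOn_vectorSpace_iff_contDiffOn.2 contDiffOn_const
  refine (h2.comp h3 fun y hy => hy).congr fun y hy => ?_
  simp only [Function.comp, tangentMapWithin, coordVec]
  rw [mfderivWithin_of_isOpen e.open_target hy]

theorem contDiffOn_background
    (g : Bundle.ContMDiffRiemannianMetric (𝓡 n) ∞ (EuclideanSpace ℝ (Fin n))
      (fun x : M => TangentSpace (𝓡 n) x))
    {e : OpenPartialHomeomorph M (EuclideanSpace ℝ (Fin n))}
    (he : e ∈ atlas (EuclideanSpace ℝ (Fin n)) M) :
    SmoothTensorOn e.target (bilinComp e g.inner) := by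
  intro I
  have : IsManifold (𝓡 n) 1 M := IsManifold.of_le (n := ∞) (by norm_cast)
  have h1 := contMDiffOn_symm_of_mem_maximalAtlas (I := 𝓡 n) (n := ∞)
    (IsManifold.subset_maximalAtlas he)
  have h2 := g.contMDiff.comp_contMDiffOn h1
  have h3 := ContMDiffOn.clm_bundle_apply₂ (F₃ := ℝ) (E₃ := Bundle.Trivial M ℝ)
    (𝕜 := ℝ) h2 (contMDiffOn_coordVec he (I 0)) (contMDiffOn_coordVec he (I 1))
  rw [← contMDiffOn_iff_contDiffOn]
  intro y hy
  have h4 := h3 y hy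
  simp only [Bundle.contMDiffWithinAt_totalSpace] at h4
  exact h4.2

end Charts

/-! ### Independence of the norms from the chart -/

section Invariance

variable {n r : ℕ} {M : Type*} [TopologicalSpace M] [ChartedSpace (EuclideanSpace ℝ (Fin n)) M]

/-- In all charts, the components of `a` on the open set `O` are a smooth Riemannian metric. -/
def IsMetricField (O : Set M) (a : BilinField n M) : Prop :=
  ∀ e ∈ atlas (EuclideanSpace ℝ (Fin n)) M, IsMetricOn (chartDom e O) (bilinComp e a)

theorem IsPullback.mono {φ : EuclideanSpace ℝ (Fin n) → EuclideanSpace ℝ (Fin n)}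
    {U U' : Set (EuclideanSpace ℝ (Fin n))} (hU : U' ⊆ U) {T' T : CoordTensor n r}
    (h : IsPullback φ U T' T) : IsPullback φ U' T' T := fun y hy => h y (hU hy)

theorem IsMetricOn.mono {V V' : Set (EuclideanSpace ℝ (Fin n))} {G : CoordTensor n 2}
    (h : IsMetricOn V G) (hV : V' ⊆ V) : IsMetricOn V' G :=
  ⟨fun I => (h.smooth I).mono hV, fun y hy => h.posDef y (hV hy)⟩

section MetricFam

variable {a : BilinField n M} {e : OpenPartialHomeomorph M (EuclideanSpace ℝ (Fin n))}
  {L : Set (EuclideanSpace ℝ (Fin n))} {ι : Type*} {D : FamDomain ι n}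

theorem IsMetricField.isMetricFam (ha : IsMetricField univ a)
    (he : e ∈ atlas (EuclideanSpace ℝ (Fin n)) M) (hD : ∀ k, ∀ z ∈ D.dom k, z.1 ∈ e.target) :
    IsMetricFam D (fun _ _ => bilinComp e a) where
  smooth I k := ((ha e he).smooth I).comp (f := Prod.fst) contDiffOn_fst
    fun z hz => ⟨hD k z hz, mem_univ _⟩
  posDef k z hz := (ha e he).posDef _ ⟨hD k z hz, mem_univ _⟩

theorem IsMetricField.timeJetBdd (ha : IsMetricField univ a)
    (he : e ∈ atlas (EuclideanSpace ℝ (Fin n)) M) (hL : IsCompact L) (hLe : L ⊆ e.target)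
    (hD : ∀ k, ∀ z ∈ D.dom k, z.1 ∈ e.target) (hDL : ∀ k, ∀ z ∈ D.core k, z.1 ∈ L) (q : ℕ)
    (I : Fin 2 → Fin n) :
    TimeJetBdd D q (TensorFam.comp (fun _ _ => bilinComp e a) I) :=
  timeJetBdd_of_compact e.open_target hL hLe hD hDL
    (((ha e he).smooth I).mono fun _ hy => ⟨hy, mem_univ _⟩) q

theorem IsMetricField.invBdd (ha : IsMetricField univ a)
    (he : e ∈ atlas (EuclideanSpace ℝ (Fin n)) M) (hL : IsCompact L) (hLe : L ⊆ e.target)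
    (hD : ∀ k, ∀ z ∈ D.dom k, z.1 ∈ e.target) (hDL : ∀ k, ∀ z ∈ D.core k, z.1 ∈ L) :
    InvBdd D (fun _ _ => bilinComp e a) := fun i j =>
  (timeJetBdd_of_compact e.open_target hL hLe hD hDL
    (((ha e he).contDiffOn_invMetric i j).mono fun _ hy => ⟨hy, mem_univ _⟩) 0).bdd

/-- The way back from partial to covariant derivatives: the background Christoffel symbols and
inverse metric have bounded jets on L and do not depend on time. -/
theorem IsMetricField.exists_tensorNorm_iteratedDeriv_le {r : ℕ} (ha : IsMetricField univ a)
    (he : e ∈ atlas (EuclideanSpace ℝ (Fin n)) M) (hL : IsCompact L) (hLe : L ⊆ e.target)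
    (hD : ∀ k, ∀ z ∈ D.dom k, z.1 ∈ e.target) (hDL : ∀ k, ∀ z ∈ D.core k, z.1 ∈ L)
    {T : TensorFam ι n r} {q : ℕ} (hT : ∀ I, TimeJetBdd D q (T.comp I)) (p : ℕ) :
    ∃ c, ∀ k, ∀ z ∈ D.core k, tensorNorm (bilinComp e a) z.1 (fun I =>
      iteratedDeriv q (fun s => iterCovDeriv (bilinComp e a) (T k s) p z.1 I) z.2) ≤ c := by
  have hinv := ha.invBdd he hL hLe hD hDL
  have h1 := TimeJetBdd.iterCovDeriv (ha.isMetricFam he hD) hinv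
    (ha.timeJetBdd he hL hLe hD hDL q) hT p
  choose b hb using fun I => (h1 I).abs_iteratedDeriv_le
  obtain ⟨c, hc, hcb⟩ := exists_uniform_bdd (α := Fin n × Fin n) (D := D) (w := 0)
    (f := fun i _ z => invMetric (bilinComp e a) z.1 i.1 i.2) (fun i => hinv i.1 i.2)
    zero_weight_nonneg
  refine ⟨_, fun k z hz => tensorNorm_le (c := c) (b := ∑ I, |b I|)
    (fun i j => by simpa using hcb (i, j) k z hz) fun I => ?_⟩
  exact ((hb I k z hz).trans (le_abs_self _)).trans
    (Finset.single_le_sum (f := fun I => |b I|) (fun _ _ => abs_nonneg _) (Finset.mem_univ I))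

end MetricFam

variable [IsManifold (𝓡 n) ∞ M] {O : Set M} {a : BilinField n M}
  {e e' : OpenPartialHomeomorph M (EuclideanSpace ℝ (Fin n))}

theorem IsMetricField.isPullback_iterCovDeriv (ha : IsMetricField O a)
    (he : e ∈ atlas (EuclideanSpace ℝ (Fin n)) M) (he' : e' ∈ atlas (EuclideanSpace ℝ (Fin n)) M)
    {O' : Set M} (hO' : IsOpen O') (hOO : O' ⊆ O) {T' T : CoordTensor n r}
    (hT : SmoothTensorOn (chartDom e' O') T)
    (h : IsPullback (transition e e') (chartDom e (e'.source ∩ O')) T' T) (p : ℕ) :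
    IsPullback (transition e e') (chartDom e (e'.source ∩ O'))
      (iterCovDeriv (bilinComp e a) T' p) (iterCovDeriv (bilinComp e' a) T p) :=
  ((isPullback_bilinComp he he' a).mono (chartDom_mono e inter_subset_left)).iterCovDeriv
    (isOpen_chartDom e (e'.open_source.inter hO')) (isOpen_chartDom e' hO')
    (contDiffOn_transition he he' O') (mapsTo_transition e e' O')
    ((ha e he).mono (chartDom_mono e (inter_subset_right.trans hOO)))
    ((ha e' he').mono (chartDom_mono e' hOO)) hT h p

theorem IsMetricField.tensorNorm_eq (ha : IsMetricField O a)
    (he : e ∈ atlas (EuclideanSpace ℝ (Fin n)) M) (he' : e' ∈ atlas (EuclideanSpace ℝ (Fin n)) M)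
    {x : M} (hx : x ∈ O) (hxe : x ∈ e.source) (hxe' : x ∈ e'.source)
    {T' T : (Fin r → Fin n) → ℝ}
    (hT : ∀ I, T' I = ∑ J : Fin r → Fin n,
      (∏ s, jac (transition e e') (e x) (J s) (I s)) * T J) :
    tensorNorm (bilinComp e a) (e x) T' = tensorNorm (bilinComp e' a) (e' x) T := by
  rw [← transition_apply (e' := e') hxe]
  exact tensorNorm_eq_of_pullback (isPullback_bilinComp he he' a) (mem_chartDom hxe hxe')
    ((ha e he).det_ne_zero (mem_chartDom hxe hx)) hT

theorem IsMetricField.tensorNorm_iterCovDeriv_eq (ha : IsMetricField O a) (hO : IsOpen O)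
    (he : e ∈ atlas (EuclideanSpace ℝ (Fin n)) M) (he' : e' ∈ atlas (EuclideanSpace ℝ (Fin n)) M)
    {x : M} (hx : x ∈ O) (hxe : x ∈ e.source) (hxe' : x ∈ e'.source) {T' T : CoordTensor n r}
    (hT : SmoothTensorOn (chartDom e' O) T)
    (h : IsPullback (transition e e') (chartDom e (e'.source ∩ O)) T' T) (p : ℕ) :
    tensorNorm (bilinComp e a) (e x) (iterCovDeriv (bilinComp e a) T' p (e x))
      = tensorNorm (bilinComp e' a) (e' x) (iterCovDeriv (bilinComp e' a) T p (e' x)) :=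
  ha.tensorNorm_eq he he' hx hxe hxe' fun I => by
    have := ha.isPullback_iterCovDeriv he he' hO Subset.rfl hT h p _
      (mem_chartDom hxe ⟨hxe', hx⟩) I
    rwa [transition_apply hxe] at this

theorem IsMetricField.normCovRm_eq (ha : IsMetricField O a) (hO : IsOpen O)
    (he : e ∈ atlas (EuclideanSpace ℝ (Fin n)) M) {x : M} (hx : x ∈ O) (hxe : x ∈ e.source)
    (p : ℕ) : normCovRm a p x
      = tensorNorm (bilinComp e a) (e x)
        (iterCovDeriv (bilinComp e a) (riemann (bilinComp e a)) p (e x)) := by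
  have hc := chart_mem_atlas (EuclideanSpace ℝ (Fin n)) x
  have hR : SmoothTensorOn (chartDom e O) (riemann (bilinComp e a)) :=
    smoothTensorOn_riemann (ha e he) (isOpen_chartDom e hO)
  refine ha.tensorNorm_iterCovDeriv_eq hO hc he hx (mem_chart_source _ x) hxe hR ?_ p
  exact ((isPullback_bilinComp hc he a).mono (chartDom_mono _ inter_subset_left)).riemann
    (isOpen_chartDom _ (e.open_source.inter hO)) (isOpen_chartDom e hO)
    (contDiffOn_transition hc he O) (mapsTo_transition _ e O)
    ((ha _ hc).mono (chartDom_mono _ inter_subset_right)) (ha e he)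

theorem IsMetricField.normCovBilin_eq (ha : IsMetricField O a)
    (he : e ∈ atlas (EuclideanSpace ℝ (Fin n)) M) {x : M} (hxe : x ∈ e.source)
    {O' : Set M} (hO' : IsOpen O') (hOO : O' ⊆ O) (hx' : x ∈ O') {b : BilinField n M}
    (hb : SmoothTensorOn (chartDom e O') (bilinComp e b)) (p : ℕ) : normCovBilin a b p x
      = tensorNorm (bilinComp e a) (e x)
        (iterCovDeriv (bilinComp e a) (bilinComp e b) p (e x)) := by
  have hc := chart_mem_atlas (EuclideanSpace ℝ (Fin n)) x
  have ha' : IsMetricField O' a := fun e he => (ha e he).mono (chartDom_mono _ hOO)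
  exact ha'.tensorNorm_iterCovDeriv_eq hO' hc he hx' (mem_chart_source _ x) hxe hb
    ((isPullback_bilinComp hc he b).mono (chartDom_mono _ inter_subset_left)) p

theorem IsMetricField.normCovForm_eq (ha : IsMetricField O a) (hO : IsOpen O)
    (he : e ∈ atlas (EuclideanSpace ℝ (Fin n)) M) {x : M} (hx : x ∈ O) (hxe : x ∈ e.source)
    {H : ThreeForm n M} (hH : SmoothTensorOn (chartDom e O) (formComp e H)) (p : ℕ) :
    normCovForm a H p x = tensorNorm (bilinComp e a) (e x)
      (iterCovDeriv (bilinComp e a) (formComp e H) p (e x)) := by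
  have hc := chart_mem_atlas (EuclideanSpace ℝ (Fin n)) x
  exact ha.tensorNorm_iterCovDeriv_eq hO hc he hx (mem_chart_source _ x) hxe hH
    ((isPullback_formComp hc he H).mono (chartDom_mono _ inter_subset_left)) p

/-- A chart, as a domain for families of functions. -/
def chartFamDomain {ι : Type*} (e : OpenPartialHomeomorph M (EuclideanSpace ℝ (Fin n)))
    (W : ι → Set (M × ℝ)) (hW : ∀ k, IsOpen (W k)) (S : Set (EuclideanSpace ℝ (Fin n)))
    (J : Set ℝ) (hS : ∀ k, S ×ˢ J ⊆ chartSpaceTime e (W k)) : FamDomain ι n where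
  dom k := chartSpaceTime e (W k)
  core _ := S ×ˢ J
  isOpen k := isOpen_chartSpaceTime e (hW k)
  subset := hS

theorem iteratedDeriv_sum_const_mul {α : Type*} {s : Finset α} {c : α → ℝ} {f : α → ℝ → ℝ}
    {q : ℕ} {t : ℝ} (hf : ∀ i ∈ s, ContDiffAt ℝ q (f i) t) :
    iteratedDeriv q (fun x => ∑ i ∈ s, c i * f i x) t = ∑ i ∈ s, c i * iteratedDeriv q (f i) t := by
  rw [iteratedDeriv_fun_sum fun i hi => contDiffAt_const.mul (hf i hi)]
  exact Finset.sum_congr rfl fun i hi => iteratedDeriv_const_mul _ (hf i hi)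

/-- The Jacobian of the transition does not depend on time, so time derivatives of components again
transform as a tensor. -/
theorem IsMetricField.tensorNorm_iteratedDeriv_eq (ha : IsMetricField univ a)
    (he : e ∈ atlas (EuclideanSpace ℝ (Fin n)) M) (he' : e' ∈ atlas (EuclideanSpace ℝ (Fin n)) M)
    {W : Set (M × ℝ)} (hW : IsOpen W) {x : M} {t : ℝ} (hx : (x, t) ∈ W) (hxe : x ∈ e.source)
    (hxe' : x ∈ e'.source) {T' T : ℝ → CoordTensor n r}
    (hT : ∀ I, ContDiffOn ℝ ∞ (fun z : EuclideanSpace ℝ (Fin n) × ℝ => T z.2 z.1 I)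
      (chartSpaceTime e' W))
    (h : ∀ s, IsPullback (transition e e') (chartDom e e'.source) (T' s) (T s)) (p q : ℕ) :
    tensorNorm (bilinComp e a) (e x) (fun I =>
        iteratedDeriv q (fun s => iterCovDeriv (bilinComp e a) (T' s) p (e x) I) t)
      = tensorNorm (bilinComp e' a) (e' x) fun I =>
        iteratedDeriv q (fun s => iterCovDeriv (bilinComp e' a) (T s) p (e' x) I) t := by
  refine ha.tensorNorm_eq he he' (mem_univ x) hxe hxe' fun I => ?_
  have h1 : ∀ᶠ s in nhds t, (x, s) ∈ W :=
    (hW.preimage (f := fun s : ℝ => (x, s)) (by fun_prop)).mem_nhds hx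
  have h2 : (fun s => iterCovDeriv (bilinComp e a) (T' s) p (e x) I) =ᶠ[nhds t]
      fun s => ∑ J : Fin (r + p) → Fin n, (∏ u, jac (transition e e') (e x) (J u) (I u))
        * iterCovDeriv (bilinComp e' a) (T s) p (e' x) J := by
    filter_upwards [h1] with s hs
    have h3 := ha.isPullback_iterCovDeriv he he' (isOpen_timeSlice hW s)
      (subset_univ _) (smoothTensorOn_timeSlice hT s)
      ((h s).mono (chartDom_mono _ inter_subset_left)) p _ (mem_chartDom hxe ⟨hxe', hs⟩) I
    rwa [transition_apply hxe] at h3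
  rw [h2.iteratedDeriv_eq q]
  refine iteratedDeriv_sum_const_mul fun J _ => ?_
  -- The empty core asks for no bounds; this domain only supplies smoothness in time, needed to
  -- differentiate the finite sum.
  let D : FamDomain Unit n := chartFamDomain e' (fun _ => W) (fun _ => hW) ∅ ∅
    fun _ => by simp
  have h4 : SmoothFam D _ := SmoothFam.iterCovDeriv (D := D) (T := fun _ s => T s)
    (ha.isMetricFam he' fun _ z hz => hz.1) (fun I _ => hT I) p J
  exact contDiffAt_slice h4 (k := ()) (z := (e' x, t))
    ⟨e'.map_source hxe', by simpa [e'.left_inv hxe'] using hx⟩ q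

end Invariance

/-! ### Solutions of the flow on a manifold -/

section Solutions

variable {n : ℕ} {M : Type*} [TopologicalSpace M] [ChartedSpace (EuclideanSpace ℝ (Fin n)) M]
  [IsManifold (𝓡 n) ∞ M] {W : Set (M × ℝ)} {g : ℝ → BilinField n M} {H : ℝ → ThreeForm n M}

theorem IsSolutionOn.posDef (h : IsSolutionOn W g H)
    {e : OpenPartialHomeomorph M (EuclideanSpace ℝ (Fin n))}
    (he : e ∈ atlas (EuclideanSpace ℝ (Fin n)) M) {z : EuclideanSpace ℝ (Fin n) × ℝ}
    (hz : z ∈ chartSpaceTime e W) : (gram (bilinComp e (g z.2)) z.1).PosDef :=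
  posDef_gram_bilinComp he hz.1 (h.symm _ _ hz.2) (h.pos _ _ hz.2)

theorem IsSolutionOn.isMetricField (h : IsSolutionOn W g H) (t : ℝ) :
    IsMetricField (timeSlice W t) (g t) := fun e he =>
  ⟨smoothTensorOn_timeSlice (T := fun s => bilinComp e (g s)) (h.smooth_metric e he) t,
    fun _ hy => h.posDef he (z := (_, t)) ⟨hy.1, hy.2⟩⟩

theorem isMetricField_background
    (g : Bundle.ContMDiffRiemannianMetric (𝓡 n) ∞ (EuclideanSpace ℝ (Fin n))
      (fun x : M => TangentSpace (𝓡 n) x)) : IsMetricField univ g.inner := fun _ he =>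
  ⟨fun I => (contDiffOn_background g he I).mono inter_subset_left,
    fun _ hy => posDef_gram_bilinComp he hy.1 (g.symm _) (g.pos _)⟩

/-- The metrics of a solution are uniformly equivalent where the curvature and the form are
bounded. -/
theorem IsSolutionOn.exp_bounds (h : IsSolutionOn W g H) {x : M} {β ψ t₀ t : ℝ} {c : ℝ}
    (hW : ∀ s ∈ Icc β ψ, (x, s) ∈ W) (ht₀ : t₀ ∈ Icc β ψ) (ht : t ∈ Icc β ψ)
    (hc : ∀ s ∈ Icc β ψ, normCovRm (g s) 0 x + normCovForm (g s) (H s) 0 x ≤ c)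
    (V : TangentSpace (𝓡 n) x) :
    Real.exp (-((2 * n * c + 1 / 2 * (n ^ 2 * c ^ 2)) * |t - t₀|)) * g t₀ x V V ≤ g t x V V ∧
      g t x V V ≤ Real.exp ((2 * n * c + 1 / 2 * (n ^ 2 * c ^ 2)) * |t - t₀|) * g t₀ x V V := by
  set e := chartAt (EuclideanSpace ℝ (Fin n)) x with he_def
  have he := chart_mem_atlas (EuclideanSpace ℝ (Fin n)) x
  have hxe := mem_chart_source (EuclideanSpace ℝ (Fin n)) x
  have hy : e x ∈ e.target := e.map_source hxe
  have hp : e.symm (e x) = x := e.left_inv hxe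
  obtain ⟨v, hv⟩ := tangentOf_surjective he hy V
  have hquad : ∀ s, g s x V V = quad (bilinComp e (g s)) (e x) v := by
    intro s
    rw [quad_bilinComp, hv]
    exact (bilin_congr (g s) hp V V).symm
  have hmem : ∀ s ∈ Icc β ψ, (e x, s) ∈ chartSpaceTime e W := fun s hs =>
    ⟨hy, by simpa [hp] using hW s hs⟩
  simp only [hquad]
  -- The derivative of g(V,V) is -2 Ric(V,V) + h(V,V)/2. The frame estimates bound it by 2n|Rm| +
  -- n²|H|²/2 times g(V,V), which explains the constant.
  refine exp_bounds_of_abs_deriv_le (u := fun s => quad (bilinComp e (g s)) (e x) v)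
    (u' := fun s => -2 * (∑ i, ∑ j, v i * v j * ricci (bilinComp e (g s)) (e x) ![i, j])
      + 1 / 2 * ∑ i, ∑ j, v i * v j
        * hTensor (bilinComp e (g s)) (formComp e (H s)) (e x) ![i, j]) ht₀ ?_ ?_ ht
  · intro s hs
    have h1 : ∀ i j, HasDerivAt (fun s => v i * v j * bilinComp e (g s) (e x) ![i, j])
        (v i * v j * (-2 * ricci (bilinComp e (g s)) (e x) ![i, j]
          + (1 / 2) * hTensor (bilinComp e (g s)) (formComp e (H s)) (e x) ![i, j])) s :=
      fun i j => (h.evol_metric e he _ hy s (hmem s hs).2 ![i, j]).const_mul _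
    have h2 := HasDerivAt.fun_sum (u := Finset.univ) fun i _ =>
      HasDerivAt.fun_sum (u := Finset.univ) fun j _ => h1 i j
    refine h2.congr_deriv ?_
    simp only [Finset.mul_sum, ← Finset.sum_add_distrib]
    exact Finset.sum_congr rfl fun i _ => Finset.sum_congr rfl fun j _ => by ring
  · intro s hs
    have hpd := h.posDef he (hmem s hs)
    have hRm : tensorNorm (bilinComp e (g s)) (e x) (riemann (bilinComp e (g s)) (e x))
        = normCovRm (g s) 0 x := rfl
    have hFm : tensorNorm (bilinComp e (g s)) (e x) (formComp e (H s) (e x))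
        = normCovForm (g s) (H s) 0 x := rfl
    have hRm0 : 0 ≤ normCovRm (g s) 0 x := tensorNorm_nonneg _ _ _
    have hFm0 : 0 ≤ normCovForm (g s) (H s) 0 x := tensorNorm_nonneg _ _ _
    have h1 := abs_ricci_le hpd v
    have h2 := abs_hTensor_le hpd (formComp e (H s)) v
    simp only at h1 h2
    rw [hRm] at h1
    rw [hFm] at h2
    have hq := quad_nonneg hpd v
    simp only at hq
    have hcs := hc s hs
    have h3 : n * normCovRm (g s) 0 x * quad (bilinComp e (g s)) (e x) v
        ≤ n * c * quad (bilinComp e (g s)) (e x) v := by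
      gcongr; linarith
    have h4 : n ^ 2 * normCovForm (g s) (H s) 0 x ^ 2 * quad (bilinComp e (g s)) (e x) v
        ≤ n ^ 2 * c ^ 2 * quad (bilinComp e (g s)) (e x) v := by
      gcongr; linarith
    refine (abs_add_le _ _).trans ?_
    rw [abs_mul, abs_mul, abs_neg, abs_two, abs_of_pos (one_half_pos (α := ℝ))]
    linarith

end Solutions

/-! ### Bounds in a chart -/

section PositiveDefinite

variable {n r : ℕ} {G : CoordTensor n 2} {y : EuclideanSpace ℝ (Fin n)}

/-- Positivity gives |g_{ab}| ≤ (g_{aa} + g_{bb})/2. -/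
theorem abs_apply_le_of_diag_le (h : (gram G y).PosDef) {m : ℝ} (hm : ∀ i, G y ![i, i] ≤ m)
    (a b : Fin n) : |G y ![a, b]| ≤ m := by
  obtain ⟨P, Q, -, -, hQ, -⟩ := exists_frame h
  have hG : ∀ a b, G y ![a, b] = ∑ k, Q k a * Q k b := fun a b => by
    rw [← gram_apply G y, ← hQ, Matrix.mul_apply]; rfl
  have h1 : |G y ![a, b]| ≤ ∑ k, (Q k a * Q k a + Q k b * Q k b) / 2 := by
    rw [hG]
    refine (Finset.abs_sum_le_sum_abs _ _).trans (Finset.sum_le_sum fun k _ => ?_)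
    rw [abs_le]
    constructor <;> nlinarith [sq_nonneg (Q k a + Q k b), sq_nonneg (Q k a - Q k b)]
  rw [← Finset.sum_div, Finset.sum_add_distrib, ← hG, ← hG] at h1
  linarith [hm a, hm b]

/-- Cauchy–Schwarz in a frame gives vᵢ² ≤ gⁱⁱ g(v,v); sum over i. -/
theorem sum_sq_le_quad (h : (gram G y).PosDef) {c : ℝ} (hc : ∀ i, invMetric G y i i ≤ c)
    (v : Fin n → ℝ) : ∑ i, v i ^ 2 ≤ n * c * quad G y v := by
  obtain ⟨P, Q, hPQ, -, hQ, hP⟩ := exists_frame h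
  have hv : ∀ i, v i = ∑ k, P i k * ∑ a, Q k a * v a := fun i => by
    have : (P * Q).mulVec v = v := by rw [hPQ, Matrix.one_mulVec]
    rw [← Matrix.mulVec_mulVec] at this
    exact (congrFun this i).symm
  have h1 : ∀ i, v i ^ 2 ≤ c * quad G y v := fun i => by
    have h2 : invMetric G y i i = ∑ k, P i k ^ 2 := by
      rw [invMetric_eq, ← hP, Matrix.mul_apply]
      exact Finset.sum_congr rfl fun k _ => by rw [Matrix.transpose_apply, sq]
    calc v i ^ 2 = (∑ k, P i k * ∑ a, Q k a * v a) ^ 2 := by rw [← hv]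
      _ ≤ (∑ k, P i k ^ 2) * ∑ k, (∑ a, Q k a * v a) ^ 2 := Finset.sum_mul_sq_le_sq_mul_sq _ _ _
      _ = invMetric G y i i * quad G y v := by rw [h2, quad_eq_of_frame hQ]
      _ ≤ c * quad G y v := mul_le_mul_of_nonneg_right (hc i) (quad_nonneg h v)
  calc ∑ i, v i ^ 2 ≤ ∑ _i : Fin n, c * quad G y v := Finset.sum_le_sum fun i _ => h1 i
    _ = n * c * quad G y v := by simp [mul_assoc]

theorem abs_component_le_of_le (h : (gram G y).PosDef) {m c : ℝ} (hm : ∀ i, G y ![i, i] ≤ m)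
    {T : (Fin r → Fin n) → ℝ} (hT : tensorNorm G y T ≤ c) (I : Fin r → Fin n) :
    |T I| ≤ c * Real.sqrt m ^ r := by
  refine (abs_component_le h T I).trans ?_
  have h1 : ∏ s, Real.sqrt (G y ![I s, I s]) ≤ Real.sqrt m ^ r := by
    calc ∏ s, Real.sqrt (G y ![I s, I s]) ≤ ∏ _s : Fin r, Real.sqrt m :=
          Finset.prod_le_prod (fun _ _ => Real.sqrt_nonneg _)
            fun s _ => Real.sqrt_le_sqrt (hm _)
      _ = Real.sqrt m ^ r := by simp
  exact mul_le_mul hT h1 (Finset.prod_nonneg fun _ _ => Real.sqrt_nonneg _)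
    ((tensorNorm_nonneg _ _ _).trans hT)

end PositiveDefinite

/-! ### From intrinsic bounds to component bounds -/

section ChartBounds

theorem BddFam.of_le {ι : Type*} {n : ℕ} {D : FamDomain ι n} {f : Fam ι n} {c : ℝ}
    (h : ∀ k, ∀ z ∈ D.core k, |f k z| ≤ c) : BddFam D 0 f :=
  ⟨|c|, abs_nonneg _, fun k z hz => by
    simpa using (h k z hz).trans (le_abs_self c)⟩

variable {n : ℕ} {M : Type*} [TopologicalSpace M] [ChartedSpace (EuclideanSpace ℝ (Fin n)) M]
  [IsManifold (𝓡 n) ∞ M] {ι : Type*} {W : ι → Set (M × ℝ)} {gk : ι → ℝ → BilinField n M}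
  {Hk : ι → ℝ → ThreeForm n M} {e : OpenPartialHomeomorph M (EuclideanSpace ℝ (Fin n))}
  {S L : Set (EuclideanSpace ℝ (Fin n))} {β ψ t₀ : ℝ} {a : BilinField n M}

theorem localSolution_of_bounds (hW : ∀ k, IsOpen (W k))
    (hsol : ∀ k, IsSolutionOn (W k) (gk k) (Hk k))
    (he : e ∈ atlas (EuclideanSpace ℝ (Fin n)) M)
    (hS : ∀ k, S ×ˢ Icc β ψ ⊆ chartSpaceTime e (W k)) {m c : ℝ} (hc : 0 < c) {C₂ : ℕ → ℝ}
    (hm : ∀ k, ∀ y ∈ S, ∀ t ∈ Icc β ψ, ∀ i, bilinComp e (gk k t) y ![i, i] ≤ m)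
    (hl : ∀ k, ∀ y ∈ S, ∀ t ∈ Icc β ψ, ∀ v : Fin n → ℝ,
      c * ∑ i, v i ^ 2 ≤ quad (bilinComp e (gk k t)) y v)
    (hb : ∀ k p, ∀ y ∈ S, ∀ t ∈ Icc β ψ, normCovRm (gk k t) p (e.symm y)
      + normCovForm (gk k t) (Hk k t) p (e.symm y) ≤ C₂ p) :
    LocalSolution (chartFamDomain e W hW S (Icc β ψ) hS) S β ψ
      (fun k t => bilinComp e (gk k t)) (fun k t => formComp e (Hk k t)) where
  core_eq _ := rfl
  metric := ⟨fun I k => (hsol k).smooth_metric e he I, fun k _ hz => (hsol k).posDef he hz⟩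
  smooth_form I k := (hsol k).smooth_form e he I
  evol_metric k z hz I := (hsol k).evol_metric e he z.1 hz.1 z.2 hz.2 I
  evol_form k z hz I := (hsol k).evol_form e he z.1 hz.1 z.2 hz.2 I
  metric_bdd I := by
    refine BddFam.of_le (c := m) fun k z hz => ?_
    have := abs_apply_le_of_diag_le ((hsol k).posDef he (hS k hz)) (hm k z.1 hz.1 z.2 hz.2)
      (I 0) (I 1)
    have hI : I = ![I 0, I 1] := by ext i; fin_cases i <;> rfl
    rw [hI]
    exact this
  inv_bdd i j := BddFam.of_le fun k z hz =>
    abs_invMetric_le ((hsol k).posDef he (hS k hz)) hc (hl k z.1 hz.1 z.2 hz.2) i j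
  curvature_bdd p I := by
    refine BddFam.of_le (c := C₂ p * Real.sqrt m ^ (4 + p)) fun k z hz => ?_
    have hz' := hS k hz
    refine abs_component_le_of_le ((hsol k).posDef he hz') (hm k z.1 hz.1 z.2 hz.2) (c := C₂ p)
      (T := iterCovDeriv (bilinComp e (gk k z.2)) (riemann (bilinComp e (gk k z.2))) p z.1) ?_ I
    have h1 := ((hsol k).isMetricField z.2).normCovRm_eq (isOpen_timeSlice (hW k) z.2) he
      (x := e.symm z.1) hz'.2 (e.map_target hz'.1) p
    rw [e.right_inv hz'.1] at h1
    have h2 : 0 ≤ normCovForm (gk k z.2) (Hk k z.2) p (e.symm z.1) := tensorNorm_nonneg _ _ _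
    linarith [hb k p z.1 hz.1 z.2 hz.2]
  form_bdd p I := by
    refine BddFam.of_le (c := C₂ p * Real.sqrt m ^ (3 + p)) fun k z hz => ?_
    have hz' := hS k hz
    refine abs_component_le_of_le ((hsol k).posDef he hz') (hm k z.1 hz.1 z.2 hz.2) (c := C₂ p)
      (T := iterCovDeriv (bilinComp e (gk k z.2)) (formComp e (Hk k z.2)) p z.1) ?_ I
    have h1 := ((hsol k).isMetricField z.2).normCovForm_eq (isOpen_timeSlice (hW k) z.2) he
      (x := e.symm z.1) hz'.2 (e.map_target hz'.1) (H := Hk k z.2)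
      (smoothTensorOn_timeSlice (T := fun s => formComp e (Hk k s))
        ((hsol k).smooth_form e he) z.2) p
    rw [e.right_inv hz'.1] at h1
    have h2 : 0 ≤ normCovRm (gk k z.2) p (e.symm z.1) := tensorNorm_nonneg _ _ _
    linarith [hb k p z.1 hz.1 z.2 hz.2]

/-- Bounds for the covariant derivatives give bounds for the derivatives of the components. -/
theorem IsMetricField.jetBdd_of_normCovBilin_le {D : FamDomain ι n}
    (ha : IsMetricField univ a)
    (he : e ∈ atlas (EuclideanSpace ℝ (Fin n)) M) (hL : IsCompact L) (hLe : L ⊆ e.target)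
    (hW : ∀ k, IsOpen (W k)) (hD : ∀ k, D.dom k ⊆ chartSpaceTime e (W k))
    (hDL : ∀ k, ∀ z ∈ D.core k, z.1 ∈ L)
    (hsm : ∀ k, ∀ I, ContDiffOn ℝ ∞ (fun z : EuclideanSpace ℝ (Fin n) × ℝ =>
      bilinComp e (gk k z.2) z.1 I) (chartSpaceTime e (W k)))
    {m : ℝ} (hm : ∀ y ∈ L, ∀ i, bilinComp e a y ![i, i] ≤ m) {C₁ : ℕ → ℝ}
    (hbdd : ∀ I, BddFam D 0 (TensorFam.comp (fun k t => bilinComp e (gk k t)) I))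
    (hb : ∀ k, ∀ p, ∀ z ∈ D.core k,
      normCovBilin a (gk k z.2) (p + 1) (e.symm z.1) ≤ C₁ (p + 1)) (p : ℕ) (I : Fin 2 → Fin n) :
    JetBdd D 0 p (TensorFam.comp (fun k t => bilinComp e (gk k t)) I) := by
  have hD' : ∀ k, ∀ z ∈ D.dom k, z.1 ∈ e.target := fun k z hz => (hD k hz).1
  have hmet : IsMetricFam D (fun _ _ => bilinComp e a) := ha.isMetricFam he hD'
  have hΓ := TimeJetBdd.christoffel hmet (ha.invBdd he hL hLe hD' hDL)
    (ha.timeJetBdd he hL hLe hD' hDL 0)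
  refine JetBdd.of_succ zero_weight_nonneg (JetBdd.of_iterCovDeriv zero_weight_nonneg hmet
    (T := fun k t => bilinComp e (gk k t)) (fun c i j => (hΓ c i j).jetBdd p)
    (fun I k => (hsm k I).mono (hD k)) (fun j J => ?_) 0 I)
  -- The initial bounds on covariant derivatives start at order one; order zero comes from the bound
  -- on the metric components.
  cases j with
  | zero => exact hbdd J
  | succ j =>
    refine BddFam.of_le (c := C₁ (j + 1) * Real.sqrt m ^ (2 + (j + 1))) fun k z hz => ?_
    have hz' := hD k (D.subset k hz)
    refine abs_component_le_of_le ((ha e he).posDef z.1 ⟨hz'.1, mem_univ _⟩)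
      (hm z.1 (hDL k z hz)) (c := C₁ (j + 1))
      (T := iterCovDeriv (bilinComp e a) (bilinComp e (gk k z.2)) (j + 1) z.1) ?_ J
    have h1 := ha.normCovBilin_eq he (x := e.symm z.1) (e.map_target hz'.1)
      (isOpen_timeSlice (hW k) z.2) (subset_univ _) hz'.2 (b := gk k z.2)
      (smoothTensorOn_timeSlice (T := fun s => bilinComp e (gk k s)) (hsm k) z.2) (j + 1)
    rw [e.right_inv hz'.1] at h1
    rw [← h1]
    exact hb k j z hz

end ChartBounds

/-! ### Bounds near a point -/

section Global

variable {n : ℕ} {M : Type*} [TopologicalSpace M] [ChartedSpace (EuclideanSpace ℝ (Fin n)) M]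
  [IsManifold (𝓡 n) ∞ M] {ι : Type*} {W : ι → Set (M × ℝ)} {gk : ι → ℝ → BilinField n M}
  {Hk : ι → ℝ → ThreeForm n M} {a : BilinField n M} {K : Set M} {β ψ t₀ : ℝ}

theorem exists_bound_of_isCompact {X : Type*} [TopologicalSpace X] {L : Set X} (hL : IsCompact L)
    {α : Type*} [Fintype α] {f : α → X → ℝ} (hf : ∀ i, ContinuousOn (f i) L) :
    ∃ c : ℝ, 0 ≤ c ∧ ∀ i, ∀ x ∈ L, f i x ≤ c := by
  choose c hc using fun i => hL.exists_bound_of_continuousOn (hf i)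
  refine ⟨∑ i, |c i|, Finset.sum_nonneg fun _ _ => abs_nonneg _, fun i x hx => ?_⟩
  exact ((le_abs_self _).trans ((hc i x hx).trans (le_abs_self _))).trans
    (Finset.single_le_sum (f := fun i => |c i|) (fun _ _ => abs_nonneg _) (Finset.mem_univ i))

/-- All derivatives of the solutions are uniformly bounded near a given point. -/
theorem exists_nhds_bound (ha : IsMetricField univ a) (ht₀ : t₀ ∈ Icc β ψ)
    (hW : ∀ k, IsOpen (W k)) (hKW : ∀ k, K ×ˢ Icc β ψ ⊆ W k)
    (hsol : ∀ k, IsSolutionOn (W k) (gk k) (Hk k)) {B : ℝ} (hB : 0 ≤ B)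
    (hle : ∀ k, ∀ x ∈ K, ∀ t ∈ Icc β ψ, ∀ V : TangentSpace (𝓡 n) x, gk k t x V V ≤ B * a x V V)
    (hge : ∀ k, ∀ x ∈ K, ∀ t ∈ Icc β ψ, ∀ V : TangentSpace (𝓡 n) x, a x V V ≤ B * gk k t x V V)
    {C₁ C₂ : ℕ → ℝ}
    (h_init : ∀ k p, ∀ x ∈ K, normCovBilin a (gk k t₀) (p + 1) x ≤ C₁ (p + 1))
    (h_bound : ∀ k p, ∀ x ∈ K, ∀ t ∈ Icc β ψ,
      normCovRm (gk k t) p x + normCovForm (gk k t) (Hk k t) p x ≤ C₂ p) (x₀ : M) :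
    ∃ U ∈ nhds x₀, ∀ p q, ∃ c, ∀ k, ∀ x ∈ K, x ∈ U → ∀ t ∈ Icc β ψ,
      normTimeCovBilin a (gk k) q p x t + normTimeCovForm a (Hk k) q p x t ≤ c := by
  set e := chartAt (EuclideanSpace ℝ (Fin n)) x₀ with he_def
  have he : e ∈ atlas (EuclideanSpace ℝ (Fin n)) M := chart_mem_atlas _ x₀
  have hx₀ : x₀ ∈ e.source := mem_chart_source _ x₀
  obtain ⟨ε, hε, hεe⟩ := Metric.nhds_basis_closedBall.mem_iff.1
    (e.open_target.mem_nhds (e.map_source hx₀))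
  set L := Metric.closedBall (e x₀) ε with hL_def
  have hL : IsCompact L := isCompact_closedBall _ _
  -- Only the points of K carry bounds, and `S` need not be open. Derivatives are taken on the open
  -- chart domain of `W k`, estimates only over `S`.
  let S : Set (EuclideanSpace ℝ (Fin n)) := {y ∈ L | e.symm y ∈ K}
  have hS : ∀ k, S ×ˢ Icc β ψ ⊆ chartSpaceTime e (W k) := fun k z hz =>
    ⟨hεe hz.1.1, hKW k ⟨hz.1.2, hz.2⟩⟩
  have hsub : L ⊆ chartDom e univ := fun y hy => ⟨hεe hy, mem_univ _⟩
  obtain ⟨m, hm0, hm⟩ := exists_bound_of_isCompact hL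
    (f := fun i y => bilinComp e a y ![i, i])
    fun i => ((ha e he).smooth ![i, i]).continuousOn.mono hsub
  obtain ⟨c, hc0, hc⟩ := exists_bound_of_isCompact hL
    (f := fun i y => invMetric (bilinComp e a) y i i)
    fun i => ((ha e he).contDiffOn_invMetric i i).continuousOn.mono hsub
  -- From |v|² ≤ n c a(v,v) ≤ n c B g_k(v,v); adding 1 makes the constant positive, hence
  -- invertible.
  have hB' : 0 < n * c * B + 1 := by positivity
  have hsolution := localSolution_of_bounds hW hsol he hS (m := B * m)
    (c := (n * c * B + 1)⁻¹) (inv_pos.2 hB') (C₂ := C₂)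
    (fun k y hy t ht i => (hle k _ hy.2 t ht _).trans
      (mul_le_mul_of_nonneg_left (hm i y hy.1) hB))
    (fun k y hy t ht v => by
      rw [inv_mul_le_iff₀ hB']
      have hpk := (hsol k).posDef he (hS k (mk_mem_prod hy ht))
      have h1 := sum_sq_le_quad ((ha e he).posDef y (hsub hy.1)) (fun i => hc i y hy.1) v
      have h2 : quad (bilinComp e a) y v ≤ B * quad (bilinComp e (gk k t)) y v := by
        have h3 := quad_bilinComp e a y (WithLp.toLp 2 v)
        have h4 := quad_bilinComp e (gk k t) y (WithLp.toLp 2 v)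
        simp only at h3 h4
        rw [h3, h4]
        exact hge k _ hy.2 t ht _
      have h5 := quad_nonneg hpk v
      simp only at h5
      calc ∑ i, v i ^ 2 ≤ n * c * quad (bilinComp e a) y v := h1
        _ ≤ n * c * (B * quad (bilinComp e (gk k t)) y v) := by gcongr
        _ ≤ _ := by linarith)
    fun k p y hy t ht => h_bound k p _ hy.2 t ht
  set D := chartFamDomain e W hW S (Icc β ψ) hS
  have hinit := IsMetricField.jetBdd_of_normCovBilin_le (D := D.atTime t₀) (gk := gk) ha he hL hεe
    hW (fun k => Subset.rfl) (fun k z hz => hz.1.1.1) (fun k => (hsol k).smooth_metric e he)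
    (fun y hy i => hm i y hy) (C₁ := C₁)
    (fun I => by
      obtain ⟨b, hb, hb'⟩ := hsolution.metric_bdd I
      exact ⟨b, hb, fun k z hz => hb' k z hz.1⟩)
    (fun k p z hz => by
      have h1 : z.2 = t₀ := hz.2
      rw [h1]
      exact h_init k p _ hz.1.1.2)
  refine ⟨e.source ∩ e ⁻¹' Metric.ball (e x₀) ε,
    (e.isOpen_inter_preimage Metric.isOpen_ball).mem_nhds ⟨hx₀, Metric.mem_ball_self hε⟩,
    fun p q => ?_⟩
  have hjet := hsolution.timeJetBdd ht₀ hinit q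
  obtain ⟨c₁, hc₁⟩ := ha.exists_tensorNorm_iteratedDeriv_le he hL hεe (D := D)
    (fun k z hz => hz.1) (fun k z hz => hz.1.1) hjet.1 p
  obtain ⟨c₂, hc₂⟩ := ha.exists_tensorNorm_iteratedDeriv_le he hL hεe (D := D)
    (fun k z hz => hz.1) (fun k z hz => hz.1.1) hjet.2 p
  refine ⟨c₁ + c₂, fun k x hx hxU t ht => ?_⟩
  have hchart := chart_mem_atlas (EuclideanSpace ℝ (Fin n)) x
  have hcore : (e x, t) ∈ D.core k := ⟨⟨Metric.ball_subset_closedBall hxU.2, by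
    simpa only [e.left_inv hxU.1] using hx⟩, ht⟩
  refine add_le_add ((le_of_eq ?_).trans (hc₁ k _ hcore)) ((le_of_eq ?_).trans (hc₂ k _ hcore))
  · exact ha.tensorNorm_iteratedDeriv_eq hchart he (hW k) (hKW k ⟨hx, ht⟩)
      (mem_chart_source _ x) hxU.1 (T := fun s => bilinComp e (gk k s))
      ((hsol k).smooth_metric e he) (fun s => isPullback_bilinComp hchart he (gk k s)) p q
  · exact ha.tensorNorm_iteratedDeriv_eq hchart he (hW k) (hKW k ⟨hx, ht⟩)
      (mem_chart_source _ x) hxU.1 (T := fun s => formComp e (Hk k s))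
      ((hsol k).smooth_form e he) (fun s => isPullback_formComp hchart he (Hk k s)) p q

/-- Compactness is used here: the local constants are already uniform in k and t, so the maximum
over a finite subcover serves. -/
theorem exists_bound_of_nhds (hK : IsCompact K) {J : Set ℝ} {F : ι → M → ℝ → ℝ}
    (h : ∀ x₀, ∃ U ∈ nhds x₀, ∃ c, ∀ k, ∀ x ∈ K, x ∈ U → ∀ t ∈ J, F k x t ≤ c) :
    ∃ c, ∀ k, ∀ x ∈ K, ∀ t ∈ J, F k x t ≤ c := by
  have h1 : ∃ c, ∀ k, ∀ x ∈ K, x ∈ K → ∀ t ∈ J, F k x t ≤ c := by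
    refine hK.induction_on (p := fun s => ∃ c, ∀ k, ∀ x ∈ K, x ∈ s → ∀ t ∈ J, F k x t ≤ c)
      ⟨0, fun k x _ hx => hx.elim⟩ ?_ ?_ ?_
    · rintro s s' hs ⟨c, hc⟩
      exact ⟨c, fun k x hx hxs => hc k x hx (hs hxs)⟩
    · rintro s s' ⟨c, hc⟩ ⟨c', hc'⟩
      refine ⟨max c c', fun k x hx hxs t ht => ?_⟩
      rcases hxs with hxs | hxs
      · exact (hc k x hx hxs t ht).trans (le_max_left _ _)
      · exact (hc' k x hx hxs t ht).trans (le_max_right _ _)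
    · intro x _
      obtain ⟨U, hU, hc⟩ := h x
      exact ⟨U, mem_nhdsWithin_of_mem_nhds hU, hc⟩
  obtain ⟨c, hc⟩ := h1
  exact ⟨c, fun k x hx => hc k x hx hx⟩

/-- Uniform equivalence at one time, for all times. -/
theorem exp_equiv (ht₀ : t₀ ∈ Icc β ψ) (hKW : ∀ k, K ×ˢ Icc β ψ ⊆ W k)
    (hsol : ∀ k, IsSolutionOn (W k) (gk k) (Hk k)) {C c : ℝ}
    (h_equiv : ∀ k, ∀ x ∈ K, ∀ V : TangentSpace (𝓡 n) x,
      C⁻¹ * a x V V ≤ gk k t₀ x V V ∧ gk k t₀ x V V ≤ C * a x V V)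
    (hc : ∀ k, ∀ x ∈ K, ∀ t ∈ Icc β ψ,
      normCovRm (gk k t) 0 x + normCovForm (gk k t) (Hk k t) 0 x ≤ c)
    (k : ι) {x : M} (hx : x ∈ K) {t : ℝ} (ht : t ∈ Icc β ψ) (V : TangentSpace (𝓡 n) x) :
    (C * Real.exp ((2 * n * c + 1 / 2 * (n ^ 2 * c ^ 2)) * |t - t₀|))⁻¹ * a x V V
        ≤ gk k t x V V ∧
      gk k t x V V
        ≤ C * Real.exp ((2 * n * c + 1 / 2 * (n ^ 2 * c ^ 2)) * |t - t₀|) * a x V V := by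
  obtain ⟨h1, h2⟩ := (hsol k).exp_bounds (fun s hs => hKW k ⟨hx, hs⟩) ht₀ ht (hc k x hx) V
  obtain ⟨h3, h4⟩ := h_equiv k x hx V
  rw [Real.exp_neg] at h1
  set E := Real.exp ((2 * n * c + 1 / 2 * (n ^ 2 * c ^ 2)) * |t - t₀|)
  have hE : 0 < E := Real.exp_pos _
  constructor
  · refine le_trans ?_ h1
    rw [mul_inv, mul_comm C⁻¹, mul_assoc]
    exact mul_le_mul_of_nonneg_left h3 (inv_pos.2 hE).le
  · refine h2.trans ?_
    rw [mul_comm C, mul_assoc]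
    exact mul_le_mul_of_nonneg_left h4 hE.le

theorem exists_uniform_equiv (ha : ∀ x, ∀ V : TangentSpace (𝓡 n) x, 0 ≤ a x V V)
    (ht₀ : t₀ ∈ Icc β ψ) (hKW : ∀ k, K ×ˢ Icc β ψ ⊆ W k)
    (hsol : ∀ k, IsSolutionOn (W k) (gk k) (Hk k)) {C c : ℝ}
    (h_equiv : ∀ k, ∀ x ∈ K, ∀ V : TangentSpace (𝓡 n) x,
      C⁻¹ * a x V V ≤ gk k t₀ x V V ∧ gk k t₀ x V V ≤ C * a x V V)
    (hc : ∀ k, ∀ x ∈ K, ∀ t ∈ Icc β ψ,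
      normCovRm (gk k t) 0 x + normCovForm (gk k t) (Hk k t) 0 x ≤ c) :
    ∃ B : ℝ, 0 ≤ B ∧ ∀ k, ∀ x ∈ K, ∀ t ∈ Icc β ψ, ∀ V : TangentSpace (𝓡 n) x,
      gk k t x V V ≤ B * a x V V ∧ a x V V ≤ B * gk k t x V V := by
  set A := 2 * n * c + 1 / 2 * (n ^ 2 * c ^ 2) with hA
  refine ⟨|C| * Real.exp (|A| * (ψ - β)), by positivity, fun k x hx t ht V => ?_⟩
  by_cases hV : V = 0
  · subst hV; simp
  have hpos := (hsol k).pos x t (hKW k ⟨hx, ht⟩) V hV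
  have hpos₀ := (hsol k).pos x t₀ (hKW k ⟨hx, ht₀⟩) V hV
  -- Positivity of `C` is not assumed; a nonzero vector over K forces it through 0 < g_k(V,V) ≤ C
  -- g(V,V).
  have hC : 0 < C := by
    by_contra! h
    have := mul_nonpos_of_nonpos_of_nonneg h (ha x V)
    linarith [(h_equiv k x hx V).2]
  obtain ⟨h1, h2⟩ := exp_equiv ht₀ hKW hsol h_equiv hc k hx ht V
  rw [← hA] at h1 h2
  have hE : Real.exp (A * |t - t₀|) ≤ Real.exp (|A| * (ψ - β)) := by
    refine Real.exp_le_exp.2 (mul_le_mul (le_abs_self _) ?_ (abs_nonneg _) (abs_nonneg _))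
    rw [abs_le]
    constructor <;> linarith [ht.1, ht.2, ht₀.1, ht₀.2]
  have hCE : C * Real.exp (A * |t - t₀|) ≤ |C| * Real.exp (|A| * (ψ - β)) :=
    mul_le_mul (le_abs_self C) hE (Real.exp_pos _).le (abs_nonneg _)
  rw [inv_mul_le_iff₀ (by positivity)] at h1
  exact ⟨h2.trans (mul_le_mul_of_nonneg_right hCE (ha x V)),
    h1.trans (mul_le_mul_of_nonneg_right hCE hpos.le)⟩

end Global

end GRF

theorem lemma5p7 {n : ℕ} {M : Type*} [TopologicalSpace M]
    [ChartedSpace (EuclideanSpace ℝ (Fin n)) M] [IsManifold (𝓡 n) ∞ M]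
    -- the background metric
    (g : Bundle.ContMDiffRiemannianMetric (𝓡 n) ∞ (EuclideanSpace ℝ (Fin n))
      (fun x : M => TangentSpace (𝓡 n) x))
    (K : Set M) (hK : IsCompact K) (β ψ t₀ : ℝ) (ht₀ : t₀ ∈ Icc β ψ)
    -- the collection of solutions, each on a neighborhood of `K × [β, ψ]`
    {ι : Type*} (W : ι → Set (M × ℝ)) (hW : ∀ k, IsOpen (W k))
    (hKW : ∀ k, K ×ˢ Icc β ψ ⊆ W k)
    (gk : ι → ℝ → GRF.BilinField n M) (Hk : ι → ℝ → GRF.ThreeForm n M)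
    (hsol : ∀ k, GRF.IsSolutionOn (W k) (gk k) (Hk k))
    -- the metrics at time `t₀` are uniformly equivalent to `g` on `K`
    (C : ℝ)
    (h_equiv : ∀ k, ∀ x ∈ K, ∀ V : TangentSpace (𝓡 n) x,
      C⁻¹ * g.inner x V V ≤ gk k t₀ x V V ∧ gk k t₀ x V V ≤ C * g.inner x V V)
    -- uniform bounds on the background derivatives at time `t₀`
    (C₁ : ℕ → ℝ)
    (h_init : ∀ k, ∀ p : ℕ, ∀ x ∈ K,
      GRF.normCovBilin g.inner (gk k t₀) (p + 1) x
        + GRF.normCovForm g.inner (Hk k t₀) p x ≤ C₁ (p + 1))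
    -- uniform bounds on the intrinsic derivatives of curvature and of the 3-forms
    (C₂ : ℕ → ℝ)
    (h_bound : ∀ k, ∀ p : ℕ, ∀ x ∈ K, ∀ t ∈ Icc β ψ,
      GRF.normCovRm (gk k t) p x + GRF.normCovForm (gk k t) (Hk k t) p x ≤ C₂ p) :
    (∃ C' : ℝ, ∀ k, ∀ x ∈ K, ∀ t ∈ Icc β ψ, ∀ V : TangentSpace (𝓡 n) x,
      (C * Real.exp (C' * |t - t₀|))⁻¹ * g.inner x V V ≤ gk k t x V V ∧
        gk k t x V V ≤ C * Real.exp (C' * |t - t₀|) * g.inner x V V) ∧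
    (∃ Ctilde : ℕ → ℕ → ℝ, ∀ p q : ℕ, ∀ k, ∀ x ∈ K, ∀ t ∈ Icc β ψ,
      GRF.normTimeCovBilin g.inner (gk k) q p x t
        + GRF.normTimeCovForm g.inner (Hk k) q p x t ≤ Ctilde p q) := by
  have hg0 : ∀ x, ∀ V : TangentSpace (𝓡 n) x, 0 ≤ g.inner x V V := fun x V => by
    by_cases hV : V = 0
    · subst hV; simp
    · exact (g.pos x V hV).le
  have hc := fun k x hx t ht => h_bound k 0 x hx t ht
  refine ⟨⟨_, fun k x hx t ht V => GRF.exp_equiv ht₀ hKW hsol h_equiv hc k hx ht V⟩, ?_⟩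
  obtain ⟨B, hB, hBeq⟩ := GRF.exists_uniform_equiv hg0 ht₀ hKW hsol h_equiv hc
  have hloc := GRF.exists_nhds_bound (GRF.isMetricField_background g) ht₀ hW hKW hsol hB
    (fun k x hx t ht V => (hBeq k x hx t ht V).1) (fun k x hx t ht V => (hBeq k x hx t ht V).2)
    (C₁ := C₁) (fun k p x hx => (le_add_of_nonneg_right (GRF.tensorNorm_nonneg _ _ _)).trans
      (h_init k p x hx)) h_bound
  have hglob : ∀ p q, ∃ c, ∀ k, ∀ x ∈ K, ∀ t ∈ Icc β ψ,
      GRF.normTimeCovBilin g.inner (gk k) q p x t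
        + GRF.normTimeCovForm g.inner (Hk k) q p x t ≤ c := fun p q =>
    GRF.exists_bound_of_nhds hK fun x₀ => by
      obtain ⟨U, hU, h⟩ := hloc x₀
      exact ⟨U, hU, h p q⟩
  choose Ctilde hCt using hglob
  exact ⟨Ctilde, hCt⟩
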